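/- **Theorem 1.3.** Conventions. A weighted graph on a vertex set $V$ assigns a real weight $G(x,y)=G(y,x)$ to each pair of (possibly equal) vertices; a graph is simple and is regarded as a weighted graph with weights $0$ and $1$. Let $e_G(X,Y)=\sum_{x\in X,\,y\in Y}G(x,y)$ for $X,Y\subseteq V$, let $d(G)=e_G(V,V)/|V|^2$, and let $$d_\square(G,H)=\max_{U,W\subseteq V}\frac{|e_G(U,W)-e_H(U,W)|}{|V|^2}.$$ A real number $c$ also denotes the weighted graph in which all weights are $c$. Addition and multiplication by reals are pointwise. $K_{S,T}$ is the weighted graph in which $\{s,t\}$ has weight $1$ if one of its ends is in $S$ and the other is in $T$, weight $2$ if $s,t\in S\cap T$, and weight $0$ otherwise. There are absolute constants $C,k$ and a deterministic algorithm which, given a real number $\epsilon>0$ and a graph $G$ on $n\ge 1$ vertices (by its adjacency matrix), runs in time at most $C\max(1,\epsilon^{-1})^{k}\,n^2$ and outputs subsets $S_1,\dots,S_r,T_1,\dots,T_r\subseteq V(G)$ and coefficients $c_1,\dots,c_r\in\{-\frac{\epsilon^8}{300},\frac{\epsilon^8}{300}\}$, for some $r\le C\epsilon^{-16}$, such that $$d_\square\bigl(G,\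 d(G)+c_1K_{S_1,T_1}+\dots+c_rK_{S_r,T_r}\bigr)\le\epsilon .$$ Here an algorithm is a fixed program for a word RAM: registers and arrays hold integers of absolute value at most $C(\max(1,\epsilon^{-1})\,n)^{k}$ (words of $O(\log(n\max(1,\epsilon^{-1}))+1)$ bits), and each arithmetic operation ($+,-,\cdot$, integer division), comparison, branch and memory access takes one step. The real number $\epsilon$ is accessed only through tests whether $a\epsilon\le b$, for words $a,b$, one step each. The sets are output as lists of $0/1$-vectors, and each $c_i$ by its sign. -/

import Mathlib

namespace CutGraph

/-! ### Weighted graphs and the cut distance -/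

/-- An edge-weighted graph on `V`: a real weight for every unordered pair of (possibly equal)
vertices, weight `0` meaning that there is no edge. Addition and multiplication by real numbers
are pointwise. -/
abbrev WGraph (V : Type*) := Sym2 V → ℝ

open Classical in
/-- A simple graph as a weighted graph with weights `0` and `1`. -/
noncomputable def ofGraph {V : Type*} (G : SimpleGraph V) : WGraph V :=
  fun z => if z ∈ G.edgeSet then 1 else 0

/-- The constant weighted graph (on all pairs, also on the pairs `{v, v}`). -/
def const (V : Type*) (c : ℝ) : WGraph V := fun _ => c

/-- The weighted graph `K_{S,T}`: the pair `{s, t}` has weight `1` if one of its ends lies in `S`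
and the other one in `T`, weight `2` if this holds both ways round, that is, if `s` and `t` both
lie in `S ∩ T`, and weight `0` otherwise. -/
def cutGraph {V : Type*} [DecidableEq V] (S T : Finset V) : WGraph V :=
  Sym2.lift ⟨fun s t => (if s ∈ S ∧ t ∈ T then (1 : ℝ) else 0) + (if t ∈ S ∧ s ∈ T then 1 else 0),
    fun _ _ => add_comm _ _⟩

/-- `e_G(X, Y)`: the sum of the weights over the ordered pairs in `X × Y`. -/
def edgeSum {V : Type*} (G : WGraph V) (X Y : Finset V) : ℝ :=
  ∑ x ∈ X, ∑ y ∈ Y, G s(x, y)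

/-- `d(G) = e_G(V, V) / |V|²`. -/
noncomputable def density {V : Type*} [Fintype V] (G : WGraph V) : ℝ :=
  edgeSum G Finset.univ Finset.univ / (Fintype.card V : ℝ) ^ 2

/-- The cut distance `max_{U, W ⊆ V} |e_G(U, W) - e_H(U, W)| / |V|²` (the supremum is over a
finite nonempty family, hence a maximum). -/
noncomputable def cutDist {V : Type*} [Fintype V] (G H : WGraph V) : ℝ :=
  ⨆ p : Finset V × Finset V,
    |edgeSum G p.1 p.2 - edgeSum H p.1 p.2| / (Fintype.card V : ℝ) ^ 2

/-! ### Programs for a word RAM, with a step count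

The machine has integer registers and integer arrays (random access memory). A program is a finite
text that does not depend on the input. Each arithmetic operation, comparison and memory access
takes one step. All numbers that occur must have absolute value at most `W` (machine words of
`O(log W)` bits). The real parameter `ε` cannot be stored in a word; the program has access to it
through the test whether `a * ε ≤ b`, for words `a` and `b`, which takes one step. -/

/-- Contents of the registers `vars x` and of the array cells `arrs a i`. -/
structure State where
  vars : ℕ → ℤ
  arrs : ℕ → ℕ → ℤ

/-- Expressions. `get a i` is the cell of the array `a` at the computed address `i`; `lt a b` and
`epsLe a b` are tests with value `1` (true) or `0` (false). -/
inductive Expr where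
  | lit (c : ℤ)
  | var (x : ℕ)
  | get (a : ℕ) (i : Expr)
  | add (e f : Expr)
  | sub (e f : Expr)
  | mul (e f : Expr)
  | div (e f : Expr)
  | lt (e f : Expr)
  | epsLe (e f : Expr)

/-- Time to evaluate an expression: one step for each node. -/
def Expr.cost : Expr → ℕ
  | lit _ => 1
  | var _ => 1
  | get _ i => i.cost + 1
  | add e f => e.cost + f.cost + 1
  | sub e f => e.cost + f.cost + 1
  | mul e f => e.cost + f.cost + 1
  | div e f => e.cost + f.cost + 1
  | lt e f => e.cost + f.cost + 1
  | epsLe e f => e.cost + f.cost + 1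

open Classical in
/-- Value of an expression (meaningful if the evaluation is `Safe`, see below). -/
noncomputable def Expr.val (ε : ℝ) (σ : State) : Expr → ℤ
  | lit c => c
  | var x => σ.vars x
  | get a i => σ.arrs a (i.val ε σ).toNat
  | add e f => e.val ε σ + f.val ε σ
  | sub e f => e.val ε σ - f.val ε σ
  | mul e f => e.val ε σ * f.val ε σ
  | div e f => e.val ε σ / f.val ε σ
  | lt e f => if e.val ε σ < f.val ε σ then 1 else 0
  | epsLe e f => if (e.val ε σ : ℝ) * ε ≤ (f.val ε σ : ℝ) then 1 else 0

/-- The evaluation meets no fault: every value on the way has absolute value at most `W`,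
addresses are nonnegative and divisors nonzero. -/
def Expr.Safe (W : ℕ) (ε : ℝ) (σ : State) : Expr → Prop
  | lit c => |c| ≤ W
  | var x => |σ.vars x| ≤ W
  | get a i => i.Safe W ε σ ∧ 0 ≤ i.val ε σ ∧ |σ.arrs a (i.val ε σ).toNat| ≤ W
  | add e f => e.Safe W ε σ ∧ f.Safe W ε σ ∧ |e.val ε σ + f.val ε σ| ≤ W
  | sub e f => e.Safe W ε σ ∧ f.Safe W ε σ ∧ |e.val ε σ - f.val ε σ| ≤ W
  | mul e f => e.Safe W ε σ ∧ f.Safe W ε σ ∧ |e.val ε σ * f.val ε σ| ≤ W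
  | div e f => e.Safe W ε σ ∧ f.Safe W ε σ ∧ f.val ε σ ≠ 0 ∧ |e.val ε σ / f.val ε σ| ≤ W
  | lt e f => e.Safe W ε σ ∧ f.Safe W ε σ
  | epsLe e f => e.Safe W ε σ ∧ f.Safe W ε σ

/-- Programs. `put a i e` stores the value of `e` in the array `a` at the address `i`; `ite` and
`loop` (while) branch on whether the value of an expression is nonzero. -/
inductive Prog where
  | skip
  | assign (x : ℕ) (e : Expr)
  | put (a : ℕ) (i e : Expr)
  | seq (p q : Prog)
  | ite (e : Expr) (p q : Prog)
  | loop (e : Expr) (p : Prog)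

/-- Store `v` in the register `x`. -/
def State.setVar (σ : State) (x : ℕ) (v : ℤ) : State :=
  { σ with vars := Function.update σ.vars x v }

/-- Store `v` in the array `a` at the address `i`. -/
def State.setCell (σ : State) (a i : ℕ) (v : ℤ) : State :=
  { σ with arrs := Function.update σ.arrs a (Function.update (σ.arrs a) i v) }

/-- `Exec W ε p σ t τ`: started in the state `σ`, the program `p` halts without a fault after
exactly `t` steps, in the state `τ`, using only numbers of absolute value at most `W`. -/
inductive Exec (W : ℕ) (ε : ℝ) : Prog → State → ℕ → State → Prop where
  | skip (σ : State) : Exec W ε .skip σ 1 σ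
  | assign (σ : State) (x : ℕ) (e : Expr) (he : e.Safe W ε σ) :
      Exec W ε (.assign x e) σ (e.cost + 1) (σ.setVar x (e.val ε σ))
  | put (σ : State) (a : ℕ) (i e : Expr) (hi : i.Safe W ε σ) (he : e.Safe W ε σ)
      (hpos : 0 ≤ i.val ε σ) :
      Exec W ε (.put a i e) σ (i.cost + e.cost + 1)
        (σ.setCell a (i.val ε σ).toNat (e.val ε σ))
  | seq {p q : Prog} {σ₁ σ₂ σ₃ : State} {t₁ t₂ : ℕ} (hp : Exec W ε p σ₁ t₁ σ₂)
      (hq : Exec W ε q σ₂ t₂ σ₃) : Exec W ε (.seq p q) σ₁ (t₁ + t₂) σ₃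
  | iteTrue {e : Expr} {p q : Prog} {σ τ : State} {t : ℕ} (hs : e.Safe W ε σ)
      (he : e.val ε σ ≠ 0) (hp : Exec W ε p σ t τ) :
      Exec W ε (.ite e p q) σ (e.cost + 1 + t) τ
  | iteFalse {e : Expr} {p q : Prog} {σ τ : State} {t : ℕ} (hs : e.Safe W ε σ)
      (he : e.val ε σ = 0) (hq : Exec W ε q σ t τ) :
      Exec W ε (.ite e p q) σ (e.cost + 1 + t) τ
  | loopDone {e : Expr} {p : Prog} {σ : State} (hs : e.Safe W ε σ) (he : e.val ε σ = 0) :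
      Exec W ε (.loop e p) σ (e.cost + 1) σ
  | loopStep {e : Expr} {p : Prog} {σ₁ σ₂ σ₃ : State} {t₁ t₂ : ℕ} (hs : e.Safe W ε σ₁)
      (he : e.val ε σ₁ ≠ 0) (hp : Exec W ε p σ₁ t₁ σ₂) (hl : Exec W ε (.loop e p) σ₂ t₂ σ₃) :
      Exec W ε (.loop e p) σ₁ (e.cost + 1 + t₁ + t₂) σ₃

/-- Programs are deterministic: running time and final state are determined by the program, `ε`
and the initial state (and do not depend on the word bound). -/
theorem Exec.deterministic {W W' : ℕ} {ε : ℝ} {p : Prog} {σ τ τ' : State} {t t' : ℕ}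
    (h : Exec W ε p σ t τ) (h' : Exec W' ε p σ t' τ') : t = t' ∧ τ = τ' := by
  induction h generalizing W' t' τ' with
  | skip => cases h'; exact ⟨rfl, rfl⟩
  | assign => cases h'; exact ⟨rfl, rfl⟩
  | put => cases h'; exact ⟨rfl, rfl⟩
  | seq _ _ ih₁ ih₂ =>
    cases h' with
    | seq hp hq =>
      obtain ⟨rfl, rfl⟩ := ih₁ hp
      obtain ⟨rfl, rfl⟩ := ih₂ hq
      exact ⟨rfl, rfl⟩
  | iteTrue _ he _ ih =>
    cases h' with
    | iteTrue _ _ hp => obtain ⟨rfl, rfl⟩ := ih hp; exact ⟨rfl, rfl⟩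
    | iteFalse _ he' _ => exact absurd he' he
  | iteFalse _ he _ ih =>
    cases h' with
    | iteTrue _ he' _ => exact absurd he he'
    | iteFalse _ _ hp => obtain ⟨rfl, rfl⟩ := ih hp; exact ⟨rfl, rfl⟩
  | loopDone _ he =>
    cases h' with
    | loopDone => exact ⟨rfl, rfl⟩
    | loopStep _ he' => exact absurd he he'
  | loopStep _ he _ _ ih₁ ih₂ =>
    cases h' with
    | loopDone _ he' => exact absurd he' he
    | loopStep _ _ hp hl =>
      obtain ⟨rfl, rfl⟩ := ih₁ hp
      obtain ⟨rfl, rfl⟩ := ih₂ hl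
      exact ⟨rfl, rfl⟩

/-! ### Input and output -/

open Classical in
/-- The initial state for a graph on `{0, …, n - 1}`: register `0` holds `n`, array `0` holds the
adjacency matrix, row by row, and everything else is `0`. -/
noncomputable def input {n : ℕ} (G : SimpleGraph (Fin n)) : State where
  vars x := if x = 0 then n else 0
  arrs a k := if a = 0 ∧ ∃ i j : Fin n, G.Adj i j ∧ k = i * n + j then 1 else 0

/-- The set of vertices listed by the `i`-th row (of length `n`) of the 0/1-array `a`. -/
def State.row (τ : State) (n a i : ℕ) : Finset (Fin n) :=
  Finset.univ.filter fun v : Fin n => τ.arrs a (i * n + v) = 1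

/-- How the output is read off the final state `τ`: the number `r` of terms is in register `0`,
the sign of `c i` (as `1` or `-1`, in units of `ε ^ 8 / 300`) is in cell `i` of array `1`, and the
rows of arrays `2` and `3` list the sets `S i` and `T i`. -/
def IsOutput {n r : ℕ} (ε : ℝ) (τ : State) (c : Fin r → ℝ) (S T : Fin r → Finset (Fin n)) :
    Prop :=
  τ.vars 0 = r ∧ ∀ i : Fin r,
    c i = τ.arrs 1 i * (ε ^ 8 / 300) ∧ S i = τ.row n 2 i ∧ T i = τ.row n 3 i

end CutGraph

/-! Scaling. Let m be the least power of two with mε ≥ 1 and a = 2^16 m^17 (the case ε ≥ 1 needs no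
terms). The adjacency matrix is multiplied by Q = 300 a^8 and the rounded number Q d(G) is
subtracted. The coefficient ε^8/300 becomes (aε)^8, which the program replaces by the integer h =
p^8, p = ⌈aε⌉. Then ± h K_{S,T} is subtracted from the current matrix A as long as a large cut is
found in the truncation of A to [-L, L], where L = 4mQ.

Progress. The potential is the sum of a Huber function of the entries, whose derivative is twice the
truncation. Subtracting a cut on which the truncation sums to at least 2hn² in absolute value lowers
the potential by at least 4h²n² (`energy_sub_le`). It starts at no more than Q²n² and is never
negative, so at most Q²/(4h²) ≤ 22500 ε^{-16} cuts are found. At the end, the part of A removed by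
truncation contributes at most potential/(2L) ≤ εQn²/8 to any cut. Truncation matters because the
entries of A can grow with the number of rounds, while the accuracy needed to detect cuts depends on
the fourth power of the entry bound.

Detection. Let T have entries bounded by L and a cut (X, Y) of absolute value at least βn². Let g be
the sum of the rows in X. By Cauchy-Schwarz ‖g‖² ≥ β²n³. Since ‖g‖² is the sum of Tg over X, a
second application gives Σ_v (Tg)_v² ≥ β⁴n⁵. Here (Tg)_v is the sum of the inner products of the row
v with the rows in X, so some row v has a large total correlation with X. On the other hand, take
the rows whose inner product with v has a given sign, and the columns where the sum of these rows
has a given sign. If the four cuts obtained in this way are all small and T is symmetric, then v has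
small correlation with every X (`NoCut.abs_sum_dot_le`). Hence testing four cuts per row finds a
large cut.

Sampling. A test costs about n² steps, so only a number of rows independent of n can be tested. Now
(Tg)_v² is the inner product of the tensor squares of the row v and of g. So it suffices to have a
short list of rows whose average tensor square is close in norm to the average over all rows
(`exists_large_correlation`). Such a list is found deterministically by thinning. Each round keeps
one of every four rows, chosen so that the new error vector has nonpositive inner product with the
errors accumulated in the same block, and squared norms then grow only additively
(`norm_sum_sq_le_of_inner_nonpos`). The choice requires only squared inner products of rows. As the
list shrinks by a factor of four the block size doubles, so the work halves in each round and the
errors telescope (`Represents.step`, `ends_sample`).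

The machine. Running time is counted in loop iterations, and the word size follows from one bound B
on all stored values (`Run.exec`). `Params.cut_small` and `Params.coeff_error` check that the
numerical parameters fit together. -/

namespace CutGraph

/-! ### A program logic with bounded values and a count of loop iterations -/

/-- All registers and cells have absolute value at most `B`. -/
def State.Bdd (σ : State) (B : ℕ) : Prop :=
  (∀ x, |σ.vars x| ≤ B) ∧ ∀ a i, |σ.arrs a i| ≤ B

/-- The evaluation of the expression meets nonnegative addresses and nonzero divisors only. -/
def Expr.Ok (ε : ℝ) (σ : State) : Expr → Prop
  | lit _ => True
  | var _ => True
  | get _ i => i.Ok ε σ ∧ 0 ≤ i.val ε σ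
  | add e f => e.Ok ε σ ∧ f.Ok ε σ
  | sub e f => e.Ok ε σ ∧ f.Ok ε σ
  | mul e f => e.Ok ε σ ∧ f.Ok ε σ
  | div e f => e.Ok ε σ ∧ f.Ok ε σ ∧ f.val ε σ ≠ 0
  | lt e f => e.Ok ε σ ∧ f.Ok ε σ
  | epsLe e f => e.Ok ε σ ∧ f.Ok ε σ

/-- A bound for all numbers met in the evaluation of the expression, in a state bounded by `B`. -/
def Expr.bnd (B : ℕ) : Expr → ℕ
  | lit c => c.natAbs
  | var _ => B
  | get _ i => i.bnd B + B
  | add e f => e.bnd B + f.bnd B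
  | sub e f => e.bnd B + f.bnd B
  | mul e f => e.bnd B * f.bnd B + e.bnd B + f.bnd B
  | div e f => e.bnd B + f.bnd B
  | lt e f => e.bnd B + f.bnd B + 1
  | epsLe e f => e.bnd B + f.bnd B + 1

theorem Expr.abs_val_le {ε : ℝ} {σ : State} {B : ℕ} (hσ : σ.Bdd B) :
    ∀ e : Expr, |e.val ε σ| ≤ e.bnd B
  | lit c => by simp [val, bnd]
  | var x => hσ.1 x
  | get a i => by
      simp only [val, bnd]; push_cast
      exact (hσ.2 _ _).trans (by omega)
  | add e f => by
      simp only [val, bnd]; push_cast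
      exact (abs_add_le _ _).trans (add_le_add (abs_val_le hσ e) (abs_val_le hσ f))
  | sub e f => by
      simp only [val, bnd]; push_cast
      exact (abs_sub _ _).trans (add_le_add (abs_val_le hσ e) (abs_val_le hσ f))
  | mul e f => by
      simp only [val, bnd]; push_cast
      have h := mul_le_mul (abs_val_le (ε := ε) hσ e) (abs_val_le (ε := ε) hσ f) (abs_nonneg _) (by positivity)
      rw [abs_mul]; omega
  | div e f => by
      simp only [val, bnd]; push_cast
      exact (Int.abs_ediv_le_abs _ _).trans ((abs_val_le hσ e).trans (by omega))
  | lt e f => by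
      simp only [val, bnd]; push_cast
      split_ifs <;> simp <;> omega
  | epsLe e f => by
      simp only [val, bnd]; push_cast
      split_ifs <;> simp <;> omega

theorem Expr.safe_of_ok {ε : ℝ} {σ : State} {B W : ℕ} (hσ : σ.Bdd B) :
    ∀ e : Expr, e.Ok ε σ → e.bnd B ≤ W → e.Safe W ε σ
  | lit c, _, hW => by
      simp only [Safe, bnd, Int.abs_eq_natAbs] at *
      exact_mod_cast hW
  | var x, _, hW => (hσ.1 x).trans (by exact_mod_cast hW)
  | get a i, h, hW => by
      simp only [bnd] at hW
      exact ⟨safe_of_ok hσ i h.1 (by omega), h.2, (hσ.2 _ _).trans (by omega)⟩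
  | add e f, h, hW => by
      have hv := (add e f).abs_val_le (ε := ε) hσ
      simp only [bnd] at hW
      exact ⟨safe_of_ok hσ e h.1 (by omega), safe_of_ok hσ f h.2 (by omega),
        hv.trans (by simp only [bnd]; exact_mod_cast hW)⟩
  | sub e f, h, hW => by
      have hv := (sub e f).abs_val_le (ε := ε) hσ
      simp only [bnd] at hW
      exact ⟨safe_of_ok hσ e h.1 (by omega), safe_of_ok hσ f h.2 (by omega),
        hv.trans (by simp only [bnd]; exact_mod_cast hW)⟩
  | mul e f, h, hW => by
      have hv := (mul e f).abs_val_le (ε := ε) hσ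
      simp only [bnd] at hW
      have := Nat.zero_le (e.bnd B * f.bnd B)
      exact ⟨safe_of_ok hσ e h.1 (by omega), safe_of_ok hσ f h.2 (by omega),
        hv.trans (by simp only [bnd]; exact_mod_cast hW)⟩
  | div e f, h, hW => by
      have hv := (div e f).abs_val_le (ε := ε) hσ
      simp only [bnd] at hW
      exact ⟨safe_of_ok hσ e h.1 (by omega), safe_of_ok hσ f h.2.1 (by omega), h.2.2,
        hv.trans (by simp only [bnd]; exact_mod_cast hW)⟩
  | lt e f, h, hW => by
      simp only [bnd] at hW
      exact ⟨safe_of_ok hσ e h.1 (by omega), safe_of_ok hσ f h.2 (by omega)⟩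
  | epsLe e f, h, hW => by
      simp only [bnd] at hW
      exact ⟨safe_of_ok hσ e h.1 (by omega), safe_of_ok hσ f h.2 (by omega)⟩

theorem State.Bdd.setVar {σ : State} {B : ℕ} (hσ : σ.Bdd B) {x : ℕ} {v : ℤ} (hv : |v| ≤ B) :
    (σ.setVar x v).Bdd B := by
  refine ⟨fun y => ?_, hσ.2⟩
  by_cases h : y = x
  · subst h; simpa [State.setVar] using hv
  · simpa [State.setVar, h] using hσ.1 y

theorem State.Bdd.setCell {σ : State} {B : ℕ} (hσ : σ.Bdd B) {a i : ℕ} {v : ℤ} (hv : |v| ≤ B) :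
    (σ.setCell a i v).Bdd B := by
  refine ⟨hσ.1, fun b j => ?_⟩
  by_cases h : b = a
  · subst h
    by_cases h' : j = i
    · subst h'; simpa [State.setCell] using hv
    · simpa [State.setCell, h'] using hσ.2 b j
  · simpa [State.setCell, h] using hσ.2 b j

/-- A bound for all numbers met by the program, in states bounded by `B`. -/
def Prog.bnd (B : ℕ) : Prog → ℕ
  | skip => 0
  | assign _ e => e.bnd B
  | put _ i e => i.bnd B + e.bnd B
  | seq p q => p.bnd B + q.bnd B
  | ite e p q => e.bnd B + p.bnd B + q.bnd B
  | loop e p => e.bnd B + p.bnd B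

/-- The running time is at most this constant times one plus the number of loop iterations. -/
def Prog.unitCost : Prog → ℕ
  | skip => 1
  | assign _ e => e.cost + 1
  | put _ i e => i.cost + e.cost + 1
  | seq p q => p.unitCost + q.unitCost
  | ite e p q => e.cost + 1 + p.unitCost + q.unitCost
  | loop e p => e.cost + 1 + p.unitCost

/-- `Run B ε p σ k τ`: started in `σ`, the program `p` halts in the state `τ` after `k` iterations
of loops (those of inner loops included), storing only numbers of absolute value at most `B`. -/
inductive Run (B : ℕ) (ε : ℝ) : Prog → State → ℕ → State → Prop where
  | skip (σ : State) : Run B ε .skip σ 0 σ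
  | assign (σ : State) (x : ℕ) (e : Expr) (he : e.Ok ε σ) (hB : |e.val ε σ| ≤ B) :
      Run B ε (.assign x e) σ 0 (σ.setVar x (e.val ε σ))
  | put (σ : State) (a : ℕ) (i e : Expr) (hi : i.Ok ε σ) (he : e.Ok ε σ)
      (hpos : 0 ≤ i.val ε σ) (hB : |e.val ε σ| ≤ B) :
      Run B ε (.put a i e) σ 0 (σ.setCell a (i.val ε σ).toNat (e.val ε σ))
  | seq {p q : Prog} {σ₁ σ₂ σ₃ : State} {t₁ t₂ : ℕ} (hp : Run B ε p σ₁ t₁ σ₂)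
      (hq : Run B ε q σ₂ t₂ σ₃) : Run B ε (.seq p q) σ₁ (t₁ + t₂) σ₃
  | iteTrue {e : Expr} {p q : Prog} {σ τ : State} {t : ℕ} (hs : e.Ok ε σ)
      (he : e.val ε σ ≠ 0) (hp : Run B ε p σ t τ) : Run B ε (.ite e p q) σ t τ
  | iteFalse {e : Expr} {p q : Prog} {σ τ : State} {t : ℕ} (hs : e.Ok ε σ)
      (he : e.val ε σ = 0) (hq : Run B ε q σ t τ) : Run B ε (.ite e p q) σ t τ
  | loopDone {e : Expr} {p : Prog} {σ : State} (hs : e.Ok ε σ) (he : e.val ε σ = 0) :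
      Run B ε (.loop e p) σ 0 σ
  | loopStep {e : Expr} {p : Prog} {σ₁ σ₂ σ₃ : State} {t₁ t₂ : ℕ} (hs : e.Ok ε σ₁)
      (he : e.val ε σ₁ ≠ 0) (hp : Run B ε p σ₁ t₁ σ₂) (hl : Run B ε (.loop e p) σ₂ t₂ σ₃) :
      Run B ε (.loop e p) σ₁ (1 + t₁ + t₂) σ₃

/-- Between two loop iterations only a bounded piece of straight-line code is executed, so the exact
step count is at most a constant of the program times one plus the iterations. Likewise,
intermediate values are polynomial in the stored ones. After this lemma neither single steps nor
intermediate values need to be tracked. -/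
theorem Run.exec {B W : ℕ} {ε : ℝ} {p : Prog} {σ τ : State} {k : ℕ} (h : Run B ε p σ k τ)
    (hσ : σ.Bdd B) (hW : p.bnd B ≤ W) :
    ∃ t, Exec W ε p σ t τ ∧ t ≤ p.unitCost * (1 + k) ∧ τ.Bdd B := by
  induction h with
  | skip σ => exact ⟨1, .skip σ, by simp [Prog.unitCost], hσ⟩
  | assign σ x e he hB =>
    exact ⟨_, .assign σ x e (e.safe_of_ok hσ he hW), by simp [Prog.unitCost], hσ.setVar hB⟩
  | put σ a i e hi he hpos hB =>
    simp only [Prog.bnd] at hW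
    exact ⟨_, .put σ a i e (i.safe_of_ok hσ hi (by omega)) (e.safe_of_ok hσ he (by omega)) hpos,
      by simp [Prog.unitCost], hσ.setCell hB⟩
  | seq hp hq ihp ihq =>
    simp only [Prog.bnd] at hW
    obtain ⟨t₁, h₁, ht₁, hσ₁⟩ := ihp hσ (by omega)
    obtain ⟨t₂, h₂, ht₂, hσ₂⟩ := ihq hσ₁ (by omega)
    exact ⟨_, .seq h₁ h₂, by simp only [Prog.unitCost]; nlinarith, hσ₂⟩
  | iteTrue hs he hp ih =>
    simp only [Prog.bnd] at hW
    obtain ⟨t, h, ht, hτ⟩ := ih hσ (by omega)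
    exact ⟨_, .iteTrue (Expr.safe_of_ok hσ _ hs (by omega)) he h,
      by simp only [Prog.unitCost]; nlinarith, hτ⟩
  | iteFalse hs he hp ih =>
    simp only [Prog.bnd] at hW
    obtain ⟨t, h, ht, hτ⟩ := ih hσ (by omega)
    exact ⟨_, .iteFalse (Expr.safe_of_ok hσ _ hs (by omega)) he h,
      by simp only [Prog.unitCost]; nlinarith, hτ⟩
  | loopDone hs he =>
    simp only [Prog.bnd] at hW
    exact ⟨_, .loopDone (Expr.safe_of_ok hσ _ hs (by omega)) he,
      by simp only [Prog.unitCost]; omega, hσ⟩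
  | loopStep hs he hp hl ihp ihl =>
    have hW' := hW
    simp only [Prog.bnd] at hW
    obtain ⟨t₁, h₁, ht₁, hσ₁⟩ := ihp hσ (by omega)
    obtain ⟨t₂, h₂, ht₂, hσ₂⟩ := ihl hσ₁ hW'
    exact ⟨_, .loopStep (Expr.safe_of_ok hσ _ hs (by omega)) he h₁ h₂,
      by simp only [Prog.unitCost] at *; nlinarith, hσ₂⟩

/-- The function is at most a polynomial, on positive arguments. -/
def PolyBounded (f : ℕ → ℕ) : Prop := ∃ K : ℕ, ∀ B, 1 ≤ B → f B ≤ K * B ^ K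

/-! ### Polynomial growth of the word bound of a fixed program. -/

namespace PolyBounded

theorem const (c : ℕ) : PolyBounded fun _ => c :=
  ⟨c, fun _ hB => Nat.le_mul_of_pos_right _ (pow_pos hB _)⟩

theorem id : PolyBounded fun B => B := ⟨1, fun _ _ => by simp⟩

theorem add {f g : ℕ → ℕ} (hf : PolyBounded f) (hg : PolyBounded g) :
    PolyBounded fun B => f B + g B := by
  obtain ⟨K, hK⟩ := hf
  obtain ⟨M, hM⟩ := hg
  refine ⟨K + M, fun B hB => (add_le_add (hK B hB) (hM B hB)).trans ?_⟩
  rw [add_mul]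
  gcongr <;> omega

theorem mul {f g : ℕ → ℕ} (hf : PolyBounded f) (hg : PolyBounded g) :
    PolyBounded fun B => f B * g B := by
  obtain ⟨K, hK⟩ := hf
  obtain ⟨M, hM⟩ := hg
  refine ⟨K * M + (K + M), fun B hB => (Nat.mul_le_mul (hK B hB) (hM B hB)).trans ?_⟩
  calc K * B ^ K * (M * B ^ M) = K * M * B ^ (K + M) := by ring
    _ ≤ (K * M + (K + M)) * B ^ (K * M + (K + M)) :=
      Nat.mul_le_mul (Nat.le_add_right _ _) (Nat.pow_le_pow_right hB (Nat.le_add_left _ _))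

end PolyBounded

theorem Expr.polyBounded_bnd : ∀ e : Expr, PolyBounded fun B => e.bnd B
  | lit _ => .const _
  | var _ => .id
  | get _ i => i.polyBounded_bnd.add .id
  | add e f => e.polyBounded_bnd.add f.polyBounded_bnd
  | sub e f => e.polyBounded_bnd.add f.polyBounded_bnd
  | mul e f =>
    ((e.polyBounded_bnd.mul f.polyBounded_bnd).add e.polyBounded_bnd).add f.polyBounded_bnd
  | div e f => e.polyBounded_bnd.add f.polyBounded_bnd
  | lt e f => (e.polyBounded_bnd.add f.polyBounded_bnd).add (.const 1)
  | epsLe e f => (e.polyBounded_bnd.add f.polyBounded_bnd).add (.const 1)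

theorem Prog.polyBounded_bnd : ∀ p : Prog, PolyBounded fun B => p.bnd B
  | skip => .const 0
  | assign _ e => e.polyBounded_bnd
  | put _ i e => i.polyBounded_bnd.add e.polyBounded_bnd
  | seq p q => p.polyBounded_bnd.add q.polyBounded_bnd
  | ite e p q => (e.polyBounded_bnd.add p.polyBounded_bnd).add q.polyBounded_bnd
  | loop e p => e.polyBounded_bnd.add p.polyBounded_bnd

/-! ### Frames -/

/-- Does the program assign to the register `x`? -/
def Prog.writes (x : ℕ) : Prog → Bool
  | skip => false
  | assign y _ => x == y
  | put _ _ _ => false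
  | seq p q => p.writes x || q.writes x
  | ite _ p q => p.writes x || q.writes x
  | loop _ p => p.writes x

/-- Does the program store in the array `a`? -/
def Prog.stores (a : ℕ) : Prog → Bool
  | skip => false
  | assign _ _ => false
  | put b _ _ => a == b
  | seq p q => p.stores a || q.stores a
  | ite _ p q => p.stores a || q.stores a
  | loop _ p => p.stores a

/-- The states agree on everything that the program does not write. -/
structure Frame (p : Prog) (σ τ : State) : Prop where
  var : ∀ x, p.writes x = false → τ.vars x = σ.vars x
  arr : ∀ a, p.stores a = false → τ.arrs a = σ.arrs a

theorem Frame.refl (p : Prog) (σ : State) : Frame p σ σ := ⟨fun _ _ => rfl, fun _ _ => rfl⟩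

theorem Frame.trans {p : Prog} {σ τ υ : State} (h : Frame p σ τ) (h' : Frame p τ υ) :
    Frame p σ υ :=
  ⟨fun x hx => (h'.var x hx).trans (h.var x hx), fun a ha => (h'.arr a ha).trans (h.arr a ha)⟩

theorem Frame.mono {p q : Prog} {σ τ : State} (h : Frame p σ τ)
    (hw : ∀ x, q.writes x = false → p.writes x = false)
    (hs : ∀ a, q.stores a = false → p.stores a = false) : Frame q σ τ :=
  ⟨fun x hx => h.var x (hw x hx), fun a ha => h.arr a (hs a ha)⟩

/-- As `writes` and `stores` are computable, the preservation of a concrete register or array by a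
concrete program is then proved by `rfl`. -/
theorem Run.frame {B : ℕ} {ε : ℝ} {p : Prog} {σ τ : State} {k : ℕ} (h : Run B ε p σ k τ) :
    Frame p σ τ := by
  induction h with
  | skip | loopDone => exact .refl _ _
  | assign σ x e =>
    refine ⟨fun y hy => ?_, fun _ _ => rfl⟩
    have : y ≠ x := by simpa [Prog.writes] using hy
    simp [State.setVar, this]
  | put σ a i e =>
    refine ⟨fun _ _ => rfl, fun b hb => ?_⟩
    have : b ≠ a := by simpa [Prog.stores] using hb
    simp [State.setCell, this]
  | seq _ _ ihp ihq =>
    exact (ihp.mono (fun x hx => by simp_all [Prog.writes]) fun x hx => by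
      simp_all [Prog.stores]).trans
      (ihq.mono (fun x hx => by simp_all [Prog.writes]) fun x hx => by simp_all [Prog.stores])
  | iteTrue _ _ _ ih | iteFalse _ _ _ ih =>
    exact ih.mono (fun x hx => by simp_all [Prog.writes]) fun x hx => by simp_all [Prog.stores]
  | loopStep _ _ _ _ ihp ihl =>
    exact (ihp.mono (fun x hx => by simpa [Prog.writes] using hx) fun x hx => by
      simpa [Prog.stores] using hx).trans ihl

/-! ### Total correctness with a bound for the number of loop iterations -/

/-- Started in `σ`, the program `p` halts after at most `c` iterations of loops, storing only
numbers of absolute value at most `B`, in a state that satisfies `R`. -/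
def Ends (B : ℕ) (ε : ℝ) (p : Prog) (σ : State) (c : ℕ) (R : State → Prop) : Prop :=
  ∃ k τ, Run B ε p σ k τ ∧ k ≤ c ∧ R τ

/-- The programs of the list, one after the other. -/
def block : List Prog → Prog
  | [] => .skip
  | p :: l => .seq p (block l)

section Rules

variable {B : ℕ} {ε : ℝ} {p q : Prog} {σ : State} {c : ℕ} {R R' : State → Prop}

theorem Ends.mono' {c' : ℕ} (h : Ends B ε p σ c' R) (hc : c' ≤ c)
    (hR : ∀ τ, Frame p σ τ → R τ → R' τ) : Ends B ε p σ c R' :=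
  let ⟨k, τ, hr, hk, hτ⟩ := h
  ⟨k, τ, hr, hk.trans hc, hR τ hr.frame hτ⟩

theorem Ends.skip (h : R σ) : Ends B ε .skip σ c R := ⟨0, σ, .skip σ, Nat.zero_le _, h⟩

theorem Ends.assign {x : ℕ} {e : Expr} (he : e.Ok ε σ) (hB : |e.val ε σ| ≤ B)
    (h : R (σ.setVar x (e.val ε σ))) : Ends B ε (.assign x e) σ c R :=
  ⟨0, _, .assign σ x e he hB, Nat.zero_le _, h⟩

theorem Ends.put {a : ℕ} {i e : Expr} (hi : i.Ok ε σ) (he : e.Ok ε σ) (hpos : 0 ≤ i.val ε σ)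
    (hB : |e.val ε σ| ≤ B) (h : R (σ.setCell a (i.val ε σ).toNat (e.val ε σ))) :
    Ends B ε (.put a i e) σ c R :=
  ⟨0, _, .put σ a i e hi he hpos hB, Nat.zero_le _, h⟩

theorem Ends.nil (h : R σ) : Ends B ε (block []) σ c R := Ends.skip h

theorem Ends.cons {l : List Prog} {c₁ c₂ : ℕ} (hp : Ends B ε p σ c₁ R')
    (hl : ∀ τ, Frame p σ τ → R' τ → Ends B ε (block l) τ c₂ R) (hc : c₁ + c₂ ≤ c) :
    Ends B ε (block (p :: l)) σ c R := by
  obtain ⟨k, τ, hr, hk, hτ⟩ := hp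
  obtain ⟨k', τ', hr', hk', hτ'⟩ := hl τ hr.frame hτ
  exact ⟨_, _, .seq hr hr', (add_le_add hk hk').trans hc, hτ'⟩

theorem Ends.assign_cons {l : List Prog} {x : ℕ} {e : Expr} (he : e.Ok ε σ)
    (hB : |e.val ε σ| ≤ B) (h : Ends B ε (block l) (σ.setVar x (e.val ε σ)) c R) :
    Ends B ε (block (.assign x e :: l)) σ c R := by
  obtain ⟨k', τ', hr', hk', hτ'⟩ := h
  exact ⟨_, _, .seq (.assign σ x e he hB) hr', by omega, hτ'⟩

theorem Ends.put_cons {l : List Prog} {a : ℕ} {i e : Expr} (hi : i.Ok ε σ) (he : e.Ok ε σ)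
    (hpos : 0 ≤ i.val ε σ) (hB : |e.val ε σ| ≤ B)
    (h : Ends B ε (block l) (σ.setCell a (i.val ε σ).toNat (e.val ε σ)) c R) :
    Ends B ε (block (.put a i e :: l)) σ c R := by
  obtain ⟨k', τ', hr', hk', hτ'⟩ := h
  exact ⟨_, _, .seq (.put σ a i e hi he hpos hB) hr', by omega, hτ'⟩

theorem Ends.ite {e : Expr} (he : e.Ok ε σ) (h₁ : e.val ε σ ≠ 0 → Ends B ε p σ c R)
    (h₂ : e.val ε σ = 0 → Ends B ε q σ c R) : Ends B ε (.ite e p q) σ c R := by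
  by_cases h : e.val ε σ = 0
  · obtain ⟨k, τ, hr, hk, hτ⟩ := h₂ h
    exact ⟨k, τ, .iteFalse he h hr, hk, hτ⟩
  · obtain ⟨k, τ, hr, hk, hτ⟩ := h₁ h
    exact ⟨k, τ, .iteTrue he h hr, hk, hτ⟩

/-- Loops, with an invariant indexed by the budget of iterations that is left. -/
theorem Ends.loop {e : Expr} {I : ℕ → State → Prop} (h₀ : I c σ)
    (hok : ∀ v τ, I v τ → e.Ok ε τ)
    (hstep : ∀ v τ, Frame (.loop e p) σ τ → I v τ → e.val ε τ ≠ 0 →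
      ∃ d, Ends B ε p τ d fun υ => ∃ v', 1 + d + v' ≤ v ∧ I v' υ) :
    Ends B ε (.loop e p) σ c fun τ => e.val ε τ = 0 ∧ ∃ v, I v τ := by
  suffices H : ∀ v τ, I v τ → Frame (.loop e p) σ τ →
      Ends B ε (.loop e p) τ v fun υ => e.val ε υ = 0 ∧ ∃ w, I w υ from H c σ h₀ (.refl _ _)
  intro v
  induction v using Nat.strong_induction_on with
  | _ v ih =>
    intro τ hI hF
    by_cases he : e.val ε τ = 0
    · exact ⟨0, τ, .loopDone (hok v τ hI) he, Nat.zero_le _, he, v, hI⟩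
    · obtain ⟨d, k, υ, hr, hk, v', hv', hI'⟩ := hstep v τ hF hI he
      have hF' : Frame (.loop e p) τ υ := hr.frame.mono (fun _ h => h) fun _ h => h
      obtain ⟨k', υ', hr', hk', hR⟩ := ih v' (by omega) υ hI' (hF.trans hF')
      exact ⟨_, υ', .loopStep (hok v τ hI) he hr hr', by omega, hR⟩

end Rules

@[simp] theorem State.setVar_vars (σ : State) (x : ℕ) (v : ℤ) (y : ℕ) :
    (σ.setVar x v).vars y = if y = x then v else σ.vars y := by
  simp [State.setVar, Function.update_apply]

@[simp] theorem State.setVar_arrs (σ : State) (x : ℕ) (v : ℤ) :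
    (σ.setVar x v).arrs = σ.arrs := rfl

@[simp] theorem State.setCell_vars (σ : State) (a i : ℕ) (v : ℤ) :
    (σ.setCell a i v).vars = σ.vars := rfl

@[simp] theorem State.setCell_arrs_same (σ : State) (a i : ℕ) (v : ℤ) :
    (σ.setCell a i v).arrs a = Function.update (σ.arrs a) i v := by
  simp [State.setCell]

@[simp] theorem State.setCell_arrs_of_ne (σ : State) {a b : ℕ} (h : b ≠ a) (i : ℕ) (v : ℤ) :
    (σ.setCell a i v).arrs b = σ.arrs b := by
  simp [State.setCell, h]

/-- The counting loop `for x = s, …, e - 1`. -/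
def forLoop (x : ℕ) (s e : Expr) (p : Prog) : Prog :=
  block [.assign x s, .loop (.lt (.var x) e) (block [p, .assign x (.add (.var x) (.lit 1))])]

/-- The bound `e` is evaluated again before every iteration, hence the hypothesis that it keeps the
value `b` in all states that the loop can reach according to its frame. The invariant is required
after the counter has been increased, which is why it is stated for `υ.setVar x (i + 1)`. -/
theorem Ends.forLoop {B : ℕ} {ε : ℝ} {p : Prog} {σ : State} {c x s b : ℕ} {e₀ e : Expr}
    {I : ℕ → State → Prop} (hx : p.writes x = false) (hs : e₀.Ok ε σ) (hs' : e₀.val ε σ = s)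
    (hsb : s ≤ b) (hb : b ≤ B) (h₀ : I s (σ.setVar x s))
    (he : ∀ τ, Frame (forLoop x e₀ e p) σ τ → e.Ok ε τ ∧ e.val ε τ = b)
    (hp : ∀ i τ, s ≤ i → i < b → Frame (CutGraph.forLoop x e₀ e p) σ τ → τ.vars x = i → I i τ →
      Ends B ε p τ c fun υ => I (i + 1) (υ.setVar x (i + 1))) :
    Ends B ε (CutGraph.forLoop x e₀ e p) σ ((b - s) * (c + 1)) fun τ =>
      I b τ ∧ τ.vars x = b := by
  set P := CutGraph.forLoop x e₀ e p with hP
  have hsB : |e₀.val ε σ| ≤ B := by rw [hs']; simp; omega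
  have hF0 : Frame P σ (σ.setVar x (e₀.val ε σ)) := by
    refine ⟨fun y hy => ?_, fun _ _ => rfl⟩
    have : y ≠ x := by rintro rfl; simp [hP, CutGraph.forLoop, block, Prog.writes] at hy
    simp [this]
  have hFl : ∀ τ υ, Frame (.loop (.lt (.var x) e) (block [p, .assign x (.add (.var x) (.lit 1))]))
      τ υ → Frame P τ υ := fun τ υ h => h.mono
    (fun y hy => by simp_all [CutGraph.forLoop, block, Prog.writes])
    (fun y hy => by simp_all [CutGraph.forLoop, block, Prog.stores])
  refine Ends.assign_cons hs hsB (Ends.cons (c₂ := 0) (Ends.loop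
    (I := fun v τ => ∃ i, s ≤ i ∧ i ≤ b ∧ τ.vars x = i ∧ v = (b - i) * (c + 1) ∧ I i τ ∧
      Frame P σ τ) ?_ ?_ ?_) ?_ le_rfl)
  · exact ⟨s, le_rfl, hsb, by simp [hs'], rfl, by rw [hs']; exact h₀, hF0⟩
  · rintro v τ ⟨i, -, -, -, -, -, hF⟩
    exact ⟨trivial, (he τ hF).1⟩
  · rintro v τ - ⟨i, hsi, hib, hxi, rfl, hI, hF⟩ hne
    have hlt : i < b := by
      by_contra h
      apply hne
      simp only [Expr.val, hxi, (he τ hF).2]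
      simpa using h
    refine ⟨c, Ends.cons (c₂ := 0) (hp i τ hsi hlt hF hxi hI) ?_ le_rfl⟩
    intro υ hFυ hIυ
    have hxυ : υ.vars x = i := (hFυ.var x hx).trans hxi
    refine Ends.assign_cons (by simp [Expr.Ok]) ?_ (Ends.nil ?_)
    · simp only [Expr.val, hxυ]
      rw [abs_of_nonneg (by positivity)]; omega
    · refine ⟨(b - (i + 1)) * (c + 1), ?_, i + 1, by omega, by omega, ?_, rfl, ?_, ?_⟩
      · have : b - i = b - (i + 1) + 1 := by omega
        rw [this]; ring_nf; omega
      · simp [Expr.val, hxυ]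
      · simpa [Expr.val, hxυ] using hIυ
      · refine hF.trans ((hFυ.mono ?_ ?_ : Frame P τ υ).trans ⟨fun y hy => ?_, fun _ _ => rfl⟩)
        · intro y hy; simp_all [CutGraph.forLoop, block, Prog.writes]
        · intro y hy; simp_all [CutGraph.forLoop, block, Prog.stores]
        · have : y ≠ x := by rintro rfl; simp [hP, CutGraph.forLoop, block, Prog.writes] at hy
          simp [this]
  · rintro τ - ⟨he0, v, i, hsi, hib, hxi, -, hI, hF⟩
    have : i = b := by
      simp only [Expr.val, hxi, (he τ hF).2] at he0
      by_contra h
      have : (i : ℤ) < b := by omega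
      simp [this] at he0
    subst this
    exact Ends.nil ⟨hI, hxi⟩

end CutGraph

namespace CutGraph

open Finset

/-! ### Thinning a sequence of vectors by a factor of four -/

section Thinning

variable {E : Type*} [NormedAddCommGroup E] [InnerProductSpace ℝ E]

/-- In ‖S + d‖² = ‖S‖² + 2⟨S, d⟩ + ‖d‖² the middle term is never positive, so each vector adds at
most D². -/
theorem norm_sum_sq_le_of_inner_nonpos {d : ℕ → E} {D : ℝ} {s k : ℕ}
    (hd : ∀ h ∈ Ico s (s + k), ‖d h‖ ≤ D)
    (hi : ∀ h ∈ Ico s (s + k), inner ℝ (∑ i ∈ Ico s h, d i) (d h) ≤ 0) :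
    ‖∑ h ∈ Ico s (s + k), d h‖ ^ 2 ≤ k * D ^ 2 := by
  induction k with
  | zero => simp
  | succ k ih =>
    have hk : s + k ∈ Ico s (s + (k + 1)) := by simp
    have h1 := ih (fun h hh => hd h (by simp at hh ⊢; omega)) fun h hh => hi h (by simp at hh ⊢; omega)
    rw [← add_assoc, sum_Ico_succ_top (by omega), norm_add_sq_real]
    have h2 := hi _ hk
    have h3 : ‖d (s + k)‖ ^ 2 ≤ D ^ 2 := by
      have := hd _ hk
      gcongr
    push_cast
    linarith

/-- A block of length b contributes D√b, and the triangle inequality over H/b blocks gives DH/√b. A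
single incomplete block gives D√H = DH/√H. Working in blocks limits the history that the greedy rule
has to consult. -/
theorem norm_sum_range_le_of_blocks {d : ℕ → E} {D : ℝ} (hD : 0 ≤ D) {b H : ℕ} (hb : 0 < b)
    (hH : b ∣ H ∨ H ≤ b) (hd : ∀ h < H, ‖d h‖ ≤ D)
    (hi : ∀ h < H, inner ℝ (∑ i ∈ Ico (h / b * b) h, d i) (d h) ≤ 0) :
    ‖∑ h ∈ range H, d h‖ ≤ D * H * (1 / √b + 1 / √H) := by
  have block : ∀ c k, k ≤ b → c * b + k ≤ H →
      ‖∑ h ∈ Ico (c * b) (c * b + k), d h‖ ≤ D * √k := by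
    intro c k hk hc
    have h := norm_sum_sq_le_of_inner_nonpos (d := d) (D := D) (s := c * b) (k := k)
      (fun h hh => hd h (by simp at hh; omega)) fun h hh => by
        simp only [mem_Ico] at hh
        have : h / b = c := Nat.div_eq_of_lt_le (by nlinarith) (by nlinarith)
        have h' := hi h (by omega)
        rwa [this] at h'
    refine le_of_sq_le_sq ?_ (by positivity)
    rw [mul_pow, Real.sq_sqrt (by positivity)]
    linarith
  rcases hH with ⟨c, rfl⟩ | hH
  · have key : ∀ c', c' ≤ c → ‖∑ h ∈ range (c' * b), d h‖ ≤ c' * (D * √b) := by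
      intro c'
      induction c' with
      | zero => simp
      | succ c' ih =>
        intro hc
        have hcb : (c' + 1) * b ≤ b * c := by rw [mul_comm b]; exact Nat.mul_le_mul_right _ hc
        rw [add_mul, one_mul] at hcb
        rw [add_mul, one_mul, ← sum_range_add_sum_Ico _ (Nat.le_add_right (c' * b) b)]
        refine (norm_add_le _ _).trans ?_
        have := ih (by omega)
        have := block c' b le_rfl hcb
        push_cast
        linarith
    have h1 := key c le_rfl
    rw [mul_comm c b] at h1
    refine h1.trans ?_
    have hb' : (0 : ℝ) < √b := Real.sqrt_pos.2 (by exact_mod_cast hb)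
    have h2 : (c : ℝ) * (D * √b) = D * ((b * c : ℕ) : ℝ) * (1 / √b) := by
      push_cast
      field_simp
      rw [Real.sq_sqrt (by positivity)]
    rw [h2]
    have : 0 ≤ 1 / √((b * c : ℕ) : ℝ) := by positivity
    have : 0 ≤ D * ((b * c : ℕ) : ℝ) := by positivity
    nlinarith
  · have h1 := block 0 H hH (by omega)
    simp only [zero_mul, zero_add, Nat.Ico_zero_eq_range] at h1
    refine h1.trans ?_
    rcases Nat.eq_zero_or_pos H with rfl | hpos
    · simp
    have hH' : (0 : ℝ) < √H := Real.sqrt_pos.2 (by exact_mod_cast hpos)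
    have h2 : D * √H = D * H * (1 / √H) := by
      field_simp
      rw [Real.sq_sqrt (by positivity)]
    rw [h2]
    have : 0 ≤ 1 / √(b : ℝ) := by positivity
    have : 0 ≤ D * (H : ℝ) := by positivity
    nlinarith

/-- In the `h`-th quadruple, `q` is the member chosen by the greedy rule: `κ` has value `3` there
and `-1` at the other members, and the weighted sum of the `w i j`, over the earlier indices `i` of
the same block of `b` quadruples, is least for `j = 4 * h + q`. -/
def GreedyChoice (w : ℕ → ℕ → ℤ) (κ : ℕ → ℤ) (b h q : ℕ) : Prop :=
  q < 4 ∧ (∀ j < 4, κ (4 * h + j) = if j = q then 3 else -1) ∧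
    ∀ j < 4, ∑ i ∈ Ico (4 * (h / b * b)) (4 * h), κ i * w i (4 * h + q) ≤
      ∑ i ∈ Ico (4 * (h / b * b)) (4 * h), κ i * w i (4 * h + j)

theorem sum_Ico_four_mul {M : Type*} [AddCommMonoid M] (f : ℕ → M) {s t : ℕ} (hst : s ≤ t) :
    ∑ h ∈ Ico s t, ∑ j ∈ range 4, f (4 * h + j) = ∑ i ∈ Ico (4 * s) (4 * t), f i := by
  induction t, hst using Nat.le_induction with
  | base => simp
  | succ t ht ih =>
    rw [sum_Ico_succ_top ht, ih, show 4 * (t + 1) = 4 * t + 4 by ring,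
      ← sum_Ico_consecutive f (show 4 * s ≤ 4 * t by omega) (Nat.le_add_right (4 * t) 4),
      sum_Ico_eq_sum_range (m := 4 * t)]
    simp

/-- The error of a quadruple is d = 4 x_q minus the sum of its four members, which is exactly the
combination with coefficients `κ`. Choosing q to minimize ⟨S, x_j⟩, where S is the sum of the
earlier errors of the block, makes ⟨S, d⟩ ≤ 0. -/
theorem norm_thinning_le {x : ℕ → E} {D : ℝ} {b H : ℕ} (hb : 0 < b)
    (hH : b ∣ H ∨ H ≤ b) (hD : 0 ≤ D) (hx : ∀ i < 4 * H, ‖x i‖ ≤ D) {w : ℕ → ℕ → ℤ}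
    (hw : ∀ i < 4 * H, ∀ j < 4 * H, (w i j : ℝ) = inner ℝ (x i) (x j)) {κ : ℕ → ℤ} {q : ℕ → ℕ}
    (hq : ∀ h < H, GreedyChoice w κ b h (q h)) :
    ‖(4 : ℝ) • ∑ h ∈ range H, x (4 * h + q h) - ∑ i ∈ range (4 * H), x i‖ ≤
      6 * D * H * (1 / √b + 1 / √H) := by
  set d : ℕ → E := fun h => ∑ j ∈ range 4, (κ (4 * h + j) : ℝ) • x (4 * h + j) with hd
  have hd1 : ∀ h < H, d h = (4 : ℝ) • x (4 * h + q h) - ∑ j ∈ range 4, x (4 * h + j) := by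
    intro h hh
    obtain ⟨hq4, hκ, -⟩ := hq h hh
    have : ∀ j ∈ range 4, (κ (4 * h + j) : ℝ) • x (4 * h + j) =
        (if j = q h then (4 : ℝ) • x (4 * h + j) else 0) - x (4 * h + j) := by
      intro j hj
      rw [hκ j (by simpa using hj)]
      split_ifs
      · push_cast; module
      · push_cast; module
    simp only [hd]
    rw [sum_congr rfl this, sum_sub_distrib, sum_ite_eq' (range 4) (q h)]
    simp [hq4]
  have hsum : ∑ h ∈ range H, d h =
      (4 : ℝ) • ∑ h ∈ range H, x (4 * h + q h) - ∑ i ∈ range (4 * H), x i := by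
    rw [sum_congr rfl fun h hh => hd1 h (by simpa using hh), sum_sub_distrib, smul_sum]
    congr 1
    have := sum_Ico_four_mul x (Nat.zero_le H)
    simpa using this
  rw [← hsum]
  refine norm_sum_range_le_of_blocks (by positivity) hb hH (fun h hh => ?_) fun h hh => ?_
  · obtain ⟨hq4, hκ, -⟩ := hq h hh
    have hb' : ∀ j ∈ range 4, ‖(κ (4 * h + j) : ℝ) • x (4 * h + j)‖ ≤
        (if j = q h then 3 else 1) * D := by
      intro j hj
      have hj' : j < 4 := by simpa using hj
      rw [hκ j hj', norm_smul]
      refine mul_le_mul ?_ (hx _ (by omega)) (norm_nonneg _) (by split_ifs <;> norm_num)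
      split_ifs <;> simp
    refine (norm_sum_le_of_le _ hb').trans ?_
    rw [← sum_mul]
    refine mul_le_mul_of_nonneg_right ?_ hD
    -- The absolute values of the coefficients add up to 3 + 1 + 1 + 1 = 6.
    interval_cases q h <;> simp [sum_range_succ] <;> norm_num
  · have hle : h / b * b ≤ h := Nat.div_mul_le_self h b
    obtain ⟨hq4, hκ, hmin⟩ := hq h hh
    set S := ∑ i ∈ Ico (h / b * b) h, d i with hS
    have hS' : S = ∑ i ∈ Ico (4 * (h / b * b)) (4 * h), (κ i : ℝ) • x i := by
      rw [hS, ← sum_Ico_four_mul (fun i => (κ i : ℝ) • x i) hle]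
    have hsc : ∀ j < 4, inner ℝ S (x (4 * h + j)) =
        ((∑ i ∈ Ico (4 * (h / b * b)) (4 * h), κ i * w i (4 * h + j) : ℤ) : ℝ) := by
      intro j hj
      rw [hS', sum_inner]
      push_cast
      refine sum_congr rfl fun i hi => ?_
      simp only [mem_Ico] at hi
      rw [inner_smul_left, hw i (by omega) _ (by omega)]
      simp
    have hmin' : ∀ j < 4, inner ℝ S (x (4 * h + q h)) ≤ inner ℝ S (x (4 * h + j)) := by
      intro j hj
      rw [hsc _ hq4, hsc j hj]
      exact_mod_cast hmin j hj
    -- Four times the minimum is at most the sum of the four values.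
    rw [hd1 h hh, inner_sub_right, inner_smul_right, inner_sum]
    have := hmin' 0 (by norm_num)
    have := hmin' 1 (by norm_num)
    have := hmin' 2 (by norm_num)
    have := hmin' 3 (by norm_num)
    simp only [sum_range_succ, sum_range_zero]
    linarith

/-- The first `N` members of the list `R`, weighted equally, represent the vectors `F v`, `v < N₀`,
with the accuracy that is reached when the block size has grown from `b₀` to `b`. -/
def Represents (F : ℕ → E) (D : ℝ) (b₀ N₀ : ℕ) (R : ℕ → ℕ) (N b : ℕ) : Prop :=
  ‖((N₀ : ℝ) / N) • ∑ i ∈ range N, F (R i) - ∑ v ∈ range N₀, F v‖ ≤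
    N₀ * D * (3 / 2) * (4 * (1 / √b₀ - 1 / √b) + 2 * (1 / √N - 1 / √N₀))

theorem Represents.init (F : ℕ → E) (D : ℝ) (b₀ : ℕ) {N₀ : ℕ} (hN : 0 < N₀) {R : ℕ → ℕ}
    (hR : ∀ i < N₀, R i = i) : Represents F D b₀ N₀ R N₀ b₀ := by
  have : (N₀ : ℝ) / N₀ = 1 := div_self (by positivity)
  rw [Represents, this, sum_congr rfl fun i hi => by rw [hR i (by simpa using hi)]]
  simp

/-- Rescaled by N₀/(4H), the thinning error is N₀ D (3/2)(1/√b + 1/√H). The two differences in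
`Represents` are designed to absorb this: passing from b to 2b and from 4H to H increases them by at
least these amounts. -/
theorem Represents.step {F : ℕ → E} {D : ℝ} {b₀ N₀ : ℕ} {R R' : ℕ → ℕ} {H b : ℕ}
    (h : Represents F D b₀ N₀ R (4 * H) b) (hpos : 0 < H) (hb : 0 < b) (hH : b ∣ H ∨ H ≤ b)
    (hD : 0 ≤ D) (hx : ∀ i < 4 * H, ‖F (R i)‖ ≤ D) {w : ℕ → ℕ → ℤ}
    (hw : ∀ i < 4 * H, ∀ j < 4 * H, (w i j : ℝ) = inner ℝ (F (R i)) (F (R j))) {κ : ℕ → ℤ}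
    {q : ℕ → ℕ} (hq : ∀ h < H, GreedyChoice w κ b h (q h))
    (hR' : ∀ h < H, R' h = R (4 * h + q h)) : Represents F D b₀ N₀ R' H (2 * b) := by
  have ht := norm_thinning_le (x := fun i => F (R i)) hb hH hD hx hw hq
  have hH' : (0 : ℝ) < H := by exact_mod_cast hpos
  have hsH : 0 < √(H : ℝ) := Real.sqrt_pos.2 hH'
  have hsb : 0 < √(b : ℝ) := Real.sqrt_pos.2 (by exact_mod_cast hb)
  have e1 : √((4 * H : ℕ) : ℝ) = 2 * √H := by
    push_cast
    rw [Real.sqrt_mul (by norm_num), show (4 : ℝ) = 2 ^ 2 by norm_num, Real.sqrt_sq (by norm_num)]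
  -- Equivalent to 1/√2 ≤ 3/4, the reason for the factor 4.
  have e2 : 1 / √b ≤ 4 * (1 / √b - 1 / √((2 * b : ℕ) : ℝ)) := by
    push_cast
    rw [Real.sqrt_mul (by norm_num)]
    have h2 : 4 / 3 ≤ √(2 : ℝ) := Real.le_sqrt_of_sq_le (by norm_num)
    have : 1 / (√2 * √(b : ℝ)) ≤ 3 / 4 * (1 / √b) := by
      rw [one_div_le (by positivity) (by positivity), mul_comm, one_div_mul_eq_div, one_div_div]
      rw [div_le_iff₀ (by norm_num)]
      nlinarith
    linarith
  rw [Represents] at h ⊢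
  rw [e1] at h
  have hsplit : ((N₀ : ℝ) / H) • ∑ i ∈ range H, F (R' i) - ∑ v ∈ range N₀, F v =
      ((N₀ : ℝ) / (4 * H : ℕ)) • ((4 : ℝ) • ∑ i ∈ range H, F (R (4 * i + q i)) -
        ∑ i ∈ range (4 * H), F (R i)) +
      (((N₀ : ℝ) / (4 * H : ℕ)) • ∑ i ∈ range (4 * H), F (R i) - ∑ v ∈ range N₀, F v) := by
    rw [sum_congr rfl fun i hi => by rw [hR' i (by simpa using hi)], smul_sub, smul_smul]
    have : (N₀ : ℝ) / (4 * H : ℕ) * 4 = N₀ / H := by push_cast; field_simp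
    rw [this]
    abel
  rw [hsplit]
  refine (norm_add_le _ _).trans
    ((add_le_add (b := N₀ * D * (3 / 2) * (1 / √b + 1 / √H)) ?_ h).trans ?_)
  · rw [norm_smul, Real.norm_of_nonneg (by positivity)]
    refine (mul_le_mul_of_nonneg_left ht (by positivity)).trans (le_of_eq ?_)
    push_cast
    field_simp
    ring
  · have hc : (0 : ℝ) ≤ N₀ * D * (3 / 2) := by positivity
    have e3 : 1 / (2 * √(H : ℝ)) = 1 / 2 * (1 / √H) := by field_simp
    rw [e3, ← mul_add]
    refine mul_le_mul_of_nonneg_left ?_ hc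
    linarith

/-- Dropping the negative terms leaves (3/2)(4 + 2)/√b₀ = 9/√b₀. The final length N must not fall
below b₀, unless no thinning took place. -/
theorem Represents.norm_le {F : ℕ → E} {D : ℝ} {b₀ N₀ : ℕ} {R : ℕ → ℕ} {N b : ℕ}
    (h : Represents F D b₀ N₀ R N b) (hD : 0 ≤ D) (hb : 0 < b₀) (hN : N = N₀ ∨ b₀ ≤ N) :
    ‖((N₀ : ℝ) / N) • ∑ i ∈ range N, F (R i) - ∑ v ∈ range N₀, F v‖ ≤ N₀ * D * (9 / √b₀) := by
  have hsb : 0 < √(b₀ : ℝ) := Real.sqrt_pos.2 (by exact_mod_cast hb)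
  have h1 : 1 / √(N : ℝ) - 1 / √N₀ ≤ 1 / √b₀ := by
    rcases hN with rfl | hN
    · simp
    · have : 1 / √(N : ℝ) ≤ 1 / √b₀ :=
        one_div_le_one_div_of_le hsb (Real.sqrt_le_sqrt (by exact_mod_cast hN))
      have : 0 ≤ 1 / √(N₀ : ℝ) := by positivity
      linarith
  have h2 : 0 ≤ 1 / √(b : ℝ) := by positivity
  have hc : (0 : ℝ) ≤ N₀ * D := by positivity
  refine h.trans ?_
  have e : 9 / √(b₀ : ℝ) = 9 * (1 / √b₀) := by ring
  rw [mul_assoc (_ * _), e]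
  refine mul_le_mul_of_nonneg_left ?_ hc
  linarith

end Thinning

end CutGraph

namespace CutGraph

open Finset

/-! ### Correlations of the rows of a matrix and large cuts -/

section Cuts

/-- The inner product of the rows `u` and `v` of a matrix with `n` columns. -/
def dot (T : ℕ → ℕ → ℤ) (n u v : ℕ) : ℤ := ∑ j ∈ range n, T u j * T v j

/-- The tensor square of a vector. -/
noncomputable def tensorSq (n : ℕ) (f : ℕ → ℝ) : EuclideanSpace ℝ (Fin n × Fin n) :=
  WithLp.toLp 2 fun p => f p.1 * f p.2

theorem inner_tensorSq (n : ℕ) (f g : ℕ → ℝ) :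
    inner ℝ (tensorSq n f) (tensorSq n g) = (∑ j ∈ range n, f j * g j) ^ 2 := by
  rw [PiLp.inner_apply, Fintype.sum_prod_type, sq, ← Fin.sum_univ_eq_sum_range (fun j => f j * g j),
    Finset.sum_mul_sum]
  refine sum_congr rfl fun i _ => sum_congr rfl fun j _ => ?_
  simp [tensorSq]
  ring

theorem norm_tensorSq (n : ℕ) (f : ℕ → ℝ) : ‖tensorSq n f‖ = ∑ j ∈ range n, f j ^ 2 := by
  have h : ‖tensorSq n f‖ ^ 2 = (∑ j ∈ range n, f j ^ 2) ^ 2 := by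
    rw [← real_inner_self_eq_norm_sq, inner_tensorSq]
    simp only [sq]
  exact (pow_left_inj₀ (norm_nonneg _) (sum_nonneg fun j _ => sq_nonneg _) two_ne_zero).1 h

/-- The tensor square of a row of a matrix. -/
noncomputable def rowSq (T : ℕ → ℕ → ℤ) (n v : ℕ) : EuclideanSpace ℝ (Fin n × Fin n) :=
  tensorSq n fun j => T v j

/-- This lets the program thin vectors with n² coordinates without ever forming them: one inner
product of rows, at cost n, is enough. -/
theorem inner_rowSq (T : ℕ → ℕ → ℤ) (n u v : ℕ) :
    inner ℝ (rowSq T n u) (rowSq T n v) = ((dot T n u v ^ 2 : ℤ) : ℝ) := by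
  simp [rowSq, inner_tensorSq, dot]

theorem norm_rowSq_le {T : ℕ → ℕ → ℤ} {n v : ℕ} {L : ℝ} (h : ∀ j < n, |(T v j : ℝ)| ≤ L) :
    ‖rowSq T n v‖ ≤ n * L ^ 2 := by
  rw [rowSq, norm_tensorSq]
  refine (sum_le_card_nsmul _ _ (L ^ 2) fun j hj => ?_).trans (by simp)
  rw [← sq_abs]
  have := h j (by simpa using hj)
  gcongr

/-- With g the sum of the rows in X and q = ‖g‖², Cauchy-Schwarz twice gives β⁴n⁶ ≤ q² ≤ n Σ_v s_v²,
where s = Tg. Each s_v² is an inner product with the tensor square of g, whose norm is q ≤ n³L². So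
replacing all rows by the sample changes the sum by at most the accuracy in `hR` times q. The rows
from n up to N₀ ≤ 4n are padding, and account for the factors 4. -/
theorem exists_large_correlation {n N₀ N : ℕ} {T : ℕ → ℕ → ℤ} {L η β : ℝ} {R : ℕ → ℕ}
    (hn : 0 < n) (hN : 0 < N) (hη : 0 ≤ η) (hβ : 0 ≤ β)
    (hT : ∀ u < n, ∀ j < n, |(T u j : ℝ)| ≤ L) (hnN : n ≤ N₀) (hN₀ : N₀ ≤ 4 * n)
    (hR : ‖((N₀ : ℝ) / N) • ∑ i ∈ range N, rowSq T n (R i) - ∑ v ∈ range N₀, rowSq T n v‖ ≤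
      N₀ * (n * L ^ 2) * η)
    {X Y : Finset ℕ} (hX : X ⊆ range n) (hY : Y ⊆ range n)
    (hXY : β * (n : ℝ) ^ 2 ≤ |∑ u ∈ X, ∑ j ∈ Y, (T u j : ℝ)|) :
    ∃ i < N, (β ^ 4 - 4 * η * L ^ 4) / 4 * (n : ℝ) ^ 4 ≤
      (∑ u ∈ X, (dot T n u (R i) : ℝ)) ^ 2 := by
  have hn' : (0 : ℝ) < n := by exact_mod_cast hn
  have hN' : (0 : ℝ) < N := by exact_mod_cast hN
  have hcX : (#X : ℝ) ≤ n := by exact_mod_cast (card_le_card hX).trans (by simp)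
  have hcY : (#Y : ℝ) ≤ n := by exact_mod_cast (card_le_card hY).trans (by simp)
  have hL : 0 ≤ L := (abs_nonneg _).trans (hT 0 hn 0 hn)
  set g : ℕ → ℝ := fun j => ∑ u ∈ X, (T u j : ℝ) with hg
  set q : ℝ := ∑ j ∈ range n, g j ^ 2 with hq
  set s : ℕ → ℝ := fun v => ∑ j ∈ range n, (T v j : ℝ) * g j with hs
  have hs' : ∀ v, ∑ u ∈ X, (dot T n u v : ℝ) = s v := by
    intro v
    simp only [hs, hg, dot, mul_sum]
    push_cast
    rw [sum_comm]
    exact sum_congr rfl fun j _ => sum_congr rfl fun u _ => mul_comm _ _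
  have hq0 : 0 ≤ q := sum_nonneg fun _ _ => sq_nonneg _
  have hq1 : β ^ 2 * (n : ℝ) ^ 3 ≤ q := by
    have h1 : (β * (n : ℝ) ^ 2) ^ 2 ≤ (∑ j ∈ Y, g j) ^ 2 := by
      rw [← sq_abs (∑ j ∈ Y, g j)]
      simp only [hg]
      rw [sum_comm]
      gcongr
    have h2 : (∑ j ∈ Y, g j) ^ 2 ≤ #Y * ∑ j ∈ Y, g j ^ 2 := sq_sum_le_card_mul_sum_sq
    have h3 : ∑ j ∈ Y, g j ^ 2 ≤ q :=
      sum_le_sum_of_subset_of_nonneg hY fun _ _ _ => sq_nonneg _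
    have h4 : (#Y : ℝ) * ∑ j ∈ Y, g j ^ 2 ≤ n * q :=
      mul_le_mul hcY h3 (sum_nonneg fun _ _ => sq_nonneg _) hn'.le
    have h5 : n * (β ^ 2 * (n : ℝ) ^ 3) ≤ n * q := by
      calc n * (β ^ 2 * (n : ℝ) ^ 3) = (β * (n : ℝ) ^ 2) ^ 2 := by ring
        _ ≤ n * q := h1.trans (h2.trans h4)
    exact le_of_mul_le_mul_left h5 hn'
  have hq2 : q ≤ n ^ 3 * L ^ 2 := by
    have : ∀ j ∈ range n, g j ^ 2 ≤ (n * L) ^ 2 := by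
      intro j hj
      rw [← sq_abs]
      have : |g j| ≤ n * L := by
        refine (abs_sum_le_sum_abs _ _).trans ((sum_le_card_nsmul _ _ L fun u hu => ?_).trans ?_)
        · exact hT u (by simpa using hX hu) j (by simpa using hj)
        · rw [nsmul_eq_mul]; gcongr
      gcongr
    refine (sum_le_card_nsmul _ _ _ this).trans (le_of_eq ?_)
    simp
    ring
  have hq3 : q ^ 2 ≤ n * ∑ v ∈ range N₀, s v ^ 2 := by
    have h1 : ∑ u ∈ X, s u = q := by
      simp only [hs, hq]
      rw [sum_comm]
      refine sum_congr rfl fun j _ => ?_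
      rw [← sum_mul]; simp only [hg]; ring
    have h2 : (∑ u ∈ X, s u) ^ 2 ≤ #X * ∑ u ∈ X, s u ^ 2 := sq_sum_le_card_mul_sum_sq
    rw [h1] at h2
    refine h2.trans (mul_le_mul hcX ?_ (sum_nonneg fun _ _ => sq_nonneg _) hn'.le)
    refine sum_le_sum_of_subset_of_nonneg (hX.trans ?_) fun _ _ _ => sq_nonneg _
    simpa using hnN
  have hin : ∀ v, inner ℝ (rowSq T n v) (tensorSq n g) = s v ^ 2 := by
    intro v; rw [rowSq, inner_tensorSq]
  have hsamp : ∑ v ∈ range N₀, s v ^ 2 - (N₀ : ℝ) / N * ∑ i ∈ range N, s (R i) ^ 2 ≤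
      N₀ * (n * L ^ 2) * η * q := by
    have h1 := abs_real_inner_le_norm (((N₀ : ℝ) / N) • ∑ i ∈ range N, rowSq T n (R i) -
      ∑ v ∈ range N₀, rowSq T n v) (tensorSq n g)
    rw [inner_sub_left, inner_smul_left, sum_inner, sum_inner, norm_tensorSq] at h1
    simp only [hin] at h1
    have h2 := h1.trans (mul_le_mul_of_nonneg_right hR hq0)
    have h3 := (abs_le.1 h2).1
    simp only [conj_trivial] at h3
    linarith
  by_contra hcon
  push Not at hcon
  simp only [hs'] at hcon
  -- If all sampled squares were below κ, the chain of inequalities would give β⁴n⁶ < β⁴n⁶; the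
  -- value of κ is chosen to make both sides agree.
  set κ : ℝ := (β ^ 4 - 4 * η * L ^ 4) / 4 * (n : ℝ) ^ 4 with hκ
  have hκ0 : 0 < κ := (sq_nonneg _).trans_lt (hcon 0 hN)
  have hlt : ∑ i ∈ range N, s (R i) ^ 2 < N * κ := by
    refine (sum_lt_sum_of_nonempty (by simpa using hN.ne') fun i hi =>
      hcon i (by simpa using hi)).trans_le ?_
    simp
  have hN₀' : (N₀ : ℝ) ≤ 4 * n := by exact_mod_cast hN₀
  have hN₀0 : (0 : ℝ) < N₀ := by exact_mod_cast hn.trans_le hnN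
  have h1 : (N₀ : ℝ) / N * ∑ i ∈ range N, s (R i) ^ 2 < 4 * n * κ := by
    calc (N₀ : ℝ) / N * ∑ i ∈ range N, s (R i) ^ 2 < N₀ / N * (N * κ) := by gcongr
      _ = N₀ * κ := by field_simp
      _ ≤ 4 * n * κ := by gcongr
  have h2 : N₀ * (n * L ^ 2) * η * q ≤ 4 * n * (n * L ^ 2) * η * (n ^ 3 * L ^ 2) := by gcongr
  have h3 : β ^ 4 * (n : ℝ) ^ 6 ≤ q ^ 2 := by
    calc β ^ 4 * (n : ℝ) ^ 6 = (β ^ 2 * (n : ℝ) ^ 3) ^ 2 := by ring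
      _ ≤ q ^ 2 := by gcongr
  have h4 : β ^ 4 * (n : ℝ) ^ 6 < n * (4 * n * κ + 4 * n * (n * L ^ 2) * η * (n ^ 3 * L ^ 2)) :=
    (h3.trans hq3).trans_lt (mul_lt_mul_of_pos_left (by linarith) hn')
  have h5 : n * (4 * n * κ + 4 * n * (n * L ^ 2) * η * (n ^ 3 * L ^ 2)) = β ^ 4 * (n : ℝ) ^ 6 := by
    rw [hκ]; ring
  linarith

/-- The rows whose inner product with the row `v` has the sign `s`. -/
def signSet (T : ℕ → ℕ → ℤ) (n v : ℕ) (s : ℤ) (u : ℕ) : ℤ := if 0 < s * dot T n u v then 1 else 0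

/-- The column sums over `signSet`. -/
def signSum (T : ℕ → ℕ → ℤ) (n v : ℕ) (s : ℤ) (y : ℕ) : ℤ :=
  ∑ j ∈ range n, signSet T n v s j * T y j

/-- The columns in which `signSum` has the sign `s'`. -/
def signSet' (T : ℕ → ℕ → ℤ) (n v : ℕ) (s s' : ℤ) (y : ℕ) : ℤ :=
  if 0 < s' * signSum T n v s y then 1 else 0

/-- The value of the cut that is obtained from the row `v` and two signs. -/
def signCut (T : ℕ → ℕ → ℤ) (n v : ℕ) (s s' : ℤ) : ℤ :=
  ∑ y ∈ range n, signSet' T n v s s' y * signSum T n v s y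

/-- None of the four cuts that are obtained from the row `v` is large. -/
def NoCut (T : ℕ → ℕ → ℤ) (n v : ℕ) (θ : ℤ) : Prop :=
  ∀ s, s = 1 ∨ s = -1 → ∀ s', s' = 1 ∨ s' = -1 → s' * signCut T n v s s' ≤ θ

/-- For either sign, the sum of the inner products over X is largest when X consists of all rows
whose product with v has that sign. For this X, exchanging summations (here symmetry enters) turns
the sum into Σ_j T v j · `signSum` j, at most L Σ_j |`signSum` j|. The positive and negative parts
of the last sum are two of the four cuts, each at most θ. -/
theorem NoCut.abs_sum_dot_le {T : ℕ → ℕ → ℤ} {n v : ℕ} {θ L : ℤ} (h : NoCut T n v θ)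
    (hsymm : ∀ x < n, ∀ y < n, T x y = T y x) (hL : ∀ j < n, |T v j| ≤ L) (hL0 : 0 ≤ L)
    {X : Finset ℕ} (hX : X ⊆ range n) : |∑ u ∈ X, dot T n u v| ≤ 2 * L * θ := by
  have key : ∀ s, s = 1 ∨ s = -1 → s * ∑ u ∈ X, dot T n u v ≤ 2 * L * θ := by
    intro s hs
    have h1 : s * ∑ u ∈ X, dot T n u v ≤
        s * ∑ u ∈ range n, signSet T n v s u * dot T n u v := by
      rw [mul_sum, mul_sum]
      calc ∑ u ∈ X, s * dot T n u v ≤ ∑ u ∈ X, s * (signSet T n v s u * dot T n u v) := by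
            refine sum_le_sum fun u _ => ?_
            unfold signSet; split_ifs <;> simp; omega
        _ ≤ ∑ u ∈ range n, s * (signSet T n v s u * dot T n u v) := by
            refine sum_le_sum_of_subset_of_nonneg hX fun u _ _ => ?_
            unfold signSet; split_ifs <;> simp; omega
    have h2 : ∑ u ∈ range n, signSet T n v s u * dot T n u v =
        ∑ j ∈ range n, T v j * signSum T n v s j := by
      simp only [dot, signSum, mul_sum]
      rw [sum_comm]
      refine sum_congr rfl fun j hj => sum_congr rfl fun u hu => ?_
      rw [hsymm u (by simpa using hu) j (by simpa using hj)]
      ring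
    have h3 : s * ∑ j ∈ range n, T v j * signSum T n v s j ≤
        L * ∑ j ∈ range n, |signSum T n v s j| := by
      rw [mul_sum, mul_sum]
      refine sum_le_sum fun j hj => (le_abs_self _).trans ?_
      have hs1 : |s| = 1 := by rcases hs with rfl | rfl <;> simp
      rw [abs_mul, abs_mul, hs1, one_mul]
      exact mul_le_mul_of_nonneg_right (hL j (by simpa using hj)) (abs_nonneg _)
    have h4 : ∑ j ∈ range n, |signSum T n v s j| =
        1 * signCut T n v s 1 + -1 * signCut T n v s (-1) := by
      simp only [signCut]
      rw [mul_sum, mul_sum, ← sum_add_distrib]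
      refine sum_congr rfl fun j _ => ?_
      unfold signSet'
      rcases lt_trichotomy (signSum T n v s j) 0 with h | h | h
      · rw [abs_of_neg h, if_neg (by omega), if_pos (by omega)]; ring
      · simp [h]
      · rw [abs_of_pos h, if_pos (by omega), if_neg (by omega)]; ring
    have h5 := h s hs 1 (.inl rfl)
    have h6 := h s hs (-1) (.inr rfl)
    have h7 : L * ∑ j ∈ range n, |signSum T n v s j| ≤ L * (2 * θ) :=
      mul_le_mul_of_nonneg_left (by omega) hL0
    rw [h2] at h1
    linarith
  have := key 1 (.inl rfl)
  have := key (-1) (.inr rfl)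
  rw [abs_le]
  constructor <;> linarith

end Cuts

/-! ### The potential -/

section Potential

/-- The number `a`, truncated to the interval `[-L, L]`. -/
def clip (L a : ℤ) : ℤ := max (-L) (min L a)

/-- Quadratic for arguments up to `L`, and linear beyond. -/
def huber (L a : ℤ) : ℤ := 2 * a * clip L a - clip L a ^ 2

variable {L : ℤ}

theorem abs_clip_le (hL : 0 ≤ L) (a : ℤ) : |clip L a| ≤ L := by
  rw [abs_le, clip]; omega

theorem clip_cases (hL : 0 ≤ L) (a : ℤ) :
    (a ≤ -L ∧ clip L a = -L) ∨ (-L ≤ a ∧ a ≤ L ∧ clip L a = a) ∨ (L ≤ a ∧ clip L a = L) := by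
  unfold clip; omega

theorem huber_nonneg (hL : 0 ≤ L) (a : ℤ) : 0 ≤ huber L a := by
  rcases clip_cases hL a with ⟨h, e⟩ | ⟨_, _, e⟩ | ⟨h, e⟩ <;> rw [huber, e] <;> nlinarith

theorem huber_le_sq (a : ℤ) : huber L a ≤ a ^ 2 := by
  unfold huber; nlinarith [sq_nonneg (a - clip L a)]

/-- The derivative of `huber` is twice `clip`, which is a 1-Lipschitz function; this is the
resulting second-order upper bound. -/
theorem huber_sub_le (hL : 0 ≤ L) (a d : ℤ) :
    huber L (a - d) ≤ huber L a - 2 * d * clip L a + d ^ 2 := by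
  unfold huber
  rcases clip_cases hL a with ⟨h, e⟩ | ⟨h, h', e⟩ | ⟨h, e⟩ <;>
  rcases clip_cases hL (a - d) with ⟨k, f⟩ | ⟨k, k', f⟩ | ⟨k, f⟩ <;>
  rw [e, f] <;> nlinarith

theorem two_mul_abs_sub_clip_le (hL : 0 ≤ L) (a : ℤ) : 2 * L * |a - clip L a| ≤ huber L a := by
  unfold huber
  rcases clip_cases hL a with ⟨h, e⟩ | ⟨h, h', e⟩ | ⟨h, e⟩ <;> rw [e]
  · rw [abs_of_nonpos (by omega)]; nlinarith
  · simp; nlinarith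
  · rw [abs_of_nonneg (by omega)]; nlinarith

/-- The potential of a matrix. -/
def energy (n : ℕ) (L : ℤ) (A : ℕ → ℕ → ℤ) : ℤ :=
  ∑ x ∈ range n, ∑ y ∈ range n, huber L (A x y)

theorem energy_nonneg (hL : 0 ≤ L) (n : ℕ) (A : ℕ → ℕ → ℤ) : 0 ≤ energy n L A :=
  sum_nonneg fun _ _ => sum_nonneg fun _ _ => huber_nonneg hL _

theorem energy_le {n : ℕ} {A : ℕ → ℕ → ℤ} {Q : ℤ} (hA : ∀ x < n, ∀ y < n, |A x y| ≤ Q) :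
    energy n L A ≤ Q ^ 2 * n ^ 2 := by
  have : ∀ x ∈ range n, ∑ y ∈ range n, huber L (A x y) ≤ n * Q ^ 2 := by
    intro x hx
    refine (sum_le_card_nsmul _ _ (Q ^ 2) fun y hy => ?_).trans (by simp)
    refine (huber_le_sq _).trans ?_
    rw [← sq_abs]
    have := hA x (by simpa using hx) y (by simpa using hy)
    gcongr
  refine (sum_le_card_nsmul _ _ _ this).trans (le_of_eq ?_)
  simp
  ring

theorem energy_congr {n : ℕ} {A A' : ℕ → ℕ → ℤ} (h : ∀ x < n, ∀ y < n, A x y = A' x y) :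
    energy n L A = energy n L A' :=
  sum_congr rfl fun x hx => sum_congr rfl fun y hy => by
    rw [h x (by simpa using hx) y (by simpa using hy)]

/-- By symmetry both halves of K_{S,T} yield the same cut value, so the linear term of
`huber_sub_le` gains 4h times the cut, at least 8h²n². Entries of K_{S,T} are at most 2, so the
quadratic term loses at most 4h²n². -/
theorem energy_sub_le (hL : 0 ≤ L) {n : ℕ} {A : ℕ → ℕ → ℤ}
    (hsymm : ∀ x < n, ∀ y < n, A x y = A y x) {s h : ℤ} (hs : s = 1 ∨ s = -1) (hh : 0 ≤ h)
    {S T : ℕ → ℤ} (hS : ∀ x < n, S x = 0 ∨ S x = 1) (hT : ∀ x < n, T x = 0 ∨ T x = 1)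
    (hcut : 2 * h * n ^ 2 ≤
      s * ∑ x ∈ range n, ∑ y ∈ range n, S x * T y * clip L (A x y)) :
    energy n L (fun x y => A x y - s * h * (S x * T y + S y * T x)) + 4 * h ^ 2 * n ^ 2 ≤
      energy n L A := by
  have h1 : energy n L (fun x y => A x y - s * h * (S x * T y + S y * T x)) ≤
      ∑ x ∈ range n, ∑ y ∈ range n, (huber L (A x y) -
        2 * (s * h) * (S x * T y * clip L (A x y) + S y * T x * clip L (A y x)) +
        4 * h ^ 2) := by
    refine sum_le_sum fun x hx => sum_le_sum fun y hy => ?_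
    simp only [mem_range] at hx hy
    refine (huber_sub_le hL _ _).trans ?_
    rw [← hsymm x hx y hy]
    have h4 : (s * h * (S x * T y + S y * T x)) ^ 2 ≤ 4 * h ^ 2 := by
      have : (s * h * (S x * T y + S y * T x)) ^ 2 = h ^ 2 * (S x * T y + S y * T x) ^ 2 := by
        rcases hs with rfl | rfl <;> ring
      rw [this, mul_comm 4]
      refine mul_le_mul_of_nonneg_left ?_ (sq_nonneg h)
      rcases hS x hx with e | e <;> rcases hS y hy with e' | e' <;>
      rcases hT x hx with f | f <;> rcases hT y hy with f' | f' <;> simp [e, e', f, f']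
    linarith
  have h2 : ∑ x ∈ range n, ∑ y ∈ range n, S y * T x * clip L (A y x) =
      ∑ x ∈ range n, ∑ y ∈ range n, S x * T y * clip L (A x y) := sum_comm
  have h3 : ∑ x ∈ range n, ∑ y ∈ range n, (huber L (A x y) -
        2 * (s * h) * (S x * T y * clip L (A x y) + S y * T x * clip L (A y x)) + 4 * h ^ 2) =
      energy n L A - 4 * h * (s * ∑ x ∈ range n, ∑ y ∈ range n, S x * T y * clip L (A x y)) +
        4 * h ^ 2 * n ^ 2 := by
    simp only [sum_add_distrib, sum_sub_distrib, ← mul_sum]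
    rw [h2, energy]
    simp
    ring
  have h5 : 4 * h * (2 * h * n ^ 2) ≤
      4 * h * (s * ∑ x ∈ range n, ∑ y ∈ range n, S x * T y * clip L (A x y)) :=
    mul_le_mul_of_nonneg_left hcut (by positivity)
  rw [h3] at h1
  linarith

/-- Beyond L the potential grows with slope 2L, so it controls the total excess over the truncation.
This permits a search in the truncated matrix only. -/
theorem two_mul_abs_sum_sub_clip_le (hL : 0 ≤ L) {n : ℕ} (A : ℕ → ℕ → ℤ) {X Y : Finset ℕ}
    (hX : X ⊆ range n) (hY : Y ⊆ range n) :
    2 * L * |∑ x ∈ X, ∑ y ∈ Y, (A x y - clip L (A x y))| ≤ energy n L A := by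
  calc 2 * L * |∑ x ∈ X, ∑ y ∈ Y, (A x y - clip L (A x y))|
      ≤ 2 * L * ∑ x ∈ X, ∑ y ∈ Y, |A x y - clip L (A x y)| := by
        refine mul_le_mul_of_nonneg_left ?_ (by positivity)
        exact (abs_sum_le_sum_abs _ _).trans (sum_le_sum fun x _ => abs_sum_le_sum_abs _ _)
    _ = ∑ x ∈ X, ∑ y ∈ Y, 2 * L * |A x y - clip L (A x y)| := by simp only [mul_sum]
    _ ≤ ∑ x ∈ X, ∑ y ∈ Y, huber L (A x y) :=
        sum_le_sum fun x _ => sum_le_sum fun y _ => two_mul_abs_sub_clip_le hL _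
    _ ≤ ∑ x ∈ X, ∑ y ∈ range n, huber L (A x y) :=
        sum_le_sum fun x _ => sum_le_sum_of_subset_of_nonneg hY fun _ _ _ => huber_nonneg hL _
    _ ≤ energy n L A :=
        sum_le_sum_of_subset_of_nonneg hX fun _ _ _ => sum_nonneg fun _ _ => huber_nonneg hL _

end Potential

end CutGraph

namespace CutGraph

open Finset hiding val
open CutGraph.Expr CutGraph.Prog

/-! ### The program that selects a sample of the rows -/

@[simp] theorem toNat_index (u n j : ℕ) : ((u : ℤ) * n + j).toNat = u * n + j := by
  rw [← Nat.cast_mul, ← Nat.cast_add, Int.toNat_natCast]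

/-- The cell of the array `a` in row `i` and column `j` of a matrix whose number of columns is in
register `0`. -/
def cell (a : ℕ) (i j : Expr) : Expr := get a (add (mul i (var 0)) j)

/-- Register `22` receives the inner product of the row of array `a` with number in register `20`
and the row of array `b` with number in register `21`. -/
def rowProduct (a b : ℕ) : Prog := block [
  assign 22 (lit 0),
  forLoop 23 (lit 0) (var 0)
    (assign 22 (add (var 22) (mul (cell a (var 20) (var 23)) (cell b (var 21) (var 23)))))]

theorem abs_sum_mul_le {f g : ℕ → ℤ} {M M' n k : ℕ} (hf : ∀ i, |f i| ≤ M) (hg : ∀ i, |g i| ≤ M')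
    (hk : k ≤ n) {i j : ℕ → ℕ} : |∑ t ∈ range k, f (i t) * g (j t)| ≤ (n * M * M' : ℕ) := by
  have : ∀ t ∈ range k, |f (i t) * g (j t)| ≤ (M * M' : ℕ) := by
    intro t _
    rw [abs_mul]
    push_cast
    exact mul_le_mul (hf _) (hg _) (abs_nonneg _) (by positivity)
  refine (abs_sum_le_sum_abs _ _).trans ((sum_le_card_nsmul _ _ _ this).trans ?_)
  simp only [card_range, nsmul_eq_mul]
  rw [mul_assoc]
  exact_mod_cast Nat.mul_le_mul_right _ hk

/-- The bounds on the cells are assumed for all addresses, because the sampler also reads padding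
rows beyond the n rows of the matrix. -/
theorem ends_rowProduct {B n u w M M' a b : ℕ} {ε : ℝ} {σ : State} (h0 : σ.vars 0 = n)
    (hu : σ.vars 20 = u) (hw : σ.vars 21 = w) (ha : ∀ i, |σ.arrs a i| ≤ M)
    (hb : ∀ i, |σ.arrs b i| ≤ M') (hn : n ≤ B) (hB : n * M * M' ≤ B) :
    Ends B ε (rowProduct a b) σ n fun τ =>
      τ.vars 22 = ∑ j ∈ range n, σ.arrs a (u * n + j) * σ.arrs b (w * n + j) := by
  refine Ends.assign_cons trivial (by simp [val]) (Ends.cons (c₂ := 0) (Ends.forLoop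
    (c := 0) (s := 0) (b := n) (I := fun i τ => τ.vars 22 =
      ∑ j ∈ range i, σ.arrs a (u * n + j) * σ.arrs b (w * n + j))
    rfl trivial (by simp [val]) (Nat.zero_le _) hn (by simp [val]) ?_ ?_)
    (fun τ _ h => Ends.nil h.1) (by omega))
  · intro τ hF
    have := hF.var 0 rfl
    simp [Ok, val, this, h0]
  · intro i τ _ hi hF h23 hI
    have e0 := hF.var 0 rfl
    have e1 := hF.var 20 rfl
    have e2 := hF.var 21 rfl
    have e3 := hF.arr a rfl
    have e4 := hF.arr b rfl
    simp [val] at e0 e1 e2 e3 e4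
    have hv : (add (var 22) (mul (cell a (var 20) (var 23)) (cell b (var 21) (var 23)))).val ε τ =
        ∑ j ∈ range (i + 1), σ.arrs a (u * n + j) * σ.arrs b (w * n + j) := by
      rw [sum_range_succ]
      simp [cell, val, e0, e1, e2, e3, e4, h0, hu, hw, h23, hI]
    refine Ends.assign ?_ ?_ ?_
    · simp [cell, Ok, val, e0, e1, e2, h0, hu, hw, h23]
      constructor <;> positivity
    · rw [hv]
      exact (abs_sum_mul_le ha hb (k := i + 1) hi).trans (by exact_mod_cast hB)
    · rw [hv]; simp

/-- The matrix in array `a`, with `n` columns. -/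
def State.mat (σ : State) (a n x y : ℕ) : ℤ := σ.arrs a (x * n + y)

/-- Register `26` receives the sum, over the list entries with numbers from register `24` up to
register `25`, of the squared inner products with the row in register `21`, with the coefficients
in array `6`. -/
def score : Prog := block [
  assign 26 (lit 0),
  forLoop 27 (var 24) (var 25) (block [
    assign 20 (get 5 (var 27)),
    rowProduct 4 4,
    assign 26 (add (var 26) (mul (get 6 (var 27)) (mul (var 22) (var 22))))])]

theorem abs_dot_le {T : ℕ → ℕ → ℤ} {n u v M : ℕ} (h : ∀ x y, |T x y| ≤ M) :
    |dot T n u v| ≤ (n * M * M : ℕ) :=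
  abs_sum_mul_le (h u) (h v) le_rfl

theorem abs_sum_mul_sq_le {κ d : ℕ → ℤ} {K M : ℕ} (hκ : ∀ i, |κ i| ≤ K) (hd : ∀ i, |d i| ≤ M)
    (s t : ℕ) : |∑ i ∈ Ico s t, κ i * d i ^ 2| ≤ (t * (K * M ^ 2) : ℕ) := by
  have : ∀ i ∈ Ico s t, |κ i * d i ^ 2| ≤ (K * M ^ 2 : ℕ) := by
    intro i _
    rw [abs_mul, abs_pow]
    push_cast
    have := hd i
    exact mul_le_mul (hκ i) (by gcongr) (by positivity) (by positivity)
  refine (abs_sum_le_sum_abs _ _).trans ((sum_le_card_nsmul _ _ _ this).trans ?_)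
  simp only [Nat.card_Ico, nsmul_eq_mul]
  exact_mod_cast Nat.mul_le_mul_right _ (Nat.sub_le t s)

/-- Array `4` holds a matrix with `n` columns and entries bounded by `L`, array `5` a list `R` of
`N` row numbers below `N₀`, array `6` coefficients bounded by `3`. -/
structure State.Sampling (σ : State) (n L N₀ N : ℕ) (T : ℕ → ℕ → ℤ) (R : ℕ → ℕ) : Prop where
  cols : σ.vars 0 = n
  mat : σ.mat 4 n = T
  entry : ∀ i, |σ.arrs 4 i| ≤ L
  list : ∀ i < N, σ.arrs 5 i = R i
  list_lt : ∀ i < N, R i < N₀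
  coeff : ∀ i, |σ.arrs 6 i| ≤ 3

/-- The words are long enough for the selection of a sample. -/
structure SampleBound (B n L N₀ b₀ : ℕ) : Prop where
  cols : n ≤ B
  product : n * L * L ≤ B
  score : N₀ * (3 * (n * L * L) ^ 2) ≤ B
  rows : N₀ ≤ B
  size : N₀ * b₀ ≤ B
  three : 3 ≤ B

section Sampling

variable {B n L N₀ N b₀ : ℕ} {ε : ℝ} {σ : State} {T : ℕ → ℕ → ℤ} {R : ℕ → ℕ}

theorem State.Sampling.abs_le (h : σ.Sampling n L N₀ N T R) (x y : ℕ) : |T x y| ≤ L := by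
  rw [← h.mat]; exact h.entry _

theorem ends_score (hσ : σ.Sampling n L N₀ N T R) (hB : SampleBound B n L N₀ b₀) {e s t : ℕ}
    (he : σ.vars 21 = e) (hs : σ.vars 24 = s) (ht : σ.vars 25 = t) (hst : s ≤ t) (htN : t ≤ N)
    (hN : N ≤ N₀) :
    Ends B ε score σ ((t - s) * (n + 1)) fun τ =>
      τ.vars 26 = ∑ i ∈ Ico s t, σ.arrs 6 i * dot T n (R i) e ^ 2 := by
  refine Ends.assign_cons trivial (by simp [val]) (Ends.cons (c₂ := 0) (Ends.forLoop
    (c := n) (s := s) (b := t) (I := fun i τ => τ.vars 26 =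
      ∑ i ∈ Ico s i, σ.arrs 6 i * dot T n (R i) e ^ 2)
    rfl trivial (by simp [val, hs]) hst (htN.trans (hN.trans hB.rows)) (by simp [val]) ?_ ?_)
    (fun τ _ h => Ends.nil h.1) (by omega))
  · intro τ hF
    have := hF.var 25 rfl
    simp [Ok, val, this, ht]
  · intro i τ hsi hi hF h27 hI
    have e0 := hF.var 0 rfl
    have e1 := hF.var 21 rfl
    have e3 := hF.arr 4 rfl
    have e4 := hF.arr 5 rfl
    have e5 := hF.arr 6 rfl
    simp [val] at e0 e1 e3 e4 e5
    have hRi : τ.arrs 5 i = R i := by rw [e4, hσ.list i (by omega)]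
    have hRB : R i ≤ B := (hσ.list_lt i (by omega)).le.trans hB.rows
    refine Ends.assign_cons ?_ ?_ (Ends.cons (c₂ := 0) (ends_rowProduct (n := n) (u := R i) (w := e)
      (M := L) (M' := L) ?_ ?_ ?_ ?_ ?_ hB.cols hB.product) ?_ le_rfl)
    · simp [Ok, val, h27]
    · simpa [val, h27, hRi] using hRB
    · simp [e0, hσ.cols]
    · simp [val, h27, hRi]
    · simp [e1, he]
    · simpa [e3] using hσ.entry
    · simpa [e3] using hσ.entry
    · intro υ hFυ h22
      have f1 := hFυ.var 26 rfl
      have f2 := hFυ.var 27 rfl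
      have f3 := hFυ.arr 6 rfl
      simp at f1 f2 f3
      have h22' : υ.vars 22 = dot T n (R i) e := by
        rw [h22, ← hσ.mat]
        simp [e3, dot, State.mat]
      have hv : (add (var 26) (mul (get 6 (var 27)) (mul (var 22) (var 22)))).val ε υ =
          ∑ i ∈ Ico s (i + 1), σ.arrs 6 i * dot T n (R i) e ^ 2 := by
        rw [sum_Ico_succ_top hsi]
        simp [val, f1, f2, f3, h22', hI, h27, e5, sq]
      refine Ends.assign_cons ?_ ?_ (Ends.nil ?_)
      · simp [Ok, val, f2, h27]
      · rw [hv]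
        refine (abs_sum_mul_sq_le hσ.coeff (fun i => abs_dot_le hσ.abs_le) _ _).trans ?_
        refine le_trans ?_ (Nat.cast_le.2 hB.score)
        exact_mod_cast Nat.mul_le_mul_right _ (by omega)
      · rw [hv]; simp

/-- The greedy choice in the quadruple with number in register `28`, for the block size in
register `34`: the list entry is stored in array `7`, the coefficients in array `6`. -/
def greedyStep : Prog := block [
  assign 24 (mul (lit 4) (mul (div (var 28) (var 34)) (var 34))),
  assign 25 (mul (lit 4) (var 28)),
  assign 30 (lit 0),
  assign 31 (lit 0),
  forLoop 29 (lit 0) (lit 4) (block [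
    assign 21 (get 5 (add (var 25) (var 29))),
    score,
    ite (add (lt (var 29) (lit 1)) (lt (var 26) (var 30)))
      (block [assign 30 (var 26), assign 31 (var 29)]) skip]),
  put 6 (var 25) (lit (-1)),
  put 6 (add (var 25) (lit 1)) (lit (-1)),
  put 6 (add (var 25) (lit 2)) (lit (-1)),
  put 6 (add (var 25) (lit 3)) (lit (-1)),
  put 6 (add (var 25) (var 31)) (lit 3),
  put 7 (var 28) (get 5 (add (var 25) (var 31)))]

/-- Four candidates are scored against the at most 4b earlier entries of the block, with one row
product for each. Cells of array 6 from 4h on may hold coefficients of previous rounds; the score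
does not read them. -/
theorem ends_greedyStep (hσ : σ.Sampling n L N₀ N T R) (hB : SampleBound B n L N₀ b₀) {h b : ℕ}
    (hh : σ.vars 28 = h) (hb : σ.vars 34 = b) (hb0 : 0 < b) (hhN : 4 * h + 4 ≤ N) (hN : N ≤ N₀) :
    Ends B ε greedyStep σ (4 * (4 * b * (n + 1) + 1)) fun τ =>
      (∃ q, GreedyChoice (fun i j => dot T n (R i) (R j) ^ 2) (τ.arrs 6) b h q ∧
        τ.arrs 7 = Function.update (σ.arrs 7) h (R (4 * h + q))) ∧
      (∀ i < 4 * h, τ.arrs 6 i = σ.arrs 6 i) ∧ ∀ i, |τ.arrs 6 i| ≤ 3 := by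
  have hNB := hN.trans hB.rows
  have hle : h / b * b ≤ h := Nat.div_mul_le_self h b
  set s := 4 * (h / b * b) with hs
  set sc : ℕ → ℤ := fun q => ∑ i ∈ Ico s (4 * h), σ.arrs 6 i * dot T n (R i) (R (4 * h + q)) ^ 2
    with hsc
  have hv24 : (mul (lit 4) (mul (div (var 28) (var 34)) (var 34))).val ε σ = s := by
    simp [val, hh, hb, hs]
  refine Ends.assign_cons ?_ ?_ (Ends.assign_cons ?_ ?_ (Ends.assign_cons trivial (by simp [val])
    (Ends.assign_cons trivial (by simp [val]) (Ends.cons (c₂ := 0) (Ends.forLoop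
    (c := (4 * h - s) * (n + 1)) (s := 0) (b := 4) (I := fun i τ => τ.arrs 6 = σ.arrs 6 ∧
      ∃ q : ℕ, τ.vars 31 = q ∧ (i = 0 → q = 0) ∧ (0 < i → q < i ∧ τ.vars 30 = sc q) ∧
        ∀ j < i, sc q ≤ sc j)
    rfl trivial (by simp [val]) (by norm_num) (by omega) ?_ ?_ ?_) ?_ ?_))))
  · simp [Ok, val, hb, hb0.ne']
  · rw [hv24]; simp; omega
  · simp [Ok]
  · simp [val, hh]; omega
  · exact ⟨rfl, 0, by simp [val]⟩
  · intro τ hF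
    simp [Ok, val]
  · intro i τ _ hi hF h29 ⟨h6, q, h31, hi0, hi1, hmin⟩
    have e0 := hF.var 0 rfl
    have e1 := hF.var 24 rfl
    have e2 := hF.var 25 rfl
    have e3 := hF.arr 4 rfl
    have e4 := hF.arr 5 rfl
    simp [val, hh, hb] at e0 e1 e2 e3 e4
    have hRi : τ.arrs 5 (4 * h + i) = R (4 * h + i) := by rw [e4, hσ.list _ (by omega)]
    have hRB : R (4 * h + i) ≤ B := (hσ.list_lt _ (by omega)).le.trans hB.rows
    have hnat : ((4 : ℤ) * h + i).toNat = 4 * h + i := by omega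
    refine Ends.assign_cons ?_ ?_ (Ends.cons (c₂ := 0) (ends_score (n := n) (L := L) (N₀ := N₀)
      (N := N) (T := T) (R := R) (e := R (4 * h + i)) (s := s) (t := 4 * h) ?_ hB
      ?_ ?_ ?_ (by omega) (by omega) hN) ?_ le_rfl)
    · simp [Ok, val, e2, h29]; positivity
    · simpa [val, e2, h29, hnat, hRi] using hRB
    · refine ⟨?_, ?_, ?_, ?_, hσ.list_lt, ?_⟩
      · simp [e0, hσ.cols]
      · rw [← hσ.mat]; ext x y; simp [State.mat, e3]
      · simpa [e3] using hσ.entry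
      · simpa [e4] using hσ.list
      · simpa [h6] using hσ.coeff
    · simp [val, e2, h29, hnat, hRi]
    · simp [e1, hs]
    · simp [e2]
    · intro υ hFυ h26
      have f1 := hFυ.var 29 rfl
      have f2 := hFυ.var 30 rfl
      have f3 := hFυ.var 31 rfl
      have f4 := hFυ.arr 6 rfl
      simp at f1 f2 f3 f4
      simp only [State.setVar_arrs, h6] at h26
      have h26' : υ.vars 26 = sc i := h26
      refine Ends.cons (c₁ := 0) (c₂ := 0) (R' := fun ω => ω.arrs 6 = σ.arrs 6 ∧
        ∃ q : ℕ, ω.vars 31 = q ∧ q < i + 1 ∧ ω.vars 30 = sc q ∧ ∀ j < i + 1, sc q ≤ sc j)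
        (Ends.ite (by simp [Ok]) ?_ ?_) ?_ le_rfl
      -- The sum of the two tests acts as a disjunction: the first candidate is always accepted, a
      -- later one only if it improves on the best score.
      · intro hne
        simp only [val, f1, h29, h26', f2] at hne
        have hscB : |sc i| ≤ B := by
          refine (abs_sum_mul_sq_le hσ.coeff (fun i => abs_dot_le hσ.abs_le) _ _).trans ?_
          refine le_trans ?_ (Nat.cast_le.2 hB.score)
          exact_mod_cast Nat.mul_le_mul_right _ (by omega)
        refine Ends.assign_cons trivial (by simpa [val, h26'] using hscB)
          (Ends.assign_cons trivial ?_ (Ends.nil ⟨?_, i, ?_, by omega, ?_, ?_⟩))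
        · simp [val, f1, h29]; omega
        · simp [f4, h6]
        · simp [val, f1, h29]
        · simp [val, h26']
        · intro j hj
          rcases Nat.lt_succ_iff_lt_or_eq.1 hj with hj | rfl
          · rcases Nat.eq_zero_or_pos i with h0 | h0
            · omega
            · have hq := (hi1 h0).2
              have hlt : sc i < sc q := by
                by_contra hc
                apply hne
                rw [hq, if_neg (by omega), if_neg hc]
                rfl
              exact hlt.le.trans (hmin j hj)
          · exact le_rfl
      · intro heq
        simp only [val, f1, h29, h26', f2] at heq
        have h0 : 0 < i := by
          by_contra hc
          rw [if_pos (by omega)] at heq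
          split_ifs at heq <;> omega
        obtain ⟨hqi, hq⟩ := hi1 h0
        refine Ends.skip ⟨by simp [f4, h6], q, by simp [f3, h31], by omega, by simp [f2, hq], ?_⟩
        intro j hj
        rcases Nat.lt_succ_iff_lt_or_eq.1 hj with hj | rfl
        · exact hmin j hj
        · by_contra hc
          rw [hq, if_pos (by omega : sc j < sc q)] at heq
          split_ifs at heq <;> omega
      · intro ω _ hω
        obtain ⟨g6, q', g31, hq', g30, hmin'⟩ := hω
        exact Ends.nil ⟨by simp [g6], q', by simp [g31], by simp, fun _ => ⟨hq', by simp [g30]⟩,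
          hmin'⟩
  · rintro τ hF ⟨⟨h6, q, h31, -, hq, hmin⟩, -⟩
    have hq4 := (hq (by norm_num)).1
    have e2 := hF.var 25 rfl
    have e3 := hF.var 28 rfl
    have e4 := hF.arr 5 rfl
    have e5 := hF.arr 7 rfl
    simp [val, hh] at e2 e3 e4 e5
    have hRi : σ.arrs 5 (4 * h + q) = R (4 * h + q) := hσ.list _ (by omega)
    have hRB : R (4 * h + q) ≤ B := (hσ.list_lt _ (by omega)).le.trans hB.rows
    have hnat : ((4 : ℤ) * h + q).toNat = 4 * h + q := by omega
    have hnat0 : ((4 : ℤ) * h).toNat = 4 * h := by omega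
    have hnat1 : ((4 : ℤ) * h + 1).toNat = 4 * h + 1 := by omega
    have hnat2 : ((4 : ℤ) * h + 2).toNat = 4 * h + 2 := by omega
    have hnat3 : ((4 : ℤ) * h + 3).toNat = 4 * h + 3 := by omega
    have hB3 := hB.three
    have hB1 : (1 : ℤ) ≤ B := by omega
    have hB3' : (3 : ℤ) ≤ B := by omega
    have p0 : (0 : ℤ) ≤ 4 * h := by omega
    have p1 : (0 : ℤ) ≤ 4 * h + 1 := by omega
    have p2 : (0 : ℤ) ≤ 4 * h + 2 := by omega
    have p3 : (0 : ℤ) ≤ 4 * h + 3 := by omega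
    have p4 : (0 : ℤ) ≤ 4 * h + q := by omega
    refine Ends.put_cons ?_ ?_ ?_ ?_ (Ends.put_cons ?_ ?_ ?_ ?_ (Ends.put_cons ?_ ?_ ?_ ?_
      (Ends.put_cons ?_ ?_ ?_ ?_ (Ends.put_cons ?_ ?_ ?_ ?_ (Ends.put_cons ?_ ?_ ?_ ?_
      (Ends.nil ?_)))))) <;>
    simp only [Ok, val, State.setCell_vars, e2, e3, h31, hnat, hnat0, hnat1, hnat2, hnat3, abs_neg,
      abs_one, hB1, and_self, p0, p1, p2, p3, p4, Nat.abs_ofNat, hB3']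
    · simp
    · simpa [e4, hRi] using hRB
    -- All four coefficients are first set to -1, and the chosen one is then overwritten by 3.
    · obtain ⟨κ', hκ'⟩ : ∃ κ', κ' = Function.update (Function.update (Function.update
          (Function.update (Function.update (τ.arrs 6) (4 * h) (-1)) (4 * h + 1) (-1)) (4 * h + 2)
          (-1)) (4 * h + 3) (-1)) (4 * h + q) 3 := ⟨_, rfl⟩
      have hval : ∀ i, i < 4 * h ∨ 4 * h + 4 ≤ i → κ' i = σ.arrs 6 i := by
        intro i hi
        simp only [hκ', Function.update_apply, h6]
        rw [if_neg (by omega), if_neg (by omega), if_neg (by omega), if_neg (by omega),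
          if_neg (by omega)]
      have hval' : ∀ j < 4, κ' (4 * h + j) = if j = q then 3 else -1 := by
        intro j hj
        simp only [hκ', Function.update_apply]
        interval_cases j <;> simp [eq_comm]
      generalize hω : State.setCell _ 7 _ _ = ω
      have k6 : ω.arrs 6 = κ' := by rw [← hω, hκ']; simp
      have k7 : ω.arrs 7 = Function.update (σ.arrs 7) h (R (4 * h + q)) := by
        rw [← hω]; simp [e4, e5, hRi]
      rw [k6, k7]
      have hsum : ∀ j, ∑ i ∈ Ico s (4 * h), κ' i * dot T n (R i) (R (4 * h + j)) ^ 2 = sc j := fun j => sum_congr rfl fun i hi => by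
        rw [hval i (.inl (mem_Ico.1 hi).2)]
      refine ⟨⟨q, ⟨hq4, hval', fun j hj => ?_⟩, rfl⟩, fun i hi => hval i (.inl hi), fun i => ?_⟩
      · exact ((hsum q).le.trans (hmin j hj)).trans (hsum j).ge
      · by_cases hi : i < 4 * h ∨ 4 * h + 4 ≤ i
        · rw [hval i hi]; exact hσ.coeff i
        · obtain ⟨j, rfl⟩ : ∃ j, i = 4 * h + j := ⟨i - 4 * h, by omega⟩
          rw [hval' j (by omega)]
          split_ifs <;> norm_num
  · have : 4 * h - s ≤ 4 * b := by
      have := Nat.div_add_mod' h b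
      have := Nat.mod_lt h hb0
      omega
    have := Nat.mul_le_mul_right (n + 1) this
    omega

end Sampling

/-! ### Repeated thinning down to a sample of bounded size. -/

section Sampling

variable {B n L N₀ N b₀ : ℕ} {ε : ℝ} {σ : State} {T : ℕ → ℕ → ℤ} {R : ℕ → ℕ}

theorem GreedyChoice.congr {w : ℕ → ℕ → ℤ} {κ κ' : ℕ → ℤ} {b h q : ℕ}
    (hq : GreedyChoice w κ b h q) (hκ : ∀ i < 4 * h + 4, κ' i = κ i) :
    GreedyChoice w κ' b h q := by
  refine ⟨hq.1, fun j hj => by rw [hκ _ (by omega), hq.2.1 j hj], fun j hj => ?_⟩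
  have hsum : ∀ j, ∑ i ∈ Ico (4 * (h / b * b)) (4 * h), κ' i * w i (4 * h + j) =
      ∑ i ∈ Ico (4 * (h / b * b)) (4 * h), κ i * w i (4 * h + j) := fun j =>
    sum_congr rfl fun i hi => by rw [hκ i (by have := (mem_Ico.1 hi).2; omega)]
  rw [hsum, hsum]
  exact hq.2.2 j hj

/-- One round of thinning: the list is replaced by one of a quarter of its length, and the block
size is doubled. -/
def thinStep : Prog := block [
  assign 33 (div (var 32) (lit 4)),
  forLoop 28 (lit 0) (var 33) greedyStep,
  forLoop 28 (lit 0) (var 33) (put 5 (var 28) (get 7 (var 28))),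
  assign 32 (var 33),
  assign 34 (mul (lit 2) (var 34))]

/-- The kept entries go to array 7 and are copied back only at the end, because scoring reads again
earlier entries of the old list. -/
theorem ends_thinStep {H b : ℕ} (hσ : σ.Sampling n L N₀ (4 * H) T R)
    (hB : SampleBound B n L N₀ b₀) (hN : σ.vars 32 = (4 * H : ℕ)) (hb : σ.vars 34 = b)
    (hb0 : 0 < b) (hHN : 4 * H ≤ N₀) (hbB : 2 * b ≤ B) :
    Ends B ε thinStep σ (H * (4 * (4 * b * (n + 1) + 1) + 1) + H) fun τ =>
      ∃ (q : ℕ → ℕ) (κ : ℕ → ℤ), τ.Sampling n L N₀ H T (fun h => R (4 * h + q h)) ∧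
        (∀ h < H, GreedyChoice (fun i j => dot T n (R i) (R j) ^ 2) κ b h (q h)) ∧
        τ.vars 32 = H ∧ τ.vars 34 = (2 * b : ℕ) := by
  have hHB : H ≤ B := by have := hB.rows; omega
  have hv : (div (var 32) (lit 4)).val ε σ = H := by simp [val, hN]
  refine Ends.assign_cons (by simp [Ok, val]) (by rw [hv]; simpa using hHB)
    (Ends.cons (c₂ := H) (Ends.forLoop (c := 4 * (4 * b * (n + 1) + 1)) (s := 0) (b := H)
      (I := fun h τ => (∀ h' < h, ∃ q, GreedyChoice (fun i j => dot T n (R i) (R j) ^ 2)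
        (τ.arrs 6) b h' q ∧ τ.arrs 7 h' = R (4 * h' + q)) ∧ ∀ i, |τ.arrs 6 i| ≤ 3)
      rfl trivial (by simp [val]) (Nat.zero_le _) hHB ?_ ?_ ?_) ?_ (by simp))
  · exact ⟨by simp, by simpa using hσ.coeff⟩
  · intro τ hF
    have := hF.var 33 rfl
    simp only [State.setVar_vars, ↓reduceIte] at this
    exact ⟨trivial, by simp only [val, this]; simpa [val] using hv⟩
  · intro h τ _ hh hF h28 ⟨hI, h6⟩
    have e0 := hF.var 0 rfl
    have e1 := hF.var 34 rfl
    have e3 := hF.arr 4 rfl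
    have e4 := hF.arr 5 rfl
    simp at e0 e1 e3 e4
    refine (ends_greedyStep (N := 4 * H) (T := T) (R := R) ⟨?_, ?_, ?_, ?_, hσ.list_lt, h6⟩ hB h28
      (e1.trans hb) hb0 (by omega) hHN).mono' le_rfl ?_
    · rw [e0, hσ.cols]
    · rw [← hσ.mat]; ext x y; simp [State.mat, e3]
    · simpa [e3] using hσ.entry
    · simpa [e4] using hσ.list
    · rintro υ hFυ ⟨⟨q, hq, h7⟩, hlow, h6'⟩
      refine ⟨fun h' hh' => ?_, by simpa using h6'⟩
      rcases Nat.lt_succ_iff_lt_or_eq.1 hh' with hlt | rfl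
      · obtain ⟨q', hq', h7'⟩ := hI h' hlt
        refine ⟨q', hq'.congr fun i hi => by simpa using hlow i (by omega), ?_⟩
        simp [h7, hlt.ne, h7']
      · exact ⟨q, by simpa using hq, by simp [h7]⟩
  · rintro τ hF ⟨⟨hI, h6⟩, -⟩
    have e0 := hF.var 0 rfl
    have e1 := hF.var 34 rfl
    have e2 := hF.var 33 rfl
    have e3 := hF.arr 4 rfl
    simp only [State.setVar_vars, ↓reduceIte, Nat.reduceEqDiff, State.setVar_arrs, OfNat.zero_ne_ofNat, hv] at e0 e1 e2 e3
    choose! q hq h7 using hI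
    refine Ends.cons (c₂ := 0) (Ends.forLoop (c := 0) (s := 0) (b := H)
      (I := fun h υ => ∀ h' < h, υ.arrs 5 h' = R (4 * h' + q h'))
      rfl trivial (by simp [val]) (Nat.zero_le _) hHB (by simp) ?_ ?_) ?_ (by omega)
    · intro υ hFυ
      have := hFυ.var 33 rfl
      simp [Ok, val, this, e2]
    · intro h υ _ hh hFυ h28 hI
      have f7 := hFυ.arr 7 rfl
      have hR : R (4 * h + q h) ≤ B :=
        (hσ.list_lt _ (by have := (hq h hh).1; omega)).le.trans hB.rows
      refine Ends.put (by simp [Ok]) (by simp [Ok, val, h28]) (by simp [val, h28]) ?_ ?_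
      · simpa [val, h28, f7, h7 h hh] using hR
      · intro h' hh'
        rcases Nat.lt_succ_iff_lt_or_eq.1 hh' with hlt | rfl
        · simp [val, h28, hlt.ne, hI h' hlt]
        · simp [val, h28, f7, h7 _ hh]
    · rintro υ hFυ ⟨hI, -⟩
      have f0 := hFυ.var 0 rfl
      have f1 := hFυ.var 34 rfl
      have f2 := hFυ.var 33 rfl
      have f3 := hFυ.arr 4 rfl
      have f4 := hFυ.arr 6 rfl
      refine Ends.assign_cons trivial ?_ (Ends.assign_cons (by simp [Ok]) ?_ (Ends.nil
        ⟨q, τ.arrs 6, ⟨?_, ?_, ?_, ?_, ?_, ?_⟩, hq, ?_, ?_⟩))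
      · simpa [val, f2, e2] using hHB
      · simp [val, f1, e1, hb]; exact_mod_cast hbB
      · simp [f0, e0, hσ.cols]
      · rw [← hσ.mat]; ext x y; simp [State.mat, f3, e3]
      · simpa [f3, e3] using hσ.entry
      · simpa using hI
      · intro h hh
        exact hσ.list_lt _ (by have := (hq h hh).1; omega)
      · simpa [f4] using h6
      · simp [val, f2, e2]
      · simp [val, f1, e1, hb]

/-- The selection of a sample of the rows: register `7` holds the number of rows, a power of four,
and register `8` the initial block size. The sample is left in array `5`, its size in
register `32`. -/
def sample : Prog := block [
  forLoop 28 (lit 0) (var 7) (put 5 (var 28) (var 28)),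
  assign 32 (var 7),
  assign 34 (var 8),
  loop (lt (mul (lit 4) (var 8)) (var 32)) thinStep]

/-- The list length is a power of four and the block size a power of two, so one divides into
quadruples and blocks without remainder, or has a single block. The product of length and block size
halves in every round, and a geometric series bounds the total work by a multiple of n N₀ b₀. -/
theorem ends_sample {j k : ℕ} (hn : 0 < n) (h0 : σ.vars 0 = n) (h7 : σ.vars 7 = N₀)
    (h8 : σ.vars 8 = b₀) (hN : N₀ = 4 ^ j) (hb : b₀ = 2 ^ k) (hT : σ.mat 4 n = T)
    (hL : ∀ i, |σ.arrs 4 i| ≤ L) (h6 : ∀ i, |σ.arrs 6 i| ≤ 3) (hB : SampleBound B n L N₀ b₀) :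
    Ends B ε sample σ (N₀ + 20 * n * N₀ * b₀) fun τ => ∃ (N : ℕ) (R : ℕ → ℕ),
      τ.Sampling n L N₀ N T R ∧ τ.vars 32 = N ∧ 0 < N ∧ N ≤ 4 * b₀ ∧
      ‖((N₀ : ℝ) / N) • ∑ i ∈ range N, rowSq T n (R i) - ∑ v ∈ range N₀, rowSq T n v‖ ≤
        N₀ * (n * (L : ℝ) ^ 2) * (9 / √b₀) := by
  have hN0 : 0 < N₀ := by rw [hN]; positivity
  have hb0 : 0 < b₀ := by rw [hb]; positivity
  have hb0B : b₀ ≤ B := (Nat.le_mul_of_pos_left _ hN0).trans hB.size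
  refine Ends.cons (c₂ := 20 * n * N₀ * b₀) (Ends.forLoop (c := 0) (s := 0) (b := N₀)
    (I := fun i τ => ∀ i' < i, τ.arrs 5 i' = i') rfl trivial (by simp [val]) (Nat.zero_le _)
    hB.rows (by simp) ?_ ?_) ?_ (by simp)
  · intro τ hF
    simp [Ok, val, hF.var 7 rfl, h7]
  · intro i τ _ hi hF h28 hI
    refine Ends.put (by simp [Ok]) (by simp [Ok]) (by simp [val, h28]) ?_ ?_
    · have := hB.rows
      simp [val, h28]; omega
    · intro i' hi'
      rcases Nat.lt_succ_iff_lt_or_eq.1 hi' with hlt | rfl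
      · simp [val, h28, hlt.ne, hI i' hlt]
      · simp [val, h28]
  · rintro τ hF ⟨hI, -⟩
    have e0 := hF.var 0 rfl
    have e7 := hF.var 7 rfl
    have e8 := hF.var 8 rfl
    have e4 := hF.arr 4 rfl
    have e6 := hF.arr 6 rfl
    refine Ends.assign_cons trivial (by simpa [val, e7, h7] using hB.rows)
      (Ends.assign_cons trivial (by simpa [val, e8, h8] using hb0B) (Ends.cons (c₂ := 0)
      -- The remaining budget is 20nNb for current length N and block size b. A further round occurs
      -- only if N > 4b₀, so the new length stays at least b₀, as `Represents.norm_le` requires.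
      (Ends.loop (I := fun v υ => ∃ (N : ℕ) (R : ℕ → ℕ) (b : ℕ), υ.Sampling n L N₀ N T R ∧
        υ.vars 32 = N ∧ υ.vars 34 = b ∧ υ.vars 8 = b₀ ∧ (∃ i, N = 4 ^ i) ∧ (∃ i, b = 2 ^ i) ∧
        N ≤ N₀ ∧ N * b ≤ N₀ * b₀ ∧ v = 20 * n * N * b ∧ (N = N₀ ∨ b₀ ≤ N) ∧
        Represents (rowSq T n) (n * (L : ℝ) ^ 2) b₀ N₀ R N b) ?_ ?_ ?_) ?_ le_rfl))
    · refine ⟨N₀, id, b₀, ⟨?_, ?_, ?_, ?_, fun i hi => hi, ?_⟩, ?_, ?_, ?_, ⟨j, hN⟩, ⟨k, hb⟩,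
        le_rfl, le_rfl, rfl, .inl rfl, Represents.init _ _ _ hN0 fun _ _ => rfl⟩
      · simp [e0, h0]
      · rw [← hT]; ext x y; simp [State.mat, e4]
      · simpa [e4] using hL
      · simpa using hI
      · simpa [e6] using h6
      · simp [val, e7, h7]
      · simp [val, e8, h8]
      · simp [e8, h8]
    · intro v υ _
      simp [Ok]
    · rintro v υ hFυ ⟨N, R, b, hS, h32, h34, h8', ⟨i, rfl⟩, ⟨l, rfl⟩, hNN, hNb, rfl, -, hrep⟩ hne
      have hlt : 4 * b₀ < 4 ^ i := by
        by_contra hc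
        apply hne
        simp only [val, h8', h32]
        rw [if_neg (by exact_mod_cast hc)]
      cases i with
      | zero => simp at hlt; omega
      | succ i =>
      have e : 4 ^ (i + 1) = 4 * 4 ^ i := by ring
      rw [e] at hS h32 hNN hNb hrep hlt
      set H := 4 ^ i with hH
      set b := 2 ^ l with hbl
      have hHpos : 0 < H := by positivity
      have hbpos : 0 < b := by positivity
      have hHb : 1 ≤ H * b := Nat.mul_pos hHpos hbpos
      have h2b : 2 * b ≤ 4 * H * b := by
        rw [mul_assoc]
        have : b ≤ H * b := Nat.le_mul_of_pos_left _ hHpos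
        omega
      refine ⟨_, (ends_thinStep hS hB h32 h34 hbpos hNN (h2b.trans (hNb.trans hB.size))).mono'
        le_rfl ?_⟩
      rintro ω hFω ⟨q, κ, hS', hq, g32, g34⟩
      have hdvd : b ∣ H ∨ H ≤ b := by
        rw [hH, hbl, show (4 : ℕ) = 2 ^ 2 by norm_num, ← pow_mul]
        rcases le_total l (2 * i) with h | h
        · exact .inl (pow_dvd_pow 2 h)
        · exact .inr (Nat.pow_le_pow_right (by norm_num) h)
      refine ⟨20 * n * H * (2 * b), ?_, H, _, 2 * b, hS', g32, g34,
        (hFω.var 8 rfl).trans h8', ⟨i, rfl⟩, ⟨l + 1, by rw [hbl]; ring⟩, by omega, ?_, rfl,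
        .inr (by omega), hrep.step hHpos hbpos hdvd (by positivity) ?_ ?_ hq fun _ _ => rfl⟩
      · have h1 : H ≤ H * b * n := by
          rw [mul_assoc]; exact Nat.le_mul_of_pos_right _ (Nat.mul_pos hbpos hn)
        have h2 : H * b ≤ H * b * n := Nat.le_mul_of_pos_right _ hn
        rw [e]
        -- With length 4H, at most 39nHb goes into the round itself and 40nHb is the next budget;
        -- 80nHb is available.
        nlinarith
      · calc H * (2 * b) ≤ 4 * H * b := by nlinarith
          _ ≤ _ := hNb
      · intro t _
        exact norm_rowSq_le fun x _ => by exact_mod_cast hS.abs_le _ _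
      · intro s _ t _
        rw [inner_rowSq]
    · rintro υ - ⟨h0, v, N, R, b, hS, h32, h34, h8', ⟨i, rfl⟩, -, hNN, -, -, hor, hrep⟩
      refine Ends.nil ⟨_, R, hS, h32, by positivity, ?_,
        hrep.norm_le (by positivity) hb0 hor⟩
      by_contra hc
      simp only [val, h8', h32] at h0
      rw [if_pos (by exact_mod_cast not_le.1 hc)] at h0
      omega

end Sampling

/-! ### The search for a large cut -/

/-- Store the cut given by the arrays `9` and `11` in rows number `vars 9` of the output arrays,
with the sign in register `40`. -/
def record : Prog := block [
  assign 42 (lit 1),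
  assign 44 (var 40),
  put 1 (var 9) (var 40),
  forLoop 38 (lit 0) (var 0) (block [
    put 2 (add (mul (var 9) (var 0)) (var 38)) (get 9 (var 38)),
    put 3 (add (mul (var 9) (var 0)) (var 38)) (get 11 (var 38))])]

/-- Collect in array `11` the indices at which array `10` has the sign in register `40`, and record
the cut if it is the first one that is larger than the threshold in register `11`. -/
def trySecondSign : Prog := block [
  assign 41 (lit 0),
  forLoop 38 (lit 0) (var 0) (block [
    put 11 (var 38) (lt (lit 0) (mul (var 40) (get 10 (var 38)))),
    assign 41 (add (var 41) (mul (get 11 (var 38)) (get 10 (var 38))))]),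
  ite (mul (lt (var 42) (lit 1)) (lt (var 11) (mul (var 40) (var 41)))) record skip]

/-- Collect in array `9` the indices at which array `8` has the sign in register `37`, compute the
sums of the corresponding columns, and try both signs for these. -/
def tryFirstSign : Prog := block [
  forLoop 35 (lit 0) (var 0)
    (put 9 (var 35) (lt (lit 0) (mul (var 37) (get 8 (var 35))))),
  assign 20 (lit 0),
  forLoop 35 (lit 0) (var 0) (block [
    assign 21 (var 35), rowProduct 9 4, put 10 (var 35) (var 22)]),
  assign 40 (lit 1),
  trySecondSign,
  assign 40 (lit (-1)),
  trySecondSign]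

/-- Try the four cuts given by the row with number in register `21`. -/
def tryRow : Prog := block [
  forLoop 35 (lit 0) (var 0) (block [
    assign 20 (var 35), rowProduct 4 4, put 8 (var 35) (var 22)]),
  assign 37 (lit 1),
  tryFirstSign,
  assign 37 (lit (-1)),
  tryFirstSign]

/-- A cut that is larger than `θ` has been recorded in rows number `r` of the output arrays. -/
def State.Hit (σ : State) (n r : ℕ) (T : ℕ → ℕ → ℤ) (θ : ℤ) : Prop :=
  ∃ s, (s = 1 ∨ s = -1) ∧ σ.vars 44 = s ∧ σ.arrs 1 r = s ∧
    (∀ x < n, σ.mat 2 n r x = 0 ∨ σ.mat 2 n r x = 1) ∧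
    (∀ x < n, σ.mat 3 n r x = 0 ∨ σ.mat 3 n r x = 1) ∧
    θ < s * ∑ x ∈ range n, ∑ y ∈ range n, σ.mat 3 n r x * σ.mat 2 n r y * T x y

/-- Register `42` tells whether a large cut has been recorded. -/
def State.Found (σ : State) (n r : ℕ) (T : ℕ → ℕ → ℤ) (θ : ℤ) : Prop :=
  σ.vars 42 = 0 ∨ σ.vars 42 = 1 ∧ σ.Hit n r T θ

/-- A part of the search leads from `σ` to `τ`; if no cut has been recorded then `P` holds. -/
structure Searched (n r : ℕ) (T : ℕ → ℕ → ℤ) (θ : ℤ) (σ τ : State) (P : Prop) : Prop where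
  found : τ.Found n r T θ
  sign : ∀ i < r, τ.arrs 1 i = σ.arrs 1 i
  left : ∀ i < r * n, τ.arrs 2 i = σ.arrs 2 i
  right : ∀ i < r * n, τ.arrs 3 i = σ.arrs 3 i
  none : τ.vars 42 = 0 → σ.vars 42 = 0 ∧ P

/-! ### Correctness and cost of the search over sampled rows. -/

section Search

variable {B n r L : ℕ} {ε : ℝ} {σ τ υ : State} {T : ℕ → ℕ → ℤ} {θ : ℤ} {P Q : Prop}

/-- Register 42 is never cleared during the search. If it is 0 at the end, it was 0 all along, so
the negative findings of all parts hold together. -/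
theorem Searched.trans (h : Searched n r T θ σ τ P) (h' : Searched n r T θ τ υ Q) :
    Searched n r T θ σ υ (P ∧ Q) :=
  ⟨h'.found, fun i hi => (h'.sign i hi).trans (h.sign i hi),
    fun i hi => (h'.left i hi).trans (h.left i hi),
    fun i hi => (h'.right i hi).trans (h.right i hi),
    fun h0 => ⟨(h.none (h'.none h0).1).1, (h.none (h'.none h0).1).2, (h'.none h0).2⟩⟩

theorem Searched.imp (h : Searched n r T θ σ τ P) (hPQ : P → Q) : Searched n r T θ σ τ Q :=
  ⟨h.found, h.sign, h.left, h.right, fun h0 => ⟨(h.none h0).1, hPQ (h.none h0).2⟩⟩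

theorem State.Found.congr (h : σ.Found n r T θ) (h42 : τ.vars 42 = σ.vars 42)
    (h44 : τ.vars 44 = σ.vars 44) (h1 : τ.arrs 1 = σ.arrs 1) (h2 : τ.arrs 2 = σ.arrs 2)
    (h3 : τ.arrs 3 = σ.arrs 3) : τ.Found n r T θ := by
  simpa [State.Found, State.Hit, State.mat, h42, h44, h1, h2, h3] using h

theorem Searched.of_eq (h : σ.Found n r T θ) (h42 : τ.vars 42 = σ.vars 42)
    (h44 : τ.vars 44 = σ.vars 44) (h1 : τ.arrs 1 = σ.arrs 1) (h2 : τ.arrs 2 = σ.arrs 2)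
    (h3 : τ.arrs 3 = σ.arrs 3) : Searched n r T θ σ τ True :=
  ⟨h.congr h42 h44 h1 h2 h3, by simp [h1], by simp [h2], by simp [h3], by simp [h42]⟩

theorem signSet_eq (T : ℕ → ℕ → ℤ) (n v : ℕ) (s : ℤ) (u : ℕ) :
    signSet T n v s u = 0 ∨ signSet T n v s u = 1 := by
  unfold signSet; split_ifs <;> simp

theorem signSet'_eq (T : ℕ → ℕ → ℤ) (n v : ℕ) (s s' : ℤ) (u : ℕ) :
    signSet' T n v s s' u = 0 ∨ signSet' T n v s s' u = 1 := by
  unfold signSet'; split_ifs <;> simp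

theorem abs_le_one_of_eq {a : ℤ} (h : a = 0 ∨ a = 1) : |a| ≤ (1 : ℕ) := by
  rcases h with h | h <;> simp [h]

theorem abs_signSum_le (hT : ∀ x y, |T x y| ≤ L) (v : ℕ) (s : ℤ) (y : ℕ) :
    |signSum T n v s y| ≤ (n * L : ℕ) :=
  (abs_sum_mul_le (M := 1) (M' := L) (fun i => abs_le_one_of_eq (signSet_eq T n v s i)) (hT y)
    le_rfl (i := fun j => j) (j := fun j => j)).trans (by simp)

theorem ends_record {s : ℤ} {f g : ℕ → ℤ} (h0 : σ.vars 0 = n) (h9 : σ.vars 9 = r)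
    (h40 : σ.vars 40 = s) (hs : s = 1 ∨ s = -1) (hf : ∀ x < n, σ.arrs 9 x = f x)
    (hg : ∀ x < n, σ.arrs 11 x = g x) (hf1 : ∀ x, f x = 0 ∨ f x = 1)
    (hg1 : ∀ x, g x = 0 ∨ g x = 1) (hB : 1 ≤ B) (hn : n ≤ B)
    (hθ : θ < s * ∑ x ∈ range n, ∑ y ∈ range n, g x * f y * T x y) :
    Ends B ε record σ n fun τ => τ.vars 42 = 1 ∧ τ.Hit n r T θ ∧
      (∀ i < r, τ.arrs 1 i = σ.arrs 1 i) ∧ (∀ i < r * n, τ.arrs 2 i = σ.arrs 2 i) ∧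
      ∀ i < r * n, τ.arrs 3 i = σ.arrs 3 i := by
  have hs1 : |s| ≤ B := by rcases hs with rfl | rfl <;> simpa using hB
  have hBf : ∀ x, |f x| ≤ B := fun x => (abs_le_one_of_eq (hf1 x)).trans (by exact_mod_cast hB)
  have hBg : ∀ x, |g x| ≤ B := fun x => (abs_le_one_of_eq (hg1 x)).trans (by exact_mod_cast hB)
  refine Ends.assign_cons trivial (by simpa [val] using hB) (Ends.assign_cons trivial
    (by simpa [val, h40] using hs1) (Ends.put_cons trivial trivial (by simp [val, h9])
    (by simpa [val, h40] using hs1) (Ends.cons (c₂ := 0) (Ends.forLoop (c := 0) (s := 0) (b := n)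
    (I := fun i τ => (∀ x < i, τ.mat 2 n r x = f x ∧ τ.mat 3 n r x = g x) ∧
      (∀ i < r * n, τ.arrs 2 i = σ.arrs 2 i) ∧ ∀ i < r * n, τ.arrs 3 i = σ.arrs 3 i)
    rfl trivial (by simp [val]) (Nat.zero_le _) hn ?_ ?_ ?_) ?_ (by simp))))
  · simp [val]
  · intro τ hF
    simp [Ok, val, hF.var 0 rfl, h0]
  · intro i τ _ hi hF h38 ⟨hI, h2, h3⟩
    have e0 := hF.var 0 rfl
    have e9 := hF.var 9 rfl
    have ea := hF.arr 9 rfl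
    have eb := hF.arr 11 rfl
    simp [val, h0, h9] at e0 e9 ea eb
    have hp : (0 : ℤ) ≤ r * n + i := by positivity
    refine Ends.put_cons (by simp [Ok]) (by simp [Ok, val, h38]) (by simp [val, e0, e9, h38, hp])
      (by simpa [val, h38, ea, hf i hi] using hBf i) (Ends.put_cons (by simp [Ok])
      (by simp [Ok, val, h38]) (by simp [val, e0, e9, h38, hp])
      (by simpa [val, h38, eb, hg i hi] using hBg i) (Ends.nil ⟨?_, ?_, ?_⟩))
    · intro x hx
      rcases Nat.lt_succ_iff_lt_or_eq.1 hx with hlt | rfl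
      · have := hI x hlt
        simp only [State.mat] at this
        simp [State.mat, val, e0, e9, h38, hlt.ne, this]
      · simp [State.mat, val, e0, e9, h38, ea, eb, hf x hi, hg x hi]
    · intro k hk
      have : k ≠ r * n + i := by omega
      simp [val, e0, e9, h38, this, h2 k hk]
    · intro k hk
      have : k ≠ r * n + i := by omega
      simp [val, e0, e9, h38, this, h3 k hk]
  · rintro τ hF ⟨⟨hI, h2, h3⟩, -⟩
    have e42 := hF.var 42 rfl
    have e44 := hF.var 44 rfl
    have e1 := hF.arr 1 rfl
    simp [val, h9, h40] at e42 e44 e1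
    refine Ends.nil ⟨e42, ⟨s, hs, e44, by simp [e1], fun x hx => ?_, fun x hx => ?_, ?_⟩,
      fun i hi => ?_, h2, h3⟩
    · rw [(hI x hx).1]; exact hf1 x
    · rw [(hI x hx).2]; exact hg1 x
    · refine hθ.trans_le (le_of_eq ?_)
      refine congrArg _ (sum_congr rfl fun x hx => sum_congr rfl fun y hy => ?_)
      rw [(hI x (by simpa using hx)).2, (hI y (by simpa using hy)).1]
    · simp [e1, hi.ne]

/-- The words are long enough for the search. -/
structure SearchBound (B n L : ℕ) : Prop where
  cols : n ≤ B
  product : n * L * L ≤ B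
  sum : n * L ≤ B
  cut : n * (n * L) ≤ B
  one : 1 ≤ B

/-- The product of the two tests acts as a conjunction, so only the first large cut is recorded. If
register 42 is still 0 afterwards, the second test must have failed for this cut. -/
theorem ends_trySecondSign {v : ℕ} {s s' : ℤ} (h0 : σ.vars 0 = n) (h9 : σ.vars 9 = r)
    (h11 : σ.vars 11 = θ) (h40 : σ.vars 40 = s') (hs' : s' = 1 ∨ s' = -1)
    (hf : ∀ x < n, σ.arrs 9 x = signSet T n v s x)
    (hg : ∀ x < n, σ.arrs 10 x = signSum T n v s x) (hT : ∀ x y, |T x y| ≤ L)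
    (hB : SearchBound B n L) (hfd : σ.Found n r T θ) :
    Ends B ε trySecondSign σ (2 * n) fun τ =>
      Searched n r T θ σ τ (s' * signCut T n v s s' ≤ θ) := by
  have hB1 := hB.one
  refine Ends.assign_cons trivial (by simp [val]) (Ends.cons (c₂ := n) (Ends.forLoop (c := 0)
    (s := 0) (b := n) (I := fun i τ => (∀ x < i, τ.arrs 11 x = signSet' T n v s s' x) ∧
      τ.vars 41 = ∑ y ∈ range i, signSet' T n v s s' y * signSum T n v s y)
    rfl trivial (by simp [val]) (Nat.zero_le _) hB.cols ?_ ?_ ?_) ?_ (by omega))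
  · simp [val]
  · intro τ hF
    simp [Ok, val, hF.var 0 rfl, h0]
  · intro i τ _ hi hF h38 ⟨hI, h41⟩
    have e40 := hF.var 40 rfl
    have ea := hF.arr 10 rfl
    simp [h40] at e40 ea
    have hv : (lt (lit 0) (mul (var 40) (get 10 (var 38)))).val ε τ = signSet' T n v s s' i := by
      simp [val, e40, ea, h38, hg i hi, signSet']
    refine Ends.put_cons trivial (by simp [Ok, val, h38]) (by simp [val, h38]) ?_
      (Ends.assign_cons (by simp [Ok, val, h38]) ?_ (Ends.nil ⟨fun x hx => ?_, ?_⟩))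
    · rw [hv]
      exact (abs_le_one_of_eq (signSet'_eq _ _ _ _ _ _)).trans (by exact_mod_cast hB1)
    · rw [hv]
      have : (add (var 41) (mul (get 11 (var 38)) (get 10 (var 38)))).val ε
          (τ.setCell 11 ((var 38).val ε τ).toNat (signSet' T n v s s' i)) =
          ∑ y ∈ range (i + 1), signSet' T n v s s' y * signSum T n v s y := by
        rw [sum_range_succ]
        simp [val, h38, ea, hg i hi, h41]
      rw [this]
      refine (abs_sum_mul_le (M := 1) (M' := n * L) (n := n) (i := fun j => j) (j := fun j => j)
        (fun i => abs_le_one_of_eq (signSet'_eq T n v s s' i)) (abs_signSum_le hT v s) hi).trans ?_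
      have := hB.cut
      exact_mod_cast (by simpa using this)
    · rw [hv]
      rcases Nat.lt_succ_iff_lt_or_eq.1 hx with hlt | rfl
      · simp [val, h38, hlt.ne, hI x hlt]
      · simp [val, h38]
    · rw [hv, sum_range_succ]
      simp [val, h38, ea, hg i hi, h41]
  · rintro τ hF ⟨⟨hI, h41⟩, -⟩
    have e0 := hF.var 0 rfl
    have e9 := hF.var 9 rfl
    have e11 := hF.var 11 rfl
    have e40 := hF.var 40 rfl
    have e42 := hF.var 42 rfl
    have e44 := hF.var 44 rfl
    have a1 := hF.arr 1 rfl
    have a2 := hF.arr 2 rfl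
    have a3 := hF.arr 3 rfl
    have a9 := hF.arr 9 rfl
    simp [h0, h9, h11, h40] at e0 e9 e11 e40 e42 e44 a1 a2 a3 a9
    have hcut : τ.vars 41 = signCut T n v s s' := h41
    refine Ends.cons (c₁ := n) (c₂ := 0)
      (R' := fun τ => Searched n r T θ σ τ (s' * signCut T n v s s' ≤ θ))
      (Ends.ite (by simp [Ok]) ?_ ?_) (fun _ _ h => Ends.nil h) le_rfl
    · intro hne
      have hcond : σ.vars 42 = 0 ∧ θ < s' * signCut T n v s s' := by
        simp only [val, e11, e40, e42, hcut] at hne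
        constructor
        · by_contra h
          rcases hfd with h' | ⟨h', -⟩
          · exact h h'
          · rw [h'] at hne; simp at hne
        · by_contra h
          rw [if_neg h] at hne; simp at hne
      refine (ends_record e0 e9 e40 hs' (f := signSet T n v s) (g := signSet' T n v s s')
        (fun x hx => by rw [a9]; exact hf x hx) hI (signSet_eq T n v s) (signSet'_eq T n v s s')
        hB1 hB.cols (T := T) (θ := θ) ?_).mono' le_rfl ?_
      · refine hcond.2.trans_le (le_of_eq (congrArg _ ?_))
        refine sum_congr rfl fun x _ => ?_
        rw [signSum, mul_sum]
        exact sum_congr rfl fun y _ => (mul_assoc _ _ _).symm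
      · rintro υ - ⟨h42, hit, k1, k2, k3⟩
        exact ⟨.inr ⟨h42, hit⟩, by simpa [a1] using k1, by simpa [a2] using k2,
          by simpa [a3] using k3, fun h => by rw [h42] at h; norm_num at h⟩
    · intro heq
      refine Ends.skip ((Searched.of_eq hfd e42 e44 a1 a2 a3).trans (Q := _)
        ⟨hfd.congr e42 e44 a1 a2 a3, by simp, by simp, by simp, fun h => ⟨h, ?_⟩⟩ |>.imp And.right)
      by_contra hc
      simp only [val, e11, e40, hcut, h] at heq
      rw [if_pos (not_le.1 hc)] at heq
      simp at heq

/-- The sums `signSum` are inner products of the indicator vector in array 9, viewed as row 0, with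
the rows of the matrix, so `rowProduct` can be reused. -/
theorem ends_tryFirstSign {v : ℕ} {s : ℤ} (h0 : σ.vars 0 = n) (h9 : σ.vars 9 = r)
    (h11 : σ.vars 11 = θ) (h37 : σ.vars 37 = s)
    (hd : ∀ u < n, σ.arrs 8 u = dot T n u v) (h4 : σ.mat 4 n = T)
    (hT : ∀ i, |σ.arrs 4 i| ≤ L) (h9' : ∀ i, |σ.arrs 9 i| ≤ 1)
    (hB : SearchBound B n L) (hfd : σ.Found n r T θ) :
    Ends B ε tryFirstSign σ (n + n * (n + 1) + 4 * n) fun τ =>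
      Searched n r T θ σ τ (∀ s', s' = 1 ∨ s' = -1 → s' * signCut T n v s s' ≤ θ) ∧
        ∀ i, |τ.arrs 9 i| ≤ 1 := by
  have hB1 := hB.one
  have hT' : ∀ x y, |T x y| ≤ L := fun x y => by rw [← h4]; exact hT _
  refine Ends.cons (c₂ := n * (n + 1) + 4 * n) (Ends.forLoop (c := 0) (s := 0) (b := n)
    (I := fun i τ => (∀ x < i, τ.arrs 9 x = signSet T n v s x) ∧ ∀ i, |τ.arrs 9 i| ≤ 1)
    rfl trivial (by simp [val]) (Nat.zero_le _) hB.cols ?_ ?_ ?_) ?_ (by simp; omega)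
  · simpa using h9'
  · intro τ hF
    simp [Ok, val, hF.var 0 rfl, h0]
  · intro i τ _ hi hF h35 ⟨hI, hI'⟩
    have e37 := hF.var 37 rfl
    have a8 := hF.arr 8 rfl
    have hv : (lt (lit 0) (mul (var 37) (get 8 (var 35)))).val ε τ = signSet T n v s i := by
      simp [val, e37, h37, a8, h35, hd i hi, signSet]
    have h1 : |signSet T n v s i| ≤ 1 := by simpa using abs_le_one_of_eq (signSet_eq T n v s i)
    refine Ends.put trivial (by simp [Ok, val, h35]) (by simp [val, h35])
      (by rw [hv]; exact h1.trans (by exact_mod_cast hB1)) ⟨fun x hx => ?_, fun x => ?_⟩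
    · rw [hv]
      rcases Nat.lt_succ_iff_lt_or_eq.1 hx with hlt | rfl
      · simp [val, h35, hlt.ne, hI x hlt]
      · simp [val, h35]
    · rw [hv]
      simp only [State.setVar_arrs, State.setCell_arrs_same, Function.update_apply]
      split_ifs
      · exact h1
      · exact hI' x
  · rintro τ hF ⟨⟨hI, hI'⟩, -⟩
    have e0 := hF.var 0 rfl
    have e9 := hF.var 9 rfl
    have e11 := hF.var 11 rfl
    have e42 := hF.var 42 rfl
    have e44 := hF.var 44 rfl
    have a1 := hF.arr 1 rfl
    have a2 := hF.arr 2 rfl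
    have a3 := hF.arr 3 rfl
    have a4 := hF.arr 4 rfl
    refine Ends.assign_cons trivial (by simp [val]) (Ends.cons (c₂ := 4 * n) (Ends.forLoop (c := n)
      (s := 0) (b := n) (I := fun i υ => ∀ x < i, υ.arrs 10 x = signSum T n v s x)
      rfl trivial (by simp [val]) (Nat.zero_le _) hB.cols ?_ ?_ ?_) ?_ (by simp))
    · simp
    · intro υ hF'
      simp [Ok, val, hF'.var 0 rfl, e0, h0]
    · intro i υ _ hi hF' h35 hI10
      have f0 := hF'.var 0 rfl
      have f20 := hF'.var 20 rfl
      have b4 := hF'.arr 4 rfl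
      have b9 := hF'.arr 9 rfl
      simp [val, e0, h0, a4] at f0 f20 b4 b9
      refine Ends.assign_cons trivial (by simp [val, h35]; have := hB.cols; omega)
        (Ends.cons (c₂ := 0) (ends_rowProduct (n := n) (u := 0) (w := i) (M := 1) (M' := L)
          (by simp [f0]) (by simp [f20]) (by simp [val, h35]) (by simpa [b9] using hI')
          (by simpa [b4] using hT) hB.cols (by simpa using hB.sum)) ?_ le_rfl)
      intro ω hFω h22
      have g35 := hFω.var 35 rfl
      have b10 := hFω.arr 10 rfl
      simp [h35] at g35 b10
      have h22' : ω.vars 22 = signSum T n v s i := by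
        rw [h22, signSum]
        refine sum_congr rfl fun j hj => ?_
        have : T i j = σ.arrs 4 (i * n + j) := by rw [← h4]; rfl
        simp [b9, b4, hI j (by simpa using hj), this]
      refine Ends.put_cons trivial trivial (by simp [val, g35]) ?_ (Ends.nil fun x hx => ?_)
      · simp only [val, h22']
        exact (abs_signSum_le hT' v s i).trans (by exact_mod_cast hB.sum)
      · rcases Nat.lt_succ_iff_lt_or_eq.1 hx with hlt | rfl
        · simp [val, g35, b10, hlt.ne, hI10 x hlt]
        · simp [val, g35, h22']
    · rintro υ hF' ⟨hI10, -⟩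
      have f0 := hF'.var 0 rfl
      have f9 := hF'.var 9 rfl
      have f11 := hF'.var 11 rfl
      have f42 := hF'.var 42 rfl
      have f44 := hF'.var 44 rfl
      have b1 := hF'.arr 1 rfl
      have b2 := hF'.arr 2 rfl
      have b3 := hF'.arr 3 rfl
      have b9 := hF'.arr 9 rfl
      simp [e0, e9, e11, e42, e44, a1, a2, a3, h0, h9, h11] at f0 f9 f11 f42 f44 b1 b2 b3 b9
      have hS0 : Searched n r T θ σ (υ.setVar 40 ((lit 1).val ε υ)) True :=
        Searched.of_eq hfd (by simp [f42]) (by simp [f44]) b1 b2 b3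
      refine Ends.assign_cons trivial (by simpa [val] using hB1) (Ends.cons (c₁ := 2 * n)
        (c₂ := 2 * n) (ends_trySecondSign (v := v) (s := s) (s' := 1) (T := T) (θ := θ) (n := n)
        (r := r) (by simp [f0]) (by simp [f9]) (by simp [f11]) (by simp [val]) (.inl rfl)
        (by simpa [b9] using hI) (by simpa using hI10) hT' hB hS0.found) ?_ (by omega))
      intro ω hFω hS1
      have g0 := hFω.var 0 rfl
      have g9 := hFω.var 9 rfl
      have g11 := hFω.var 11 rfl
      have c9 := hFω.arr 9 rfl
      have c10 := hFω.arr 10 rfl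
      simp [f0, f9, f11, b9] at g0 g9 g11 c9 c10
      have hS2 : Searched n r T θ ω (ω.setVar 40 ((lit (-1)).val ε ω)) True :=
        Searched.of_eq hS1.found (by simp) (by simp) rfl rfl rfl
      refine Ends.assign_cons trivial (by simpa [val] using hB1) (Ends.cons (c₁ := 2 * n)
        (c₂ := 0) (ends_trySecondSign (v := v) (s := s) (s' := -1) (T := T) (θ := θ) (n := n)
        (r := r) (by simp [g0]) (by simp [g9]) (by simp [g11]) (by simp [val]) (.inr rfl)
        (by simpa [c9] using hI) (by simpa [c10] using hI10) hT' hB hS2.found) ?_ le_rfl)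
      intro ω' hFω' hS3
      have d9 := hFω'.arr 9 rfl
      refine Ends.nil ⟨(((hS0.trans hS1).trans hS2).trans hS3).imp ?_, ?_⟩
      · rintro ⟨⟨⟨-, k1⟩, -⟩, k2⟩ s' (rfl | rfl)
        exacts [k1, k2]
      · simpa [d9, c9] using hI'

theorem ends_tryRow {v : ℕ} (h0 : σ.vars 0 = n) (h9 : σ.vars 9 = r)
    (h11 : σ.vars 11 = θ) (h21 : σ.vars 21 = v) (h4 : σ.mat 4 n = T)
    (hT : ∀ i, |σ.arrs 4 i| ≤ L) (h9' : ∀ i, |σ.arrs 9 i| ≤ 1)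
    (hB : SearchBound B n L) (hfd : σ.Found n r T θ) :
    Ends B ε tryRow σ (n * (n + 1) + 2 * (n + n * (n + 1) + 4 * n)) fun τ =>
      Searched n r T θ σ τ (NoCut T n v θ) ∧ ∀ i, |τ.arrs 9 i| ≤ 1 := by
  have hB1 := hB.one
  have hT' : ∀ x y, |T x y| ≤ L := fun x y => by rw [← h4]; exact hT _
  refine Ends.cons (c₂ := 2 * (n + n * (n + 1) + 4 * n)) (Ends.forLoop (c := n)
    (s := 0) (b := n) (I := fun i υ => ∀ x < i, υ.arrs 8 x = dot T n x v)
    rfl trivial (by simp [val]) (Nat.zero_le _) hB.cols ?_ ?_ ?_) ?_ (by simp)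
  · simp
  · intro υ hF'
    simp [Ok, val, hF'.var 0 rfl, h0]
  · intro i υ _ hi hF' h35 hI
    have f0 := hF'.var 0 rfl
    have f21 := hF'.var 21 rfl
    have b4 := hF'.arr 4 rfl
    refine Ends.assign_cons trivial (by simp [val, h35]; have := hB.cols; omega)
      (Ends.cons (c₂ := 0) (ends_rowProduct (n := n) (u := i) (w := v) (M := L) (M' := L)
        (by simp [f0, h0]) (by simp [val, h35]) (by simp [f21, h21]) (by simpa [b4] using hT)
        (by simpa [b4] using hT) hB.cols hB.product) ?_ le_rfl)
    intro ω hFω h22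
    have g35 := hFω.var 35 rfl
    have b8 := hFω.arr 8 rfl
    simp [h35] at g35 b8
    have h22' : ω.vars 22 = dot T n i v := by
      rw [h22, ← h4]
      simp [b4, dot, State.mat]
    refine Ends.put_cons trivial trivial (by simp [val, g35]) ?_ (Ends.nil fun x hx => ?_)
    · simp only [val, h22']
      exact (abs_dot_le hT').trans (by exact_mod_cast hB.product)
    · rcases Nat.lt_succ_iff_lt_or_eq.1 hx with hlt | rfl
      · simp [val, g35, b8, hlt.ne, hI x hlt]
      · simp [val, g35, h22']
  · rintro υ hF' ⟨hI, -⟩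
    have f0 := hF'.var 0 rfl
    have f9 := hF'.var 9 rfl
    have f11 := hF'.var 11 rfl
    have f42 := hF'.var 42 rfl
    have f44 := hF'.var 44 rfl
    have b1 := hF'.arr 1 rfl
    have b2 := hF'.arr 2 rfl
    have b3 := hF'.arr 3 rfl
    have b4 := hF'.arr 4 rfl
    have b9 := hF'.arr 9 rfl
    have hm : υ.mat 4 n = T := by rw [← h4]; ext x y; simp [State.mat, b4]
    have hS0 : Searched n r T θ σ (υ.setVar 37 ((lit 1).val ε υ)) True :=
      Searched.of_eq hfd (by simp [f42]) (by simp [f44]) b1 b2 b3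
    refine Ends.assign_cons trivial (by simpa [val] using hB1)
      (Ends.cons (c₁ := n + n * (n + 1) + 4 * n) (c₂ := n + n * (n + 1) + 4 * n)
      (ends_tryFirstSign (v := v) (s := 1) (T := T) (θ := θ) (n := n) (r := r) (by simp [f0, h0])
        (by simp [f9, h9]) (by simp [f11, h11]) (by simp [val]) (by simpa using hI) hm
        (by simpa [b4] using hT) (by simpa [b9] using h9') hB hS0.found) ?_ (by omega))
    rintro ω hFω ⟨hS1, hω9⟩
    have g0 := hFω.var 0 rfl
    have g9 := hFω.var 9 rfl
    have g11 := hFω.var 11 rfl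
    have c4 := hFω.arr 4 rfl
    have c8 := hFω.arr 8 rfl
    simp [f0, f9, f11, b4, h0, h9, h11] at g0 g9 g11 c4 c8
    have hm' : ω.mat 4 n = T := by rw [← h4]; ext x y; simp [State.mat, c4]
    have hS2 : Searched n r T θ ω (ω.setVar 37 ((lit (-1)).val ε ω)) True :=
      Searched.of_eq hS1.found (by simp) (by simp) rfl rfl rfl
    refine Ends.assign_cons trivial (by simpa [val] using hB1)
      (Ends.cons (c₁ := n + n * (n + 1) + 4 * n) (c₂ := 0)
      (ends_tryFirstSign (v := v) (s := -1) (T := T) (θ := θ) (n := n) (r := r) (by simp [g0])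
        (by simp [g9]) (by simp [g11]) (by simp [val]) (by simpa [c8] using hI) hm'
        (by simpa [c4] using hT) (by simpa using hω9) hB hS2.found) ?_ le_rfl)
    rintro ω' - ⟨hS3, hω'9⟩
    refine Ends.nil ⟨(((hS0.trans hS1).trans hS2).trans hS3).imp ?_, hω'9⟩
    rintro ⟨⟨⟨-, k1⟩, -⟩, k2⟩ s (rfl | rfl)
    exacts [k1, k2]

end Search

/-- The number in cell `vars 46` of array `0`, truncated to `[-vars 6, vars 6]`. -/
def clipExpr : Expr :=
  add (add (get 0 (var 46)) (mul (lt (var 6) (get 0 (var 46))) (sub (var 6) (get 0 (var 46)))))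
    (mul (lt (get 0 (var 46)) (sub (lit 0) (var 6)))
      (sub (sub (lit 0) (var 6)) (get 0 (var 46))))

/-- Search for a large cut in the truncation of the matrix in array `0`. -/
def findCut : Prog := block [
  forLoop 46 (lit 0) (mul (var 0) (var 0)) (put 4 (var 46) clipExpr),
  sample,
  assign 42 (lit 0),
  forLoop 45 (lit 0) (var 32) (block [assign 21 (get 5 (var 45)), tryRow])]

/-- Subtract the recorded cut from the matrix in array `0`. -/
def update : Prog := block [
  forLoop 46 (lit 0) (var 0) (forLoop 47 (lit 0) (var 0)
    (put 0 (add (mul (var 46) (var 0)) (var 47))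
      (sub (cell 0 (var 46) (var 47)) (mul (mul (var 5) (var 44))
        (add (mul (cell 2 (var 9) (var 46)) (cell 3 (var 9) (var 47)))
          (mul (cell 2 (var 9) (var 47)) (cell 3 (var 9) (var 46)))))))),
  assign 9 (add (var 9) (lit 1))]

/-- One round: search for a large cut, and subtract it or clear the flag in register `10`. -/
def round : Prog := block [findCut, ite (var 42) update (assign 10 (lit 0))]

/-! ### The main loop: finding and subtracting cuts. -/

section Rounds

variable {B n r L N₀ b₀ : ℕ} {ε β : ℝ} {σ : State} {θ : ℤ}

theorem index_lt {x y : ℕ} (hx : x < n) (hy : y < n) : x * n + y < n * n := by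
  calc x * n + y < x * n + n := by omega
    _ = (x + 1) * n := by ring
    _ ≤ n * n := Nat.mul_le_mul_right _ hx

theorem index_inj {x y x' y' : ℕ} (hy : y < n) (hy' : y' < n) (h : x * n + y = x' * n + y') :
    x = x' ∧ y = y' := by
  have hn : 0 < n := by omega
  have h1 : (x * n + y) / n = (x' * n + y') / n := by rw [h]
  rw [mul_comm x, mul_comm x', Nat.mul_add_div hn, Nat.mul_add_div hn, Nat.div_eq_of_lt hy,
    Nat.div_eq_of_lt hy'] at h1
  have h2 : x = x' := by omega
  subst h2
  exact ⟨rfl, by omega⟩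

/-- The scratch arrays that are used without being initialized. -/
structure State.Scratch (σ : State) (n L : ℕ) : Prop where
  zero : ∀ k, n * n ≤ k → σ.arrs 4 k = 0
  entry : ∀ k, |σ.arrs 4 k| ≤ L
  coeff : ∀ k, |σ.arrs 6 k| ≤ 3
  ind : ∀ k, |σ.arrs 9 k| ≤ 1

/-- If no sampled row gives a cut above θ, all correlations of sampled rows are at most 2Lθ. By
`hnum` this is less than the correlation that a cut of size βn² would force on one of them. At most
4b₀ rows are tested, at a cost quadratic in n each. -/
theorem ends_findCut {j k : ℕ} (hn : 0 < n) (h0 : σ.vars 0 = n) (h6 : σ.vars 6 = L)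
    (h7 : σ.vars 7 = N₀) (h8 : σ.vars 8 = b₀) (h9 : σ.vars 9 = r) (h11 : σ.vars 11 = θ)
    (hN : N₀ = 4 ^ j) (hb : b₀ = 2 ^ k) (hnN : n ≤ N₀) (hN4 : N₀ ≤ 4 * n)
    (hsymm : ∀ x < n, ∀ y < n, σ.mat 0 n x y = σ.mat 0 n y x) (hS : σ.Scratch n L)
    (hB : SearchBound B n L) (hB' : SampleBound B n L N₀ b₀) (hnB : n * n ≤ B) (hLB : L ≤ B)
    (hbB : 4 * b₀ ≤ B) (hβ : 0 ≤ β)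
    (hnum : (2 * L * θ : ℝ) ^ 2 < (β ^ 4 - 4 * (9 / √b₀) * L ^ 4) / 4 * n ^ 4) :
    Ends B ε findCut σ (160 * n ^ 2 * b₀) fun τ => ∃ T : ℕ → ℕ → ℤ,
      (∀ x < n, ∀ y < n, T x y = clip L (σ.mat 0 n x y)) ∧ τ.Scratch n L ∧ τ.Found n r T θ ∧
      (∀ i < r, τ.arrs 1 i = σ.arrs 1 i) ∧ (∀ i < r * n, τ.arrs 2 i = σ.arrs 2 i) ∧
      (∀ i < r * n, τ.arrs 3 i = σ.arrs 3 i) ∧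
      (τ.vars 42 = 0 → ∀ X ⊆ range n, ∀ Y ⊆ range n,
        |∑ x ∈ X, ∑ y ∈ Y, (T x y : ℝ)| < β * n ^ 2) := by
  have hL0 : (0 : ℤ) ≤ L := by positivity
  have hb1 : 0 < b₀ := by rw [hb]; positivity
  -- Defined so as to agree with array 4 at every address. In particular the padding rows, numbered
  -- from n on, vanish.
  set T : ℕ → ℕ → ℤ := fun x y =>
    if x * n + y < n * n then clip L (σ.mat 0 n x y) else 0 with hT
  have hTclip : ∀ x < n, ∀ y < n, T x y = clip L (σ.mat 0 n x y) := fun x hx y hy => by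
    simp only [hT]; rw [if_pos (index_lt hx hy)]
  have hTL : ∀ x y, |T x y| ≤ L := fun x y => by
    simp only [hT]; split_ifs
    · exact abs_clip_le hL0 _
    · simp
  refine Ends.cons (c₂ := (N₀ + 20 * n * N₀ * b₀) +
      4 * b₀ * (n * (n + 1) + 2 * (n + n * (n + 1) + 4 * n) + 1)) (Ends.forLoop (c := 0) (s := 0)
    (b := n * n) (I := fun i υ => (∀ x < i, υ.arrs 4 x = clip L (σ.arrs 0 x)) ∧
      (∀ k, n * n ≤ k → υ.arrs 4 k = 0) ∧ ∀ k, |υ.arrs 4 k| ≤ L)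
    rfl trivial (by simp [val]) (Nat.zero_le _) hnB ?_ ?_ ?_) ?_ ?_
  · exact ⟨by simp, by simpa using hS.zero, by simpa using hS.entry⟩
  · intro υ hF
    simp [Ok, val, hF.var 0 rfl, h0]
  · intro i υ _ hi hF h46 ⟨hI, hz, hL⟩
    have e6 := hF.var 6 rfl
    have a0 := hF.arr 0 rfl
    have hv : clipExpr.val ε υ = clip L (σ.arrs 0 i) := by
      simp only [clipExpr, val, e6, h6, h46, a0, Int.toNat_natCast]
      unfold clip
      split_ifs <;> omega
    refine Ends.put trivial (by simp [clipExpr, Ok, val, h46]) (by simp [val, h46]) ?_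
      ⟨fun x hx => ?_, fun k hk => ?_, fun k => ?_⟩
    · rw [hv]
      exact (abs_clip_le hL0 _).trans (by exact_mod_cast hLB)
    · rw [hv]
      rcases Nat.lt_succ_iff_lt_or_eq.1 hx with hlt | rfl
      · simp [val, h46, hlt.ne, hI x hlt]
      · simp [val, h46]
    · have : k ≠ i := by omega
      simp [val, h46, this, hz k hk]
    · rw [hv]
      simp only [State.setVar_arrs, State.setCell_arrs_same, Function.update_apply]
      split_ifs
      · exact abs_clip_le hL0 _
      · exact hL k
  · rintro υ hF ⟨⟨hI, hz, hL⟩, -⟩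
    have e0 := hF.var 0 rfl
    have e7 := hF.var 7 rfl
    have e8 := hF.var 8 rfl
    have e9 := hF.var 9 rfl
    have e11 := hF.var 11 rfl
    have a1 := hF.arr 1 rfl
    have a2 := hF.arr 2 rfl
    have a3 := hF.arr 3 rfl
    have a6 := hF.arr 6 rfl
    have a9 := hF.arr 9 rfl
    have hm : υ.mat 4 n = T := by
      ext x y
      simp only [State.mat, hT]
      split_ifs with h
      · exact hI _ h
      · exact hz _ (by omega)
    refine Ends.cons (ends_sample (T := T) (L := L) hn (e0.trans h0) (e7.trans h7) (e8.trans h8)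
      hN hb hm hL (by simpa [a6] using hS.coeff) hB') ?_ le_rfl
    rintro ω hFω ⟨N, R, hSa, h32, hN0, hNb, hR⟩
    have f0 := hFω.var 0 rfl
    have f9 := hFω.var 9 rfl
    have f11 := hFω.var 11 rfl
    have b1 := hFω.arr 1 rfl
    have b2 := hFω.arr 2 rfl
    have b3 := hFω.arr 3 rfl
    have b4 := hFω.arr 4 rfl
    have b9 := hFω.arr 9 rfl
    rw [e0, h0] at f0
    rw [e9, h9] at f9
    rw [e11, h11] at f11
    rw [a1] at b1
    rw [a2] at b2
    rw [a3] at b3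
    rw [a9] at b9
    refine Ends.assign_cons trivial (by simp [val]) ?_
    set ω₀ := ω.setVar 42 ((lit 0).val ε ω) with hω₀
    refine Ends.cons (c₂ := 0) (Ends.forLoop
      (c := n * (n + 1) + 2 * (n + n * (n + 1) + 4 * n)) (s := 0) (b := N) (I := fun i υ =>
        Searched n r T θ ω₀ υ (∀ i' < i, NoCut T n (R i') θ) ∧ ∀ k, |υ.arrs 9 k| ≤ 1)
      rfl trivial (by simp [val]) (Nat.zero_le _) (hNb.trans hbB) ?_ ?_ ?_) ?_ ?_
    · refine ⟨(Searched.of_eq (σ := ω₀) ?_ ?_ ?_ ?_ ?_ ?_).imp (by simp), ?_⟩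
      · exact .inl (by simp [hω₀, val])
      · simp
      · simp
      · simp
      · simp
      · simp
      · simpa [hω₀, b9] using hS.ind
    · intro π hFπ
      have := hFπ.var 32 rfl
      simp [hω₀] at this
      simp [Ok, val, this, h32]
    · intro i π _ hi hFπ h45 ⟨hI', h9'⟩
      have g0 := hFπ.var 0 rfl
      have g9 := hFπ.var 9 rfl
      have g11 := hFπ.var 11 rfl
      have c4 := hFπ.arr 4 rfl
      have c5 := hFπ.arr 5 rfl
      simp only [hω₀, State.setVar_vars, State.setVar_arrs, f0, f9, f11, b4,
        OfNat.zero_ne_ofNat, Nat.reduceEqDiff, if_false] at g0 g9 g11 c4 c5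
      have hRi : π.arrs 5 i = R i := by rw [c5, hSa.list i hi]
      have hRB : R i ≤ B := (hSa.list_lt i hi).le.trans hB'.rows
      have hS1 : Searched n r T θ π (π.setVar 21 ((get 5 (var 45)).val ε π)) True :=
        Searched.of_eq hI'.found (by simp) (by simp) rfl rfl rfl
      refine Ends.assign_cons (by simp [Ok, val, h45]) (by simpa [val, h45, hRi] using hRB)
        (Ends.cons (c₂ := 0) (ends_tryRow (n := n) (r := r) (L := L) (T := T) (θ := θ) (v := R i)
          (by simp [g0]) (by simp [g9]) (by simp [g11]) (by simp [val, h45, hRi])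
          ?_ (by simpa [c4] using hL) (by simpa using h9') hB hS1.found) ?_ le_rfl)
      · rw [← hm]; ext x y; simp [State.mat, c4]
      · rintro ρ - ⟨hS2, h9''⟩
        have hfin := ((hI'.trans hS1).trans hS2).imp (Q := ∀ i' < i + 1, NoCut T n (R i') θ) ?_
        · have hS3 : Searched n r T θ ρ (ρ.setVar 45 (i + 1)) True :=
            Searched.of_eq hfin.found (by simp) (by simp) rfl rfl rfl
          exact Ends.nil ⟨(hfin.trans hS3).imp And.left, by simpa using h9''⟩
        · rintro ⟨⟨k1, -⟩, k2⟩ i' hi'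
          rcases Nat.lt_succ_iff_lt_or_eq.1 hi' with hlt | rfl
          exacts [k1 i' hlt, k2]
    · rintro π hFπ ⟨⟨hI', h9'⟩, -⟩
      have c4 := hFπ.arr 4 rfl
      have c6 := hFπ.arr 6 rfl
      simp only [hω₀, State.setVar_arrs] at c4 c6
      refine Ends.nil ⟨T, hTclip, ⟨?_, ?_, ?_, h9'⟩, hI'.found, ?_, ?_, ?_, ?_⟩
      · simpa [c4, b4] using hz
      · simpa [c4, b4] using hL
      · simpa [c6] using hSa.coeff
      · intro i hi; rw [hI'.sign i hi]; simp [hω₀, b1]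
      · intro i hi; rw [hI'.left i hi]; simp [hω₀, b2]
      · intro i hi; rw [hI'.right i hi]; simp [hω₀, b3]
      · intro h42 X hX Y hY
        have hno := (hI'.none h42).2
        by_contra hc
        obtain ⟨i, hi, hle⟩ := exists_large_correlation (L := L) hn hN0
          (by positivity : (0 : ℝ) ≤ 9 / √b₀) hβ (fun x _ y _ => by exact_mod_cast hTL x y)
          hnN hN4 hR hX hY (not_lt.1 hc)
        have h1 := (hno i hi).abs_sum_dot_le (L := L) (fun x hx y hy => by
          rw [hTclip x hx y hy, hTclip y hy x hx, hsymm x hx y hy]) (fun y _ => hTL _ y) hL0 hX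
        have h2 : (∑ u ∈ X, (dot T n u (R i) : ℝ)) ^ 2 ≤ (2 * L * θ : ℝ) ^ 2 := by
          have h3 : |∑ u ∈ X, (dot T n u (R i) : ℝ)| ≤ 2 * L * θ := by exact_mod_cast h1
          rw [← sq_abs (∑ u ∈ X, _)]
          gcongr
        linarith
    · simp only [Nat.sub_zero, add_zero]
      exact Nat.mul_le_mul_right _ hNb
  · simp only [Nat.sub_zero, zero_add, mul_one]
    have h1 : n ≤ n ^ 2 := Nat.le_self_pow (by norm_num) n
    have h2 : 20 * n * N₀ * b₀ ≤ 20 * n * (4 * n) * b₀ := by gcongr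
    have h3 : n ^ 2 ≤ n ^ 2 * b₀ := Nat.le_mul_of_pos_right _ hb1
    have h4 : b₀ * n ≤ b₀ * n ^ 2 := Nat.mul_le_mul_left _ h1
    have h5 : b₀ ≤ b₀ * n ^ 2 := Nat.le_mul_of_pos_right _ (by positivity)
    nlinarith

/-- Updating in place is sound because the new value of an entry depends on no other entry of array
0. -/
theorem ends_update {h s : ℤ} (h0 : σ.vars 0 = n) (h5 : σ.vars 5 = h) (h44 : σ.vars 44 = s)
    (h9 : σ.vars 9 = r) (hn : n ≤ B) (hr : r + 1 ≤ B)
    (hB : ∀ x < n, ∀ y < n, |σ.mat 0 n x y - h * s *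
      (σ.mat 2 n r x * σ.mat 3 n r y + σ.mat 2 n r y * σ.mat 3 n r x)| ≤ B) :
    Ends B ε update σ (n * (n + 1)) fun τ => τ.vars 9 = r + 1 ∧
      ∀ x < n, ∀ y < n, τ.mat 0 n x y = σ.mat 0 n x y - h * s *
        (σ.mat 2 n r x * σ.mat 3 n r y + σ.mat 2 n r y * σ.mat 3 n r x) := by
  set A : ℕ → ℕ → ℤ := fun x y => σ.mat 0 n x y - h * s *
    (σ.mat 2 n r x * σ.mat 3 n r y + σ.mat 2 n r y * σ.mat 3 n r x) with hA
  refine Ends.cons (c₂ := 0) (Ends.forLoop (c := n) (s := 0) (b := n)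
    (I := fun i τ => ∀ x < n, ∀ y < n, τ.mat 0 n x y = if x < i then A x y else σ.mat 0 n x y)
    rfl trivial (by simp [val]) (Nat.zero_le _) hn (by simp [State.mat]) ?_ ?_) ?_ (by simp)
  · intro τ hF
    simp [Ok, val, hF.var 0 rfl, h0]
  · intro i τ _ hi hF h46 hI
    refine (Ends.forLoop (x := 47) (e₀ := lit 0) (e := var 0) (c := 0) (s := 0) (b := n)
      (I := fun j υ => ∀ x < n, ∀ y < n, υ.mat 0 n x y =
        if x < i ∨ x = i ∧ y < j then A x y else σ.mat 0 n x y)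
      rfl trivial (by simp [val]) (Nat.zero_le _) hn (by simpa [State.mat] using hI) ?_ ?_).mono'
      (by simp) ?_
    · intro υ hF'
      simp [Ok, val, hF'.var 0 rfl, hF.var 0 rfl, h0]
    · intro j υ _ hj hF' h47 hI'
      have e0 := (hF'.var 0 rfl).trans (hF.var 0 rfl)
      have e5 := (hF'.var 5 rfl).trans (hF.var 5 rfl)
      have e9 := (hF'.var 9 rfl).trans (hF.var 9 rfl)
      have e44 := (hF'.var 44 rfl).trans (hF.var 44 rfl)
      have e46 := hF'.var 46 rfl
      have a2 := (hF'.arr 2 rfl).trans (hF.arr 2 rfl)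
      have a3 := (hF'.arr 3 rfl).trans (hF.arr 3 rfl)
      rw [h0] at e0
      rw [h5] at e5
      rw [h9] at e9
      rw [h44] at e44
      rw [h46] at e46
      have hval : (sub (cell 0 (var 46) (var 47)) (mul (mul (var 5) (var 44))
          (add (mul (cell 2 (var 9) (var 46)) (cell 3 (var 9) (var 47)))
          (mul (cell 2 (var 9) (var 47)) (cell 3 (var 9) (var 46)))))).val ε υ = A i j := by
        have hold := hI' i hi j hj
        -- The entry (i, j) still has its old value when it is read.
        rw [if_neg (by omega)] at hold
        simp only [State.mat] at hold
        simp [cell, val, e0, e5, e9, e44, e46, h47, a2, a3, hA, State.mat, hold]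
      have hp1 : (0 : ℤ) ≤ i * n + j := by positivity
      have hp2 : (0 : ℤ) ≤ r * n + i := by positivity
      have hp3 : (0 : ℤ) ≤ r * n + j := by positivity
      refine Ends.put (by simp [Ok]) (by simp [cell, Ok, val, e0, e9, e46, h47, hp1, hp2, hp3])
        (by simp [val, e0, e46, h47, hp1]) (by rw [hval]; exact hB i hi j hj) ?_
      intro x hx y hy
      rw [hval]
      simp only [State.mat, val, e0, e46, h47, toNat_index, State.setVar_arrs,
        State.setCell_arrs_same, Function.update_apply]
      by_cases hxy : x * n + y = i * n + j
      · obtain ⟨rfl, rfl⟩ := index_inj hy hj hxy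
        simp
      · rw [if_neg hxy]
        have := hI' x hx y hy
        simp only [State.mat] at this
        rw [this]
        have : (x < i ∨ x = i ∧ y < j) ↔ (x < i ∨ x = i ∧ y < j + 1) := by
          constructor
          · rintro (h | ⟨h, h'⟩)
            · exact .inl h
            · exact .inr ⟨h, by omega⟩
          · rintro (h | ⟨h, h'⟩)
            · exact .inl h
            · refine .inr ⟨h, ?_⟩
              rcases Nat.lt_succ_iff_lt_or_eq.1 h' with h' | h'
              · exact h'
              · subst h h'; exact absurd rfl hxy
        simp only [this]
    · rintro υ - ⟨hI', -⟩ x hx y hy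
      have := hI' x hx y hy
      simp only [State.mat, State.setVar_arrs] at this ⊢
      rw [this]
      have : (x < i ∨ x = i ∧ y < n) ↔ x < i + 1 := by omega
      simp only [this]
  · rintro τ hF ⟨hI, -⟩
    have e9 := hF.var 9 rfl
    refine Ends.assign_cons (by simp [Ok]) ?_ (Ends.nil ⟨by simp [val, e9, h9], ?_⟩)
    · simp [val, e9, h9]
      rw [abs_of_nonneg (by positivity)]
      exact_mod_cast hr
    · intro x hx y hy
      have := hI x hx y hy
      rw [if_pos hx] at this
      exact this

/-- After `r` cuts have been found: the matrix in array `0` is `A₀` minus the sum of the `r`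
recorded cuts, with coefficients `± h`, and its potential is small. -/
structure State.Model (σ : State) (n h L Q N₀ b₀ r : ℕ) (θ : ℤ) (A₀ : ℕ → ℕ → ℤ) : Prop where
  v0 : σ.vars 0 = n
  v5 : σ.vars 5 = h
  v6 : σ.vars 6 = L
  v7 : σ.vars 7 = N₀
  v8 : σ.vars 8 = b₀
  v9 : σ.vars 9 = r
  v11 : σ.vars 11 = θ
  sign : ∀ i < r, σ.arrs 1 i = 1 ∨ σ.arrs 1 i = -1
  left : ∀ i < r, ∀ x < n, σ.mat 2 n i x = 0 ∨ σ.mat 2 n i x = 1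
  right : ∀ i < r, ∀ x < n, σ.mat 3 n i x = 0 ∨ σ.mat 3 n i x = 1
  eq : ∀ x < n, ∀ y < n, σ.mat 0 n x y = A₀ x y - ∑ i ∈ range r, h * σ.arrs 1 i *
    (σ.mat 2 n i x * σ.mat 3 n i y + σ.mat 2 n i y * σ.mat 3 n i x)
  energy : energy n L (σ.mat 0 n) + 4 * h ^ 2 * n ^ 2 * r ≤ Q ^ 2 * n ^ 2
  scratch : σ.Scratch n L

variable {h Q : ℕ} {A₀ : ℕ → ℕ → ℤ}

theorem State.Model.symm (hσ : σ.Model n h L Q N₀ b₀ r θ A₀)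
    (hA : ∀ x < n, ∀ y < n, A₀ x y = A₀ y x) :
    ∀ x < n, ∀ y < n, σ.mat 0 n x y = σ.mat 0 n y x := by
  intro x hx y hy
  rw [hσ.eq x hx y hy, hσ.eq y hy x hx, hA x hx y hy]
  refine congrArg _ (sum_congr rfl fun i _ => ?_)
  ring

theorem abs_cut_le {s a b c d : ℤ} (hs : s = 1 ∨ s = -1) (ha : a = 0 ∨ a = 1) (hb : b = 0 ∨ b = 1)
    (hc : c = 0 ∨ c = 1) (hd : d = 0 ∨ d = 1) : |h * s * (a * b + c * d)| ≤ 2 * h := by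
  have h1 : |s| = 1 := by rcases hs with rfl | rfl <;> simp
  rw [abs_mul, abs_mul, h1, mul_one, Nat.abs_cast, mul_comm]
  refine mul_le_mul_of_nonneg_right ?_ (by positivity)
  rcases ha with rfl | rfl <;> rcases hb with rfl | rfl <;> rcases hc with rfl | rfl <;>
    rcases hd with rfl | rfl <;> simp

theorem State.Model.abs_le (hσ : σ.Model n h L Q N₀ b₀ r θ A₀)
    (hA : ∀ x < n, ∀ y < n, |A₀ x y| ≤ Q) :
    ∀ x < n, ∀ y < n, |σ.mat 0 n x y| ≤ Q + 2 * h * r := by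
  intro x hx y hy
  rw [hσ.eq x hx y hy]
  have : |∑ i ∈ range r, (h : ℤ) * σ.arrs 1 i *
      (σ.mat 2 n i x * σ.mat 3 n i y + σ.mat 2 n i y * σ.mat 3 n i x)| ≤ 2 * h * r := by
    refine (abs_sum_le_sum_abs _ _).trans ((sum_le_card_nsmul _ _ (2 * h : ℤ) fun i hi => ?_).trans ?_)
    · have hi' : i < r := by simpa using hi
      exact abs_cut_le (hσ.sign i hi') (hσ.left i hi' x hx) (hσ.right i hi' y hy)
        (hσ.left i hi' y hy) (hσ.right i hi' x hx)
    · simp; linarith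
  exact (abs_sub _ _).trans (add_le_add (hA x hx y hy) this)

/-- The words are long enough for the main loop. -/
structure RoundBound (B n h L Q N₀ b₀ M : ℕ) : Prop where
  search : SearchBound B n L
  sample : SampleBound B n L N₀ b₀
  sq : n * n ≤ B
  clip : L ≤ B
  block : 4 * b₀ ≤ B
  entry : Q + 2 * h * (M + 1) ≤ B
  count : M + 1 ≤ B

/-- The potential is nonnegative and has dropped by 4h²n² for each cut. -/
theorem State.Model.le (hσ : σ.Model n h L Q N₀ b₀ r θ A₀) {M : ℕ} (hn : 0 < n)
    (hM : Q ^ 2 < 4 * h ^ 2 * (M + 1)) : r ≤ M := by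
  by_contra hc
  have h1 := hσ.energy
  have h2 := energy_nonneg (L := (L : ℤ)) (by positivity) n (σ.mat 0 n)
  have h3 : 4 * h ^ 2 * n ^ 2 * r ≤ Q ^ 2 * n ^ 2 := by
    have : (4 * h ^ 2 * n ^ 2 * r : ℤ) ≤ Q ^ 2 * n ^ 2 := by linarith
    exact_mod_cast this
  have h4 : 4 * h ^ 2 * n ^ 2 * (M + 1) ≤ 4 * h ^ 2 * n ^ 2 * r :=
    Nat.mul_le_mul_left _ (by omega)
  have h5 : Q ^ 2 * n ^ 2 < 4 * h ^ 2 * (M + 1) * n ^ 2 :=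
    Nat.mul_lt_mul_of_pos_right hM (by positivity)
  nlinarith

/-- The threshold 2hn² is the one at which `energy_sub_le` guarantees a decrease of 4h²n², which
maintains the field `energy`. -/
theorem ends_round {j k M : ℕ} (hσ : σ.Model n h L Q N₀ b₀ r (2 * h * n ^ 2) A₀) (hn : 0 < n)
    (hN : N₀ = 4 ^ j) (hb : b₀ = 2 ^ k) (hnN : n ≤ N₀) (hN4 : N₀ ≤ 4 * n)
    (hsymm : ∀ x < n, ∀ y < n, A₀ x y = A₀ y x) (hA : ∀ x < n, ∀ y < n, |A₀ x y| ≤ Q)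
    (hB : RoundBound B n h L Q N₀ b₀ M) (hr : r ≤ M) (hβ : 0 ≤ β)
    (hnum : (2 * L * (2 * h * n ^ 2) : ℝ) ^ 2 < (β ^ 4 - 4 * (9 / √b₀) * L ^ 4) / 4 * n ^ 4) :
    Ends B ε round σ (162 * n ^ 2 * b₀) fun τ =>
      (τ.vars 10 = σ.vars 10 ∧ τ.Model n h L Q N₀ b₀ (r + 1) (2 * h * n ^ 2) A₀) ∨
      (τ.vars 10 = 0 ∧ τ.Model n h L Q N₀ b₀ r (2 * h * n ^ 2) A₀ ∧
        ∀ X ⊆ range n, ∀ Y ⊆ range n,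
          |∑ x ∈ X, ∑ y ∈ Y, (clip L (τ.mat 0 n x y) : ℝ)| < β * n ^ 2) := by
  have hb1 : 0 < b₀ := by rw [hb]; positivity
  refine Ends.cons (c₂ := n * (n + 1)) (ends_findCut (β := β) hn hσ.v0 hσ.v6 hσ.v7 hσ.v8 hσ.v9 hσ.v11 hN hb
    hnN hN4 (hσ.symm hsymm) hσ.scratch hB.search hB.sample hB.sq hB.clip hB.block hβ
    (by exact_mod_cast hnum)) ?_ ?_
  · rintro τ hF ⟨T, hT, hscr, hfd, k1, k2, k3, hnone⟩
    have e0 := (hF.var 0 rfl).trans hσ.v0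
    have e5 := (hF.var 5 rfl).trans hσ.v5
    have e6 := (hF.var 6 rfl).trans hσ.v6
    have e7 := (hF.var 7 rfl).trans hσ.v7
    have e8 := (hF.var 8 rfl).trans hσ.v8
    have e9 := (hF.var 9 rfl).trans hσ.v9
    have e10 := hF.var 10 rfl
    have e11 := (hF.var 11 rfl).trans hσ.v11
    have a0 := hF.arr 0 rfl
    have hm0 : τ.mat 0 n = σ.mat 0 n := by ext x y; simp [State.mat, a0]
    have hix : ∀ i < r, ∀ x < n, i * n + x < r * n := fun i hi x hx => by
      calc i * n + x < (i + 1) * n := by rw [add_mul]; omega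
        _ ≤ r * n := Nat.mul_le_mul_right _ hi
    have hm2 : ∀ i < r, ∀ x < n, τ.mat 2 n i x = σ.mat 2 n i x := fun i hi x hx =>
      k2 _ (hix i hi x hx)
    have hm3 : ∀ i < r, ∀ x < n, τ.mat 3 n i x = σ.mat 3 n i x := fun i hi x hx =>
      k3 _ (hix i hi x hx)
    have hτ : τ.Model n h L Q N₀ b₀ r (2 * h * n ^ 2) A₀ := by
      refine ⟨e0, e5, e6, e7, e8, e9, e11, fun i hi => ?_, fun i hi x hx => ?_,
        fun i hi x hx => ?_, fun x hx y hy => ?_, ?_, hscr⟩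
      · rw [k1 i hi]; exact hσ.sign i hi
      · rw [hm2 i hi x hx]; exact hσ.left i hi x hx
      · rw [hm3 i hi x hx]; exact hσ.right i hi x hx
      · rw [hm0, hσ.eq x hx y hy]
        refine congrArg _ (sum_congr rfl fun i hi => ?_)
        have hi' : i < r := by simpa using hi
        rw [k1 i hi', hm2 i hi' x hx, hm3 i hi' y hy, hm2 i hi' y hy, hm3 i hi' x hx]
      · rw [hm0]; exact hσ.energy
    have hT' : ∀ x < n, ∀ y < n, T x y = clip L (τ.mat 0 n x y) := by rw [hm0]; exact hT
    refine Ends.cons (c₁ := n * (n + 1)) (c₂ := 0) (R' := fun τ =>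
      (τ.vars 10 = σ.vars 10 ∧ τ.Model n h L Q N₀ b₀ (r + 1) (2 * h * n ^ 2) A₀) ∨
      (τ.vars 10 = 0 ∧ τ.Model n h L Q N₀ b₀ r (2 * h * n ^ 2) A₀ ∧
        ∀ X ⊆ range n, ∀ Y ⊆ range n,
          |∑ x ∈ X, ∑ y ∈ Y, (clip L (τ.mat 0 n x y) : ℝ)| < β * n ^ 2))
      (Ends.ite (by simp [Ok]) ?_ ?_) (fun _ _ h => Ends.nil h) (by omega)
    · intro hne
      have h42 : τ.vars 42 ≠ 0 := by simpa [val] using hne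
      obtain ⟨s, hs, h44, h1r, hl, hri, hcut⟩ := (hfd.resolve_left h42).2
      refine (ends_update (n := n) (r := r) (h := h) (s := s) e0 e5 h44 e9 hB.search.cols
        (by have := hB.count; omega) ?_).mono' le_rfl ?_
      · intro x hx y hy
        refine (abs_sub _ _).trans ((add_le_add (hτ.abs_le hA x hx y hy)
          (abs_cut_le hs (hl x hx) (hri y hy) (hl y hy) (hri x hx))).trans ?_)
        have h2 : Q + 2 * h * r + 2 * h ≤ B := by
          refine le_trans ?_ hB.entry
          have := Nat.mul_le_mul_left (2 * h) hr
          rw [mul_add]; omega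
        exact_mod_cast h2
      · rintro υ hFυ ⟨g9, hupd⟩
        have g10 := hFυ.var 10 rfl
        have b1 := hFυ.arr 1 rfl
        have b2 := hFυ.arr 2 rfl
        have b3 := hFυ.arr 3 rfl
        have b4 := hFυ.arr 4 rfl
        have b6 := hFυ.arr 6 rfl
        have b9 := hFυ.arr 9 rfl
        have hn2 : υ.mat 2 n = τ.mat 2 n := by ext x y; simp [State.mat, b2]
        have hn3 : υ.mat 3 n = τ.mat 3 n := by ext x y; simp [State.mat, b3]
        refine .inl ⟨g10.trans e10, (hFυ.var 0 rfl).trans e0, (hFυ.var 5 rfl).trans e5,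
          (hFυ.var 6 rfl).trans e6, (hFυ.var 7 rfl).trans e7, (hFυ.var 8 rfl).trans e8,
          by rw [g9]; push_cast; rfl, (hFυ.var 11 rfl).trans e11, fun i hi => ?_, fun i hi x hx => ?_,
          fun i hi x hx => ?_, fun x hx y hy => ?_, ?_, ⟨?_, ?_, ?_, ?_⟩⟩
        · rw [b1]
          rcases Nat.lt_succ_iff_lt_or_eq.1 hi with hlt | rfl
          · exact hτ.sign i hlt
          · rw [h1r]; exact hs
        · rw [hn2]
          rcases Nat.lt_succ_iff_lt_or_eq.1 hi with hlt | rfl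
          · exact hτ.left i hlt x hx
          · exact hl x hx
        · rw [hn3]
          rcases Nat.lt_succ_iff_lt_or_eq.1 hi with hlt | rfl
          · exact hτ.right i hlt x hx
          · exact hri x hx
        · rw [hupd x hx y hy, sum_range_succ, hτ.eq x hx y hy, b1, hn2, hn3, h1r]
          ring
        · have h1 : CutGraph.energy n L (υ.mat 0 n) = CutGraph.energy n L (fun x y => τ.mat 0 n x y -
              s * h * (τ.mat 3 n r x * τ.mat 2 n r y + τ.mat 3 n r y * τ.mat 2 n r x)) := by
            refine energy_congr fun x hx y hy => ?_
            rw [hupd x hx y hy]; ring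
          -- The roles of the two sets are exchanged, since the recorded cut value has array 3 on
          -- the outer index; K_{S,T} is symmetric in S and T.
          have h2 := energy_sub_le (L := (L : ℤ)) (by positivity) (hτ.symm hsymm) hs
            (h := (h : ℤ)) (by positivity) hri hl (by
              refine hcut.le.trans (le_of_eq (congrArg _ ?_))
              refine sum_congr rfl fun x hx => sum_congr rfl fun y hy => ?_
              rw [hT' x (by simpa using hx) y (by simpa using hy)])
          have h3 := hτ.energy
          rw [h1]
          push_cast
          linarith
        · simpa [b4] using hscr.zero
        · simpa [b4] using hscr.entry
        · simpa [b6] using hscr.coeff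
        · simpa [b9] using hscr.ind
    · intro heq
      have h42 : τ.vars 42 = 0 := by simpa [val] using heq
      refine Ends.assign trivial (by simp [val]) (.inr ⟨by simp [val], ?_, ?_⟩)
      · exact ⟨by simp [e0], by simp [e5], by simp [e6], by simp [e7], by simp [e8], by simp [e9],
          by simp [e11], hτ.sign, hτ.left, hτ.right, hτ.eq, hτ.energy,
          hscr.zero, hscr.entry, hscr.coeff, hscr.ind⟩
      · intro X hX Y hY
        have := hnone h42 X hX Y hY
        refine lt_of_eq_of_lt (congrArg _ ?_) this
        refine sum_congr rfl fun x hx => sum_congr rfl fun y hy => ?_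
        rw [hT' x (by simpa using hX hx) y (by simpa using hY hy)]
        rfl
  · have h1 : n ≤ n ^ 2 := Nat.le_self_pow (by norm_num) n
    have h3 : n ^ 2 ≤ n ^ 2 * b₀ := Nat.le_mul_of_pos_right _ hb1
    nlinarith

theorem ends_rounds {j k M : ℕ} (hσ : σ.Model n h L Q N₀ b₀ 0 (2 * h * n ^ 2) A₀) (hn : 0 < n)
    (h10 : σ.vars 10 = 1)
    (hN : N₀ = 4 ^ j) (hb : b₀ = 2 ^ k) (hnN : n ≤ N₀) (hN4 : N₀ ≤ 4 * n)
    (hsymm : ∀ x < n, ∀ y < n, A₀ x y = A₀ y x) (hA : ∀ x < n, ∀ y < n, |A₀ x y| ≤ Q)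
    (hB : RoundBound B n h L Q N₀ b₀ M) (hM : Q ^ 2 < 4 * h ^ 2 * (M + 1)) (hβ : 0 ≤ β)
    (hnum : (2 * L * (2 * h * n ^ 2) : ℝ) ^ 2 < (β ^ 4 - 4 * (9 / √b₀) * L ^ 4) / 4 * n ^ 4) :
    Ends B ε (loop (var 10) round) σ ((M + 1) * (162 * n ^ 2 * b₀ + 1)) fun τ =>
      ∃ r ≤ M, τ.Model n h L Q N₀ b₀ r (2 * h * n ^ 2) A₀ ∧
        ∀ X ⊆ range n, ∀ Y ⊆ range n,
          |∑ x ∈ X, ∑ y ∈ Y, (clip L (τ.mat 0 n x y) : ℝ)| < β * n ^ 2 := by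
  -- With r cuts found there is budget for M + 1 - r more rounds, at least one because r ≤ M. The
  -- extra round is the unsuccessful one, which clears the flag and ends the loop.
  refine (Ends.loop (I := fun v τ => ∃ r, τ.Model n h L Q N₀ b₀ r (2 * h * n ^ 2) A₀ ∧
    ((τ.vars 10 = 1 ∧ v = (M + 1 - r) * (162 * n ^ 2 * b₀ + 1)) ∨ (τ.vars 10 = 0 ∧
      ∀ X ⊆ range n, ∀ Y ⊆ range n,
          |∑ x ∈ X, ∑ y ∈ Y, (clip L (τ.mat 0 n x y) : ℝ)| < β * n ^ 2))) ?_ ?_ ?_).mono' le_rfl ?_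
  · exact ⟨0, hσ, .inl ⟨h10, rfl⟩⟩
  · intro v τ _; trivial
  · rintro v τ - ⟨r, hτ, ⟨h1, rfl⟩ | ⟨h1, -⟩⟩ hne
    · have hr := hτ.le hn hM
      refine ⟨162 * n ^ 2 * b₀, (ends_round hτ hn hN hb hnN hN4 hsymm hA hB hr hβ hnum).mono'
        le_rfl ?_⟩
      have e : M + 1 - r = (M - r) + 1 := by omega
      rw [e]
      rintro υ - (⟨g10, hυ⟩ | ⟨g10, hυ, hsmall⟩)
      · refine ⟨_, ?_, r + 1, hυ, .inl ⟨g10.trans h1, rfl⟩⟩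
        have : M + 1 - (r + 1) = M - r := by omega
        rw [this, add_mul (M - r), one_mul]; omega
      · exact ⟨0, by rw [add_mul, one_mul]; omega, r, hυ, .inr ⟨g10, hsmall⟩⟩
    · exact absurd (by simpa [val] using h1) hne
  · rintro τ - ⟨he, v, r, hτ, ⟨h1, -⟩ | ⟨-, hsmall⟩⟩
    · simp [val, h1] at he
    · exact ⟨r, hτ.le hn hM, hτ, hsmall⟩

end Rounds

/-- The power with the given exponent, as an expression. -/
def Expr.pow (e : Expr) : ℕ → Expr
  | 0 => lit 1
  | k + 1 => mul (e.pow k) e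

@[simp] theorem Expr.val_pow (ε : ℝ) (σ : State) (e : Expr) (k : ℕ) :
    (e.pow k).val ε σ = e.val ε σ ^ k := by
  induction k with
  | zero => simp [Expr.pow, val]
  | succ k ih => simp [Expr.pow, val, ih, pow_succ]

theorem Expr.ok_var_pow {ε : ℝ} {σ : State} (x k : ℕ) : ((var x).pow k).Ok ε σ := by
  induction k with
  | zero => trivial
  | succ k ih => exact ⟨ih, trivial⟩

@[simp] theorem State.setVar_setVar (σ : State) (x : ℕ) (v w : ℤ) :
    (σ.setVar x v).setVar x w = σ.setVar x w := by
  simp [State.setVar]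

/-- A loop that runs through a sequence of values of one register. -/
theorem Ends.iterate {B k x : ℕ} {ε : ℝ} {e f : Expr} {σ : State} {u : ℕ → ℤ}
    (h₀ : σ.vars x = u 0) (he : ∀ j ≤ k, e.Ok ε (σ.setVar x (u j)))
    (hne : ∀ j < k, e.val ε (σ.setVar x (u j)) ≠ 0) (hk : e.val ε (σ.setVar x (u k)) = 0)
    (hf : ∀ j < k, f.Ok ε (σ.setVar x (u j)))
    (hu : ∀ j < k, f.val ε (σ.setVar x (u j)) = u (j + 1)) (hB : ∀ j ≤ k, |u j| ≤ B) :
    Ends B ε (Prog.loop e (Prog.assign x f)) σ k fun τ => τ = σ.setVar x (u k) := by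
  have hσ : σ = σ.setVar x (u 0) := by simp [State.setVar, ← h₀]
  refine (Ends.loop (I := fun v τ => v ≤ k ∧ τ = σ.setVar x (u (k - v))) ?_ ?_ ?_).mono' le_rfl ?_
  · exact ⟨le_rfl, by simpa using hσ⟩
  · rintro v τ ⟨hv, rfl⟩
    exact he _ (Nat.sub_le _ _)
  · rintro v τ - ⟨hv, rfl⟩ hv0
    have hv1 : v ≠ 0 := by rintro rfl; exact hv0 (by simpa using hk)
    have hlt : k - v < k := by omega
    refine ⟨0, Ends.assign (hf _ hlt) (by rw [hu _ hlt]; exact hB _ (by omega))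
      ⟨v - 1, by omega, by omega, ?_⟩⟩
    rw [hu _ hlt, State.setVar_setVar, show k - v + 1 = k - (v - 1) by omega]
  · rintro τ - ⟨he0, v, hv, rfl⟩
    by_cases h : v = 0
    · subst h; simp
    · exact absurd he0 (hne _ (by omega))

/-- Compute the parameters of the main loop. -/
def setup : Prog := block [
  assign 1 (lit 1),
  loop (sub (lit 1) (epsLe (sub (lit 0) (var 1)) (lit (-1)))) (assign 1 (mul (lit 2) (var 1))),
  assign 2 (mul (lit (2 ^ 16)) ((var 1).pow 17)),
  assign 3 (lit 0),
  loop (sub (lit 1) (epsLe (var 2) (var 3))) (assign 3 (add (var 3) (lit 1))),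
  assign 4 (mul (lit 300) ((var 2).pow 8)),
  assign 5 ((var 3).pow 8),
  assign 6 (mul (mul (lit 4) (var 1)) (var 4)),
  assign 7 (lit 1),
  loop (lt (var 7) (var 0)) (assign 7 (mul (lit 4) (var 7))),
  assign 8 (mul (lit (2 ^ 40)) ((var 1).pow 16)),
  assign 9 (lit 0),
  assign 11 (mul (mul (lit 2) (var 5)) ((var 0).pow 2)),
  assign 10 (lit 1)]

/-- Rescale the adjacency matrix and subtract the density. -/
def center : Prog := block [
  assign 12 (lit 0),
  forLoop 13 (lit 0) ((var 0).pow 2) (assign 12 (add (var 12) (get 0 (var 13)))),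
  assign 14 (div (mul (var 4) (var 12)) ((var 0).pow 2)),
  forLoop 13 (lit 0) ((var 0).pow 2)
    (put 0 (var 13) (sub (mul (var 4) (get 0 (var 13))) (var 14)))]

/-- The whole algorithm. -/
def approximate : Prog :=
  ite (epsLe (lit (-1)) (lit (-1))) (assign 0 (lit 0))
    (block [setup, center, loop (var 10) round, assign 0 (var 9)])

/-! ### Computing the parameters and centering the matrix. -/

section Setup

variable {B n i j m a p Q h L N₀ b₀ : ℕ} {ε : ℝ} {σ : State}

/-- The test whether -mε ≤ -1 recognizes the first power of two with mε ≥ 1, and counting up to the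
first p with aε ≤ p computes the ceiling. Counting in steps of one costs p iterations, independently
of n. -/
theorem ends_setup (h0 : σ.vars 0 = n) (hm : m = 2 ^ i) (hi : 1 ≤ m * ε)
    (hi' : ∀ i' < i, (2 : ℝ) ^ i' * ε < 1) (ha : a = 2 ^ 16 * m ^ 17) (hp : p = ⌈a * ε⌉₊)
    (hQ : Q = 300 * a ^ 8) (hh : h = p ^ 8) (hL : L = 4 * m * Q) (hN : N₀ = 4 ^ j) (hj : n ≤ 4 ^ j)
    (hj' : ∀ j' < j, 4 ^ j' < n) (hb : b₀ = 2 ^ 40 * m ^ 16) (hmB : m ≤ B) (haB : a ≤ B)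
    (hpB : p ≤ B) (hQB : Q ≤ B) (hhB : h ≤ B) (hLB : L ≤ B) (hNB : N₀ ≤ B) (hbB : b₀ ≤ B)
    (hθB : 2 * h * n ^ 2 ≤ B) :
    Ends B ε setup σ (i + p + j) fun τ => τ.vars 0 = n ∧ τ.vars 4 = Q ∧ τ.vars 5 = h ∧
      τ.vars 6 = L ∧ τ.vars 7 = N₀ ∧ τ.vars 8 = b₀ ∧ τ.vars 9 = 0 ∧ τ.vars 10 = 1 ∧
      τ.vars 11 = 2 * h * n ^ 2 ∧ τ.arrs = σ.arrs := by
  have hm1 : 1 ≤ m := by rw [hm]; exact Nat.one_le_two_pow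
  have hB1 : 1 ≤ B := hm1.trans hmB
  have ε0 : 0 ≤ ε := by
    by_contra hc
    have : (m : ℝ) * ε ≤ 0 := mul_nonpos_of_nonneg_of_nonpos (by positivity) (by linarith)
    linarith
  refine Ends.assign_cons trivial (by simpa [val] using hB1) (Ends.cons (c₁ := i) (c₂ := p + j)
    (Ends.iterate (u := fun t => 2 ^ t) (by simp [val]) ?_ ?_ ?_ ?_ ?_ ?_) ?_ (by omega))
  · intros; simp [Ok]
  · intro t ht
    have := hi' t ht
    simp [val]
    rw [if_neg (by linarith)]; simp
  · have : ((2 : ℝ) ^ i * ε) = m * ε := by rw [hm]; push_cast; rfl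
    simp [val]
    rw [if_pos (by linarith)]; simp
  · intros; simp [Ok]
  · intro t ht; simp [val, pow_succ, mul_comm]
  · intro t ht
    rw [abs_of_nonneg (by positivity)]
    have : 2 ^ t ≤ m := by rw [hm]; exact Nat.pow_le_pow_right (by norm_num) ht
    exact_mod_cast this.trans hmB
  rintro σ₁ - rfl
  have hva : (mul (lit (2 ^ 16)) ((var 1).pow 17)).val ε
      ((σ.setVar 1 ((lit 1).val ε σ)).setVar 1 (2 ^ i)) = a := by
    simp [val, ha, hm]
  refine Ends.assign_cons ⟨trivial, ok_var_pow _ _⟩ (by rw [hva]; simpa using haB) ?_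
  rw [hva]
  refine Ends.assign_cons trivial (by simp [val]) (Ends.cons (c₁ := p) (c₂ := j)
    (Ends.iterate (u := fun t => t) (by simp [val]) ?_ ?_ ?_ ?_ ?_ ?_) ?_ (by omega))
  · intros; simp [Ok]
  · intro t ht
    rw [hp, Nat.lt_ceil] at ht
    simp [val]
    rw [if_neg (by linarith)]; simp
  · have : (a : ℝ) * ε ≤ p := by rw [hp]; exact Nat.le_ceil _
    simp [val]
    rw [if_pos (by linarith)]; simp
  · intros; simp [Ok]
  · intro t ht; simp [val]
  · intro t ht
    simp only [Nat.abs_cast]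
    exact_mod_cast ht.trans hpB
  rintro σ₂ - rfl
  refine Ends.assign_cons ⟨trivial, ok_var_pow _ _⟩ ?_
    (Ends.assign_cons (ok_var_pow _ _) ?_ (Ends.assign_cons (by simp [Ok]) ?_
    (Ends.assign_cons trivial (by simpa [val] using hB1) (Ends.cons (c₁ := j) (c₂ := 0)
    (Ends.iterate (u := fun t => 4 ^ t) (by simp [val]) ?_ ?_ ?_ ?_ ?_ ?_) ?_ (by omega)))))
  · have : ((300 * a ^ 8 : ℕ) : ℤ) ≤ B := by rw [← hQ]; exact_mod_cast hQB
    simp only [val, val_pow, State.setVar_vars]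
    rw [abs_of_nonneg (by simp)]
    simpa using this
  · have : ((p ^ 8 : ℕ) : ℤ) ≤ B := by rw [← hh]; exact_mod_cast hhB
    simp only [val, val_pow, State.setVar_vars]
    rw [abs_of_nonneg (by simp)]
    simpa using this
  · have : ((4 * m * (300 * a ^ 8) : ℕ) : ℤ) ≤ B := by rw [← hQ, ← hL]; exact_mod_cast hLB
    simp only [val, val_pow, State.setVar_vars]
    rw [abs_of_nonneg (by simp)]
    simpa [hm] using this
  · intros; simp [Ok]
  · intro t ht
    have : (4 ^ t : ℤ) < n := by exact_mod_cast hj' t ht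
    simp [val, h0, this]
  · have : ¬ (4 ^ j : ℤ) < n := by simpa using (by exact_mod_cast hj : (n : ℤ) ≤ 4 ^ j)
    simp [val, h0, this]
  · intros; simp [Ok]
  · intro t ht; simp [val, pow_succ, mul_comm]
  · intro t ht
    rw [abs_of_nonneg (by positivity)]
    have : 4 ^ t ≤ N₀ := by rw [hN]; exact Nat.pow_le_pow_right (by norm_num) ht
    exact_mod_cast this.trans hNB
  rintro σ₃ - rfl
  refine Ends.assign_cons ⟨trivial, ok_var_pow _ _⟩ ?_ (Ends.assign_cons trivial (by simp [val])
    (Ends.assign_cons ⟨by simp [Ok], ok_var_pow _ _⟩ ?_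
    (Ends.assign_cons trivial (by simpa [val] using hB1) (Ends.nil ?_))))
  · have : ((2 ^ 40 * m ^ 16 : ℕ) : ℤ) ≤ B := by rw [← hb]; exact_mod_cast hbB
    simp only [val, val_pow, State.setVar_vars]
    rw [abs_of_nonneg (by simp)]
    simpa [hm] using this
  · have : ((2 * p ^ 8 * n ^ 2 : ℕ) : ℤ) ≤ B := by rw [← hh]; exact_mod_cast hθB
    simp only [val, val_pow, State.setVar_vars]
    rw [abs_of_nonneg (by simp [h0]; positivity)]
    simpa [h0] using this
  · simp [val, h0, hQ, hh, hL, hN, hb, hm]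

theorem ends_center (hn : 0 < n) (h0 : σ.vars 0 = n) (h4 : σ.vars 4 = Q)
    (h01 : ∀ k, σ.arrs 0 k = 0 ∨ σ.arrs 0 k = 1) (hB : Q * n ^ 2 ≤ B) (hnB : n ^ 2 ≤ B) :
    Ends B ε center σ (2 * n ^ 2) fun τ => ∀ k < n ^ 2, τ.arrs 0 k =
      Q * σ.arrs 0 k - Q * (∑ l ∈ range (n ^ 2), σ.arrs 0 l) / n ^ 2 := by
  have hsum0 : ∀ k, 0 ≤ ∑ l ∈ range k, σ.arrs 0 l := fun k =>
    sum_nonneg fun l _ => by rcases h01 l with h | h <;> simp [h]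
  have hsum1 : ∀ k, ∑ l ∈ range k, σ.arrs 0 l ≤ k := fun k =>
    (sum_le_card_nsmul _ _ 1 fun l _ => by rcases h01 l with h | h <;> simp [h]).trans (by simp)
  have hn2 : (0 : ℤ) < n ^ 2 := by positivity
  set s := ∑ l ∈ range (n ^ 2), σ.arrs 0 l with hs
  have hQs : Q * s / n ^ 2 ≤ Q := by
    refine Int.ediv_le_of_le_mul hn2 ?_
    exact mul_le_mul_of_nonneg_left (by exact_mod_cast hsum1 (n ^ 2)) (by positivity)
  have hQs0 : 0 ≤ Q * s / n ^ 2 := Int.ediv_nonneg (mul_nonneg (by positivity) (hsum0 _)) hn2.le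
  have hQB : (Q : ℤ) ≤ B := by
    exact_mod_cast (Nat.le_mul_of_pos_right Q (by positivity)).trans hB
  refine Ends.assign_cons trivial (by simp [val]) (Ends.cons (c₁ := n ^ 2) (c₂ := n ^ 2)
    (Ends.forLoop (x := 13) (e₀ := lit 0) (e := (var 0).pow 2) (c := 0) (s := 0) (b := n ^ 2)
    (I := fun k τ => τ.vars 12 = ∑ l ∈ range k, σ.arrs 0 l)
    rfl trivial (by simp [val]) (Nat.zero_le _) hnB (by simp [val]) ?_ ?_ |>.mono' (by simp)
      fun _ _ h => h.1) ?_ (by omega))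
  · intro τ hF
    have e0 := hF.var 0 rfl
    exact ⟨ok_var_pow _ _, by simp [val, e0, h0]⟩
  · intro k τ _ hk hF h13 hI
    have a0 := hF.arr 0 rfl
    have hv : (add (var 12) (get 0 (var 13))).val ε τ = ∑ l ∈ range (k + 1), σ.arrs 0 l := by
      simp [val, h13, hI, a0, sum_range_succ]
    refine Ends.assign (by simp [Ok, val, h13]) ?_ (by simp [hv])
    rw [hv, abs_of_nonneg (hsum0 _)]
    refine (hsum1 _).trans ?_
    have : k + 1 ≤ B := by omega
    exact_mod_cast this
  rintro σ₁ hF₁ h12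
  have e0 := (hF₁.var 0 rfl)
  have e4 := (hF₁.var 4 rfl)
  have a0 := (hF₁.arr 0 rfl)
  simp only [State.setVar_vars, State.setVar_arrs, h0, h4, OfNat.zero_ne_ofNat, Nat.reduceEqDiff,
    if_false] at e0 e4 a0
  have hv : (div (mul (var 4) (var 12)) ((var 0).pow 2)).val ε σ₁ = Q * s / n ^ 2 := by
    simp [val, e0, e4, h12, hs]
  refine Ends.assign_cons ⟨by simp [Ok], ok_var_pow _ _, by simp [val, e0]; omega⟩
    (by rw [hv, abs_of_nonneg hQs0]; exact hQs.trans hQB) ?_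
  rw [hv]
  refine Ends.cons (c₁ := n ^ 2) (c₂ := 0)
    (Ends.forLoop (x := 13) (e₀ := lit 0) (e := (var 0).pow 2) (c := 0) (s := 0) (b := n ^ 2)
    (I := fun k τ => ∀ l < n ^ 2, τ.arrs 0 l =
      if l < k then Q * σ.arrs 0 l - Q * s / n ^ 2 else σ.arrs 0 l)
    rfl trivial (by simp [val]) (Nat.zero_le _) hnB (by simp [a0]) ?_ ?_ |>.mono' (by simp)
      fun _ _ h => h.1) ?_ (by omega)
  · intro τ hF
    have g0 := hF.var 0 rfl
    exact ⟨ok_var_pow _ _, by simp [val, g0, e0]⟩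
  · intro k τ _ hk hF h13 hI
    have g4 := hF.var 4 rfl
    have g14 := hF.var 14 rfl
    have hk0 := hI k hk
    rw [if_neg (lt_irrefl _)] at hk0
    have hv : (sub (mul (var 4) (get 0 (var 13))) (var 14)).val ε τ =
        Q * σ.arrs 0 k - Q * s / n ^ 2 := by
      simp [val, g4, g14, e4, h13, hk0]
    refine Ends.put trivial (by simp [Ok, val, h13]) (by simp [val, h13]) ?_ ?_
    · rw [hv]
      rcases h01 k with h | h <;> rw [h, abs_le] <;> constructor <;> linarith
    · intro l hl
      rw [hv]
      simp only [val, h13, Int.toNat_natCast, State.setVar_arrs, State.setCell_arrs_same,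
        Function.update_apply]
      by_cases hlk : l = k
      · subst hlk; simp
      · rw [if_neg hlk, hI l hl]
        have : l < k ↔ l < k + 1 := by omega
        simp only [this]
  · intro τ _ hτ
    refine Ends.nil fun k hk => ?_
    rw [hτ k hk, if_pos hk]

end Setup

/-- The largest number is a score, of size N₀ · 3(nL²)², with exponent 2 + 2 + 2 · 297 = 598; the
exponent 700 leaves room. -/
theorem roundBound_pow {Y n h L Q N₀ b₀ M : ℕ} (hY : 2 ≤ Y) (hn : n ≤ Y) (hL : L ≤ Y ^ 148)
    (hh : h ≤ Y ^ 136) (hQ : Q ≤ Y ^ 145) (hN : N₀ ≤ Y ^ 2) (hb : b₀ ≤ Y ^ 40)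
    (hM : M + 1 ≤ Y ^ 31) : RoundBound (Y ^ 700) n h L Q N₀ b₀ M := by
  have key : ∀ {x : ℕ} (k : ℕ), x ≤ Y ^ k → k ≤ 700 → x ≤ Y ^ 700 := fun k hx hk =>
    hx.trans (Nat.pow_le_pow_right (by omega) hk)
  have h1 : 1 ≤ Y := by omega
  have hprod : n * L * L ≤ Y ^ 297 :=
    (Nat.mul_le_mul (Nat.mul_le_mul hn hL) hL).trans_eq (by ring)
  have hsum : n * L ≤ Y ^ 149 := (Nat.mul_le_mul hn hL).trans_eq (by ring)
  have h4 : 4 ≤ Y ^ 2 := by nlinarith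
  refine ⟨⟨key 1 (by simpa using hn) (by norm_num), key _ hprod (by norm_num),
    key _ hsum (by norm_num), key 150 ?_ (by norm_num), Nat.one_le_pow _ _ h1⟩,
    ⟨key 1 (by simpa using hn) (by norm_num), key _ hprod (by norm_num), key 598 ?_ (by norm_num),
    key _ hN (by norm_num), key 42 ?_ (by norm_num), key 2 (by omega) (by norm_num)⟩,
    key 2 ?_ (by norm_num), key _ hL (by norm_num), key 42 ?_ (by norm_num),
    key 169 ?_ (by norm_num), key _ hM (by norm_num)⟩
  · exact (Nat.mul_le_mul hn hsum).trans_eq (by ring)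
  · have h3 : 3 ≤ Y ^ 2 := by omega
    exact (Nat.mul_le_mul hN (Nat.mul_le_mul h3 (Nat.pow_le_pow_left hprod 2))).trans_eq (by ring)
  · exact (Nat.mul_le_mul hN hb).trans_eq (by ring)
  · exact (Nat.mul_le_mul hn hn).trans_eq (by ring)
  · exact (Nat.mul_le_mul h4 hb).trans_eq (by ring)
  · have e1 : 2 * h * (M + 1) ≤ Y ^ 168 :=
      (Nat.mul_le_mul (Nat.mul_le_mul hY hh) hM).trans_eq (by ring)
    have e2 : Q ≤ Y ^ 168 := hQ.trans (Nat.pow_le_pow_right h1 (by norm_num))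
    have e3 : 2 * Y ^ 168 ≤ Y * Y ^ 168 := Nat.mul_le_mul_right _ hY
    calc Q + 2 * h * (M + 1) ≤ 2 * Y ^ 168 := by omega
      _ ≤ Y * Y ^ 168 := e3
      _ = Y ^ 169 := by ring

/-- The parameters of the algorithm. -/
structure Params (ε : ℝ) (i m a p Q h L b₀ : ℕ) : Prop where
  lt_one : ε < 1
  m_eq : m = 2 ^ i
  one_le : 1 ≤ m * ε
  lt : ∀ i' < i, (2 : ℝ) ^ i' * ε < 1
  a_eq : a = 2 ^ 16 * m ^ 17
  p_eq : p = ⌈a * ε⌉₊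
  Q_eq : Q = 300 * a ^ 8
  h_eq : h = p ^ 8
  L_eq : L = 4 * m * Q
  b_eq : b₀ = 2 ^ 40 * m ^ 16

/-! ### Numerical inequalities between the parameters. -/

namespace Params

variable {ε : ℝ} {i m a p Q h L b₀ : ℕ} (P : Params ε i m a p Q h L b₀)
theorem pos (P : Params ε i m a p Q h L b₀) : 0 < ε := by
  by_contra hc
  have : (m : ℝ) * ε ≤ 0 := mul_nonpos_of_nonneg_of_nonpos (by positivity) (by linarith)
  linarith [P.one_le]

theorem one_le_m (P : Params ε i m a p Q h L b₀) : 1 ≤ m := by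
  rw [P.m_eq]; exact Nat.one_le_two_pow

theorem m_mul_lt (P : Params ε i m a p Q h L b₀) : m * ε < 2 := by
  rw [P.m_eq]
  rcases i with _ | i
  · have := P.lt_one
    simp; linarith
  · have := P.lt i (Nat.lt_succ_self i)
    push_cast
    rw [pow_succ]
    linarith

theorem a_mul_le (P : Params ε i m a p Q h L b₀) : a * ε ≤ p := by
  rw [P.p_eq]; exact Nat.le_ceil _

theorem p_lt (P : Params ε i m a p Q h L b₀) : p < a * ε + 1 := by
  rw [P.p_eq]; exact Nat.ceil_lt_add_one (mul_nonneg (by positivity) P.pos.le)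

theorem p_le_a (P : Params ε i m a p Q h L b₀) : p ≤ a := by
  rw [P.p_eq, Nat.ceil_le]
  exact mul_le_of_le_one_right (by positivity) P.lt_one.le

theorem a_le (P : Params ε i m a p Q h L b₀) : a ≤ m * p := by
  have h1 : (a : ℝ) * 1 ≤ a * (m * ε) := mul_le_mul_of_nonneg_left P.one_le (by positivity)
  have h2 : (m : ℝ) * (a * ε) ≤ m * p := mul_le_mul_of_nonneg_left P.a_mul_le (by positivity)
  have : (a : ℝ) ≤ m * p := by linarith
  exact_mod_cast this

/-- The large power of m in a serves this bound: rounding aε up to p must be harmless even when the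
error is multiplied by the number of cuts, of order m^16. -/
theorem le_p (P : Params ε i m a p Q h L b₀) : 2 ^ 16 * m ^ 16 ≤ p := by
  have h1 := P.a_le
  rw [P.a_eq, pow_succ m 16] at h1
  have h2 := P.one_le_m
  refine Nat.le_of_mul_le_mul_left (c := m) (h1.trans' (le_of_eq ?_)) (by omega)
  ring

theorem p_pos (P : Params ε i m a p Q h L b₀) : 0 < p := by
  have : 0 < m ^ 16 := pow_pos P.one_le_m _
  have := P.le_p
  omega

theorem a_pos (P : Params ε i m a p Q h L b₀) : 0 < a := P.p_pos.trans_le P.p_le_a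

theorem p_le (P : Params ε i m a p Q h L b₀) : p ≤ 1.01 * (a * ε) := by
  have h1 := P.p_lt
  have h2 : (2 ^ 16 : ℝ) ≤ a * ε := by
    have h3 : (1 : ℝ) ≤ m ^ 16 := one_le_pow₀ (by exact_mod_cast P.one_le_m)
    have h4 : (a : ℝ) = 2 ^ 16 * m ^ 17 := by rw [P.a_eq]; push_cast; ring
    calc (2 ^ 16 : ℝ) ≤ 2 ^ 16 * m ^ 16 * (m * ε) := by nlinarith [P.one_le]
      _ = a * ε := by rw [h4]; ring
  norm_num at h2 ⊢
  linarith

/-- Q²/(4h²) = 22500 (a/p)^16 and a/p ≤ m. -/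
theorem sq_lt (P : Params ε i m a p Q h L b₀) :
    Q ^ 2 < 4 * h ^ 2 * (22500 * m ^ 16 + 1) := by
  have h1 : a ^ 16 ≤ m ^ 16 * p ^ 16 := by rw [← mul_pow]; exact Nat.pow_le_pow_left P.a_le 16
  have h2 : 0 < p ^ 16 := pow_pos P.p_pos _
  calc Q ^ 2 = 90000 * a ^ 16 := by rw [P.Q_eq]; ring
    _ ≤ 90000 * (m ^ 16 * p ^ 16) := Nat.mul_le_mul_left _ h1
    _ < 90000 * (m ^ 16 * p ^ 16) + 4 * p ^ 16 := by omega
    _ = _ := by rw [P.h_eq]; ring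

/-- In units of ε⁴Q⁴n⁴, the left side is at most 0.02: it equals 256 m²Q²p^16 n⁴, where p^16 is
about Q²ε^16/90000 and mε < 2. The sampling error is at most 0.01, because √b₀ = 2^20 m^8 outweighs
L⁴ = 256 m⁴Q⁴. The right side is therefore at least (81/256 - 0.01)/4. -/
theorem cut_small (P : Params ε i m a p Q h L b₀) {n : ℕ} (hn : 0 < n) :
    (2 * L * (2 * h * n ^ 2) : ℝ) ^ 2 <
      ((3 / 4 * ε * Q) ^ 4 - 4 * (9 / √b₀) * L ^ 4) / 4 * n ^ 4 := by
  have hε := P.pos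
  have hm : (0 : ℝ) < m := by exact_mod_cast P.one_le_m
  have ha : (0 : ℝ) < a := by exact_mod_cast P.a_pos
  have hQ : (Q : ℝ) = 300 * a ^ 8 := by rw [P.Q_eq]; push_cast; ring
  have hL : (L : ℝ) = 4 * m * Q := by rw [P.L_eq]; push_cast; ring
  have hh : (h : ℝ) = p ^ 8 := by rw [P.h_eq]; push_cast; ring
  have hQ0 : (0 : ℝ) < Q := by rw [hQ]; positivity
  have hn0 : (0 : ℝ) < n := by exact_mod_cast hn
  have hb : √(b₀ : ℝ) = 2 ^ 20 * m ^ 8 := by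
    rw [Real.sqrt_eq_iff_eq_sq (by positivity) (by positivity), P.b_eq]
    push_cast; ring
  have h1 : (p : ℝ) ^ 16 ≤ 1.2 * (a * ε) ^ 16 := by
    calc (p : ℝ) ^ 16 ≤ (1.01 * (a * ε)) ^ 16 := pow_le_pow_left₀ (by positivity) P.p_le 16
      _ = 1.01 ^ 16 * (a * ε) ^ 16 := by ring
      _ ≤ 1.2 * (a * ε) ^ 16 := by
        refine mul_le_mul_of_nonneg_right ?_ (by positivity)
        norm_num
  have h2 : (m : ℝ) ^ 2 * ε ^ 16 ≤ 4 * ε ^ 4 := by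
    have e1 : (m * ε) ^ 2 ≤ 2 ^ 2 := pow_le_pow_left₀ (by positivity) P.m_mul_lt.le 2
    have e2 : ε ^ 14 ≤ ε ^ 4 := pow_le_pow_of_le_one hε.le P.lt_one.le (by norm_num)
    calc (m : ℝ) ^ 2 * ε ^ 16 = (m * ε) ^ 2 * ε ^ 14 := by ring
      _ ≤ 2 ^ 2 * ε ^ 4 := mul_le_mul e1 e2 (by positivity) (by positivity)
      _ = 4 * ε ^ 4 := by ring
  have h3 : 1 / (m : ℝ) ^ 4 ≤ ε ^ 4 := by
    rw [div_le_iff₀ (by positivity), ← mul_pow]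
    exact one_le_pow₀ (by linarith [P.one_le])
  have h4 : (2 * L * (2 * h * n ^ 2) : ℝ) ^ 2 ≤ 0.02 * ε ^ 4 * Q ^ 4 * n ^ 4 := by
    calc (2 * L * (2 * h * n ^ 2) : ℝ) ^ 2 = 256 * m ^ 2 * Q ^ 2 * n ^ 4 * p ^ 16 := by
          rw [hL, hh]; ring
      _ ≤ 256 * m ^ 2 * Q ^ 2 * n ^ 4 * (1.2 * (a * ε) ^ 16) :=
          mul_le_mul_of_nonneg_left h1 (by positivity)
      _ = 256 * 1.2 / 90000 * Q ^ 4 * n ^ 4 * (m ^ 2 * ε ^ 16) := by rw [hQ]; ring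
      _ ≤ 256 * 1.2 / 90000 * Q ^ 4 * n ^ 4 * (4 * ε ^ 4) :=
          mul_le_mul_of_nonneg_left h2 (by positivity)
      _ = 256 * 1.2 / 90000 * 4 * (ε ^ 4 * Q ^ 4 * n ^ 4) := by ring
      _ ≤ 0.02 * (ε ^ 4 * Q ^ 4 * n ^ 4) :=
          mul_le_mul_of_nonneg_right (by norm_num) (by positivity)
      _ = _ := by ring
  have h5 : 4 * (9 / √(b₀ : ℝ)) * L ^ 4 ≤ 0.01 * ε ^ 4 * Q ^ 4 := by
    calc 4 * (9 / √(b₀ : ℝ)) * L ^ 4 = 36 * 256 / 2 ^ 20 * Q ^ 4 * (1 / m ^ 4) := by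
          rw [hb, hL]; field_simp; ring
      _ ≤ 36 * 256 / 2 ^ 20 * Q ^ 4 * ε ^ 4 := mul_le_mul_of_nonneg_left h3 (by positivity)
      _ = 36 * 256 / 2 ^ 20 * (ε ^ 4 * Q ^ 4) := by ring
      _ ≤ 0.01 * (ε ^ 4 * Q ^ 4) := mul_le_mul_of_nonneg_right (by norm_num) (by positivity)
      _ = _ := by ring
  have h6 : (0 : ℝ) < ε ^ 4 * Q ^ 4 := by positivity
  refine h4.trans_lt (mul_lt_mul_of_pos_right ?_ (by positivity))
  have h7 : (3 / 4 * ε * Q) ^ 4 = 81 / 256 * (ε ^ 4 * Q ^ 4) := by ring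
  rw [h7]
  norm_num at h5 ⊢
  linarith

theorem r_mul_le (P : Params ε i m a p Q h L b₀) {r : ℕ} (hr : 4 * h ^ 2 * r ≤ Q ^ 2) :
    r * p ^ 16 ≤ 22500 * a ^ 16 := by
  have : 4 * (r * p ^ 16) ≤ 4 * (22500 * a ^ 16) := by
    refine (le_of_eq ?_).trans (hr.trans_eq ?_)
    · rw [P.h_eq]; ring
    · rw [P.Q_eq]; ring
  omega

theorem r_le (P : Params ε i m a p Q h L b₀) {r : ℕ} (hr : 4 * h ^ 2 * r ≤ Q ^ 2) :
    (r : ℝ) ≤ 22500 * ε⁻¹ ^ 16 := by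
  have hε := P.pos
  have ha : (0 : ℝ) < a := by exact_mod_cast P.a_pos
  have h1 : (r : ℝ) * p ^ 16 ≤ 22500 * a ^ 16 := by exact_mod_cast P.r_mul_le hr
  have h2 : (r : ℝ) * (a * ε) ^ 16 ≤ r * p ^ 16 :=
    mul_le_mul_of_nonneg_left (pow_le_pow_left₀ (by positivity) P.a_mul_le 16) (by positivity)
  have h3 : (r * ε ^ 16) * (a : ℝ) ^ 16 ≤ 22500 * a ^ 16 := by
    calc (r * ε ^ 16) * (a : ℝ) ^ 16 = r * (a * ε) ^ 16 := by ring
      _ ≤ _ := h2.trans h1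
  have h4 := le_of_mul_le_mul_right h3 (by positivity)
  rw [inv_pow, ← div_eq_mul_inv, le_div_iff₀ (by positivity)]
  exact h4

/-- After multiplication by p^9 and insertion of r p^16 ≤ 22500 a^16, it remains to see that 60000 m
a^8 ≤ p^9. This follows from a ≤ mp and p ≥ 60000 m^9. -/
theorem r_mul_pow_le (P : Params ε i m a p Q h L b₀) {r : ℕ} (hr : 4 * h ^ 2 * r ≤ Q ^ 2) :
    800 * (r * p ^ 7 * m) ≤ Q := by
  have h0 := P.p_pos
  have h1 := P.r_mul_le hr
  have h2 : a ^ 8 ≤ m ^ 8 * p ^ 8 := by rw [← mul_pow]; exact Nat.pow_le_pow_left P.a_le 8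
  have h3 : 60000 * m ^ 9 ≤ p := by
    refine le_trans ?_ P.le_p
    refine (Nat.mul_le_mul (by norm_num) (Nat.pow_le_pow_right P.one_le_m (by norm_num)))
  have h4 : 60000 * m * a ^ 8 ≤ p ^ 9 := by
    calc 60000 * m * a ^ 8 ≤ 60000 * m * (m ^ 8 * p ^ 8) := Nat.mul_le_mul_left _ h2
      _ = 60000 * m ^ 9 * p ^ 8 := by ring
      _ ≤ p * p ^ 8 := Nat.mul_le_mul_right _ h3
      _ = p ^ 9 := by ring
  refine Nat.le_of_mul_le_mul_right (c := p ^ 9) ?_ (by positivity)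
  calc 800 * (r * p ^ 7 * m) * p ^ 9 = 800 * m * (r * p ^ 16) := by ring
    _ ≤ 800 * m * (22500 * a ^ 16) := Nat.mul_le_mul_left _ h1
    _ = 300 * a ^ 8 * (60000 * m * a ^ 8) := by ring
    _ ≤ 300 * a ^ 8 * p ^ 9 := Nat.mul_le_mul_left _ h4
    _ = Q * p ^ 9 := by rw [P.Q_eq]

/-- The rounding of the coefficients is harmless. -/
theorem coeff_error (P : Params ε i m a p Q h L b₀) {r : ℕ} (hr : 4 * h ^ 2 * r ≤ Q ^ 2) :
    (r : ℝ) * (2 * |(h : ℝ) - Q * (ε ^ 8 / 300)|) ≤ ε * Q / 50 := by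
  have hε := P.pos
  have hm : (0 : ℝ) < m := by exact_mod_cast P.one_le_m
  have ha : (0 : ℝ) < a := by exact_mod_cast P.a_pos
  have hQ : (Q : ℝ) * (ε ^ 8 / 300) = (a * ε) ^ 8 := by rw [P.Q_eq]; push_cast; ring
  have hh : (h : ℝ) = p ^ 8 := by rw [P.h_eq]; push_cast; ring
  have h1 : |(h : ℝ) - Q * (ε ^ 8 / 300)| ≤ 8 * (p : ℝ) ^ 7 := by
    have hx : (0 : ℝ) ≤ a * ε := by positivity
    have hle := P.a_mul_le
    have hlt := P.p_lt
    -- The first factor is less than 1, and each of the eight summands is at most p^7.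
    have e : (p : ℝ) ^ 8 - (a * ε) ^ 8 = (p - a * ε) * ∑ k ∈ range 8, p ^ k * (a * ε) ^ (7 - k) :=
      ((Commute.all _ _).mul_geom_sum₂ 8).symm
    have e2 : ∑ k ∈ range 8, (p : ℝ) ^ k * (a * ε) ^ (7 - k) ≤ 8 * p ^ 7 := by
      refine (sum_le_card_nsmul _ _ ((p : ℝ) ^ 7) fun k hk => ?_).trans (by simp)
      have hk' : k ≤ 7 := by simpa using Nat.lt_succ_iff.1 (by simpa using hk)
      calc (p : ℝ) ^ k * (a * ε) ^ (7 - k) ≤ p ^ k * p ^ (7 - k) := by gcongr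
        _ = p ^ 7 := by rw [← pow_add]; congr 1; omega
    have e3 : 0 ≤ ∑ k ∈ range 8, (p : ℝ) ^ k * (a * ε) ^ (7 - k) :=
      sum_nonneg fun k _ => by positivity
    rw [hQ, hh, e, abs_of_nonneg (mul_nonneg (by linarith) e3)]
    calc (p - a * ε) * ∑ k ∈ range 8, (p : ℝ) ^ k * (a * ε) ^ (7 - k)
        ≤ 1 * ∑ k ∈ range 8, (p : ℝ) ^ k * (a * ε) ^ (7 - k) :=
          mul_le_mul_of_nonneg_right (by linarith) e3
      _ ≤ 8 * p ^ 7 := by rw [one_mul]; exact e2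
  have h2 : (800 * (r * p ^ 7 * m) : ℝ) ≤ Q := by exact_mod_cast P.r_mul_pow_le hr
  calc (r : ℝ) * (2 * |h - Q * (ε ^ 8 / 300)|) ≤ r * (2 * (8 * (p : ℝ) ^ 7)) := by gcongr
    _ ≤ r * (2 * (8 * (p : ℝ) ^ 7)) * (m * ε) := le_mul_of_one_le_right (by positivity) P.one_le
    _ = 800 * (r * p ^ 7 * m) * ε / 50 := by ring
    _ ≤ Q * ε / 50 := by gcongr
    _ = _ := by ring

theorem le_mul_Q (P : Params ε i m a p Q h L b₀) : 300 ≤ ε * Q := by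
  have hε := P.pos
  have h1 : (300 * m : ℝ) ≤ Q := by
    have h2 : m ≤ a ^ 8 := by
      calc m ≤ a := by
            rw [P.a_eq]
            exact (Nat.le_self_pow (by norm_num) m).trans (Nat.le_mul_of_pos_left _ (by norm_num))
        _ ≤ a ^ 8 := Nat.le_self_pow (by norm_num) a
    rw [P.Q_eq]
    exact_mod_cast Nat.mul_le_mul_left 300 h2
  nlinarith [P.one_le]

end Params

theorem sum_range_mul {M : Type*} [AddCommMonoid M] (f : ℕ → M) (a n : ℕ) :
    ∑ l ∈ range (a * n), f l = ∑ x ∈ range a, ∑ y ∈ range n, f (x * n + y) := by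
  induction a with
  | zero => simp
  | succ a ih => rw [add_mul, one_mul, sum_range_add, ih, sum_range_succ]

/-! ### Translation between integer matrices and weighted graphs. -/

section Graphs

variable {n : ℕ} (G : SimpleGraph (Fin n))

theorem input_arrs_zero (k : ℕ) : (input G).arrs 0 k = 0 ∨ (input G).arrs 0 k = 1 := by
  simp only [input]
  split_ifs <;> simp

theorem input_arrs_of_ne {a : ℕ} (ha : a ≠ 0) (k : ℕ) : (input G).arrs a k = 0 := by
  simp [input, ha]

theorem ofGraph_apply (x y : Fin n) :
    ofGraph G s(x, y) = (((input G).mat 0 n x y : ℤ) : ℝ) := by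
  have : (∃ i j : Fin n, G.Adj i j ∧ (x : ℕ) * n + y = i * n + j) ↔ G.Adj x y := by
    constructor
    · rintro ⟨i, j, hij, h⟩
      obtain ⟨h1, h2⟩ := index_inj y.2 j.2 h
      rwa [Fin.ext h1, Fin.ext h2]
    · exact fun h => ⟨x, y, h, rfl⟩
  by_cases h : G.Adj x y <;> simp [ofGraph, State.mat, input, this, h]

theorem input_symm {x y : ℕ} (hx : x < n) (hy : y < n) :
    (input G).mat 0 n x y = (input G).mat 0 n y x := by
  have h := ofGraph_apply G ⟨x, hx⟩ ⟨y, hy⟩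
  rw [Sym2.eq_swap, ofGraph_apply G ⟨y, hy⟩ ⟨x, hx⟩] at h
  exact_mod_cast h.symm

theorem density_ofGraph :
    density (ofGraph G) = ((∑ l ∈ range (n ^ 2), (input G).arrs 0 l : ℤ) : ℝ) / n ^ 2 := by
  rw [density, Fintype.card_fin, sq n, sum_range_mul, edgeSum]
  congr 1
  push_cast
  rw [← Fin.sum_univ_eq_sum_range
    (fun x => ∑ y ∈ range n, (((input G).arrs 0 (x * n + y) : ℤ) : ℝ))]
  refine sum_congr rfl fun x _ => ?_
  rw [← Fin.sum_univ_eq_sum_range (fun y => (((input G).arrs 0 (x * n + y) : ℤ) : ℝ))]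
  exact sum_congr rfl fun y _ => ofGraph_apply G x y

theorem sum_input_nonneg (k : ℕ) : 0 ≤ ∑ l ∈ range k, (input G).arrs 0 l :=
  sum_nonneg fun l _ => by rcases input_arrs_zero G l with h | h <;> simp [h]

theorem sum_input_le (k : ℕ) : ∑ l ∈ range k, (input G).arrs 0 l ≤ k :=
  (sum_le_card_nsmul _ _ 1 fun l _ => by
    rcases input_arrs_zero G l with h | h <;> simp [h]).trans (by simp)

/-- The adjacency matrix multiplied by `Q`, minus the rounded density. -/
noncomputable def centered (Q : ℕ) (x y : ℕ) : ℤ :=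
  Q * (input G).mat 0 n x y - Q * (∑ l ∈ range (n ^ 2), (input G).arrs 0 l) / n ^ 2

theorem abs_centered_le (hn : 0 < n) (Q x y : ℕ) : |centered G Q x y| ≤ Q := by
  have hn2 : (0 : ℤ) < n ^ 2 := by positivity
  have h1 := sum_input_nonneg G (n ^ 2)
  have h2 : Q * (∑ l ∈ range (n ^ 2), (input G).arrs 0 l) / n ^ 2 ≤ Q :=
    Int.ediv_le_of_le_mul hn2
      (mul_le_mul_of_nonneg_left (by exact_mod_cast sum_input_le G (n ^ 2)) (by positivity))
  have h3 : 0 ≤ Q * (∑ l ∈ range (n ^ 2), (input G).arrs 0 l) / (n : ℤ) ^ 2 :=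
    Int.ediv_nonneg (mul_nonneg (by positivity) h1) hn2.le
  rcases input_arrs_zero G (x * n + y) with h | h <;>
    rw [centered, State.mat, h, abs_le] <;> constructor <;> linarith

theorem abs_centered_sub_le (hn : 0 < n) (Q : ℕ) (x y : Fin n) :
    |Q * (ofGraph G s(x, y) - density (ofGraph G)) - centered G Q x y| ≤ 1 := by
  rw [density_ofGraph, ofGraph_apply, centered]
  set s := ∑ l ∈ range (n ^ 2), (input G).arrs 0 l
  have hn2 : (0 : ℤ) < n ^ 2 := by positivity
  have hn3 : (0 : ℝ) < n ^ 2 := by positivity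
  have h1 : ((n ^ 2 * (Q * s / n ^ 2) : ℤ) : ℝ) ≤ Q * s := by
    exact_mod_cast Int.mul_ediv_self_le (x := Q * s) hn2.ne'
  have h2 : (Q * s : ℝ) < ((n ^ 2 * (Q * s / n ^ 2) + n ^ 2 : ℤ) : ℝ) := by
    exact_mod_cast Int.lt_mul_ediv_self_add (x := Q * s) hn2
  push_cast at h1 h2 ⊢
  have h3 : (s : ℝ) / n ^ 2 * n ^ 2 = s := div_mul_cancel₀ _ hn3.ne'
  rw [abs_le]
  constructor <;> refine le_of_mul_le_mul_right ?_ hn3 <;> nlinarith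

theorem cutDist_le (hn : 0 < n) {G H : WGraph (Fin n)} {δ : ℝ}
    (h : ∀ X Y : Finset (Fin n), |∑ x ∈ X, ∑ y ∈ Y, (G s(x, y) - H s(x, y))| ≤ δ * n ^ 2) :
    cutDist G H ≤ δ := by
  refine ciSup_le fun p => ?_
  rw [Fintype.card_fin, div_le_iff₀ (by positivity)]
  simpa [edgeSum, sum_sub_distrib] using h p.1 p.2

theorem abs_sum_sum_le {f : Fin n → Fin n → ℝ} {δ : ℝ} (hδ : 0 ≤ δ) (h : ∀ x y, |f x y| ≤ δ)
    (X Y : Finset (Fin n)) : |∑ x ∈ X, ∑ y ∈ Y, f x y| ≤ δ * n ^ 2 := by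
  have hX : (#X : ℝ) ≤ n := by exact_mod_cast (card_le_univ X).trans_eq (Fintype.card_fin n)
  have hY : (#Y : ℝ) ≤ n := by exact_mod_cast (card_le_univ Y).trans_eq (Fintype.card_fin n)
  refine (abs_sum_le_sum_abs _ _).trans ((sum_le_card_nsmul _ _ (n * δ) fun x _ => ?_).trans ?_)
  · refine (abs_sum_le_sum_abs _ _).trans ((sum_le_card_nsmul _ _ δ fun y _ => h x y).trans ?_)
    rw [nsmul_eq_mul]
    exact mul_le_mul_of_nonneg_right hY hδ
  · rw [nsmul_eq_mul]
    calc (#X : ℝ) * (n * δ) ≤ n * (n * δ) := mul_le_mul_of_nonneg_right hX (by positivity)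
      _ = δ * n ^ 2 := by ring

/-- Products of indicators reproduce the weight 2 inside S ∩ T, on the diagonal as well. -/
theorem cutGraph_row {τ : State} {i : ℕ} (h2 : ∀ x < n, τ.mat 2 n i x = 0 ∨ τ.mat 2 n i x = 1)
    (h3 : ∀ x < n, τ.mat 3 n i x = 0 ∨ τ.mat 3 n i x = 1) (x y : Fin n) :
    cutGraph (τ.row n 2 i) (τ.row n 3 i) s(x, y) =
      ((τ.mat 2 n i x * τ.mat 3 n i y + τ.mat 2 n i y * τ.mat 3 n i x : ℤ) : ℝ) := by
  have e2 : ∀ v : Fin n, v ∈ τ.row n 2 i ↔ τ.mat 2 n i v = 1 := fun v => by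
    simp [State.row, State.mat]
  have e3 : ∀ v : Fin n, v ∈ τ.row n 3 i ↔ τ.mat 3 n i v = 1 := fun v => by
    simp [State.row, State.mat]
  simp only [cutGraph, Sym2.lift_mk, e2, e3]
  rcases h2 x x.2 with hx | hx <;> rcases h2 y y.2 with hy | hy <;>
    rcases h3 x x.2 with hx' | hx' <;> rcases h3 y y.2 with hy' | hy' <;>
    simp [hx, hy, hx', hy', one_add_one_eq_two]

end Graphs

/-- The state holds a solution. -/
def State.Solves {n : ℕ} (τ : State) (ε : ℝ) (G : SimpleGraph (Fin n)) : Prop :=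
  ∃ (r : ℕ) (c : Fin r → ℝ) (S T : Fin r → Finset (Fin n)), IsOutput ε τ c S T ∧
    (r : ℝ) ≤ 22500 * ε⁻¹ ^ 16 ∧ (∀ i, c i = -(ε ^ 8 / 300) ∨ c i = ε ^ 8 / 300) ∧
    cutDist (ofGraph G) (const (Fin n) (density (ofGraph G)) +
      ∑ i, c i • cutGraph (S i) (T i)) ≤ ε

theorem ofGraph_mem {n : ℕ} (G : SimpleGraph (Fin n)) (z : Sym2 (Fin n)) :
    0 ≤ ofGraph G z ∧ ofGraph G z ≤ 1 := by
  unfold ofGraph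
  split_ifs <;> simp

/-- Entries and density lie in [0, 1], so the constant graph alone is within cut distance 1. -/
theorem solves_of_one_le {n : ℕ} {ε : ℝ} (hn : 0 < n) (G : SimpleGraph (Fin n)) (hε : 1 ≤ ε)
    {τ : State} (hτ : τ.vars 0 = 0) : τ.Solves ε G := by
  refine ⟨0, Fin.elim0, Fin.elim0, Fin.elim0, ⟨by simpa using hτ, fun i => i.elim0⟩,
    by simp; positivity, fun i => i.elim0, cutDist_le hn fun X Y => ?_⟩
  refine (abs_sum_sum_le zero_le_one (fun x y => ?_) X Y).trans (by gcongr)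
  have h1 := ofGraph_mem G s(x, y)
  have hn2 : (0 : ℝ) < n ^ 2 := by positivity
  have h2 : 0 ≤ density (ofGraph G) := by
    rw [density_ofGraph]
    exact div_nonneg (by exact_mod_cast sum_input_nonneg G _) hn2.le
  have h3 : density (ofGraph G) ≤ 1 := by
    rw [density_ofGraph, div_le_one hn2]
    exact_mod_cast sum_input_le G _
  simp only [univ_eq_empty, sum_empty, add_zero, const]
  rw [abs_le]
  constructor <;> linarith [h1.1, h1.2]

/-! ### Assembling the approximation, the running time and the word size. -/

section Main

variable {ε : ℝ} {i m a p Q h L b₀ n N₀ r : ℕ} {G : SimpleGraph (Fin n)} {σ : State} {θ : ℤ}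

/-- The truncated part gives 3/4. The rest gives at most Q²n²/(2L) = Qn²/(8m) ≤ εQn²/8. -/
theorem Params.abs_sum_le (P : Params ε i m a p Q h L b₀) {A : ℕ → ℕ → ℤ}
    (hA : energy n L A ≤ Q ^ 2 * n ^ 2)
    (hc : ∀ X ⊆ range n, ∀ Y ⊆ range n,
      |∑ x ∈ X, ∑ y ∈ Y, (clip L (A x y) : ℝ)| < 3 / 4 * ε * Q * n ^ 2) (X Y : Finset (Fin n)) :
    |∑ x ∈ X, ∑ y ∈ Y, (A x y : ℝ)| ≤ 7 / 8 * (ε * Q) * n ^ 2 := by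
  have hm : (0 : ℝ) < m := by exact_mod_cast P.one_le_m
  have hQ0 : (0 : ℝ) < Q := by
    have := P.le_mul_Q
    exact pos_of_mul_pos_right (by linarith) P.pos.le
  set X' := X.map Fin.valEmbedding
  set Y' := Y.map Fin.valEmbedding
  have hX : X' ⊆ range n := fun x hx => by
    obtain ⟨v, -, rfl⟩ := mem_map.1 hx
    simp
  have hY : Y' ⊆ range n := fun x hx => by
    obtain ⟨v, -, rfl⟩ := mem_map.1 hx
    simp
  have e : ∑ x ∈ X, ∑ y ∈ Y, (A x y : ℝ) = ∑ x ∈ X', ∑ y ∈ Y', (A x y : ℝ) := by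
    simp [X', Y', sum_map]
  have h1 := two_mul_abs_sum_sub_clip_le (L := (L : ℤ)) (by positivity) A hX hY
  have h2 : (2 * L * |∑ x ∈ X', ∑ y ∈ Y', ((A x y : ℝ) - clip L (A x y))| : ℝ) ≤
      Q ^ 2 * n ^ 2 := by
    exact_mod_cast h1.trans hA
  have hL : (L : ℝ) = 4 * m * Q := by rw [P.L_eq]; push_cast; ring
  have h3 : |∑ x ∈ X', ∑ y ∈ Y', ((A x y : ℝ) - clip L (A x y))| ≤ 1 / 8 * (ε * Q) * n ^ 2 := by
    refine le_of_mul_le_mul_left (a := 2 * (L : ℝ)) (h2.trans ?_) (by rw [hL]; positivity)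
    calc (Q : ℝ) ^ 2 * n ^ 2 ≤ Q ^ 2 * n ^ 2 * (m * ε) :=
          le_mul_of_one_le_right (by positivity) P.one_le
      _ = _ := by rw [hL]; ring
  have h4 : ∑ x ∈ X', ∑ y ∈ Y', (A x y : ℝ) = ∑ x ∈ X', ∑ y ∈ Y', (clip L (A x y) : ℝ) +
      ∑ x ∈ X', ∑ y ∈ Y', ((A x y : ℝ) - clip L (A x y)) := by
    simp only [sum_sub_distrib]; ring
  rw [e, h4]
  refine (abs_add_le _ _).trans ((add_le_add (hc X' hX Y' hY).le h3).trans (le_of_eq (by ring)))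

/-- The errors, in units of εQn², are 7/8 from the remaining matrix, 1/50 from replacing Qε^8/300 by
h, and at most 1/300 from rounding the density, since εQ ≥ 300. They add up to less than 1. -/
theorem Params.solves (P : Params ε i m a p Q h L b₀) (hn : 0 < n)
    (hσ : σ.Model n h L Q N₀ b₀ r θ (centered G Q))
    (hc : ∀ X ⊆ range n, ∀ Y ⊆ range n,
      |∑ x ∈ X, ∑ y ∈ Y, (clip L (σ.mat 0 n x y) : ℝ)| < 3 / 4 * ε * Q * n ^ 2) :
    (σ.setVar 0 r).Solves ε G := by
  have hε := P.pos
  have hn2 : (0 : ℝ) < n ^ 2 := by positivity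
  have hQ0 : (0 : ℝ) < Q := by
    have := P.le_mul_Q
    exact pos_of_mul_pos_right (by linarith) hε.le
  have hen := energy_nonneg (L := (L : ℤ)) (by positivity) n (σ.mat 0 n)
  have hr : 4 * h ^ 2 * r ≤ Q ^ 2 := by
    have h1 : (4 * h ^ 2 * n ^ 2 * r : ℤ) ≤ Q ^ 2 * n ^ 2 := by linarith [hσ.energy]
    have h2 : 4 * h ^ 2 * r * n ^ 2 ≤ Q ^ 2 * n ^ 2 := by
      have : 4 * h ^ 2 * n ^ 2 * r ≤ Q ^ 2 * n ^ 2 := by exact_mod_cast h1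
      linarith
    exact Nat.le_of_mul_le_mul_right h2 (by positivity)
  have henergy : CutGraph.energy n L (σ.mat 0 n) ≤ Q ^ 2 * n ^ 2 := by
    have : (0 : ℤ) ≤ 4 * h ^ 2 * n ^ 2 * r := by positivity
    linarith [hσ.energy]
  refine ⟨r, fun j => σ.arrs 1 j * (ε ^ 8 / 300), fun j => σ.row n 2 j, fun j => σ.row n 3 j,
    ⟨by simp, fun j => ⟨rfl, rfl, rfl⟩⟩, P.r_le hr, fun j => ?_, cutDist_le hn fun X Y => ?_⟩
  · rcases hσ.sign j j.2 with h1 | h1 <;> simp [h1]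
  set K : ℕ → ℕ → ℕ → ℤ := fun j x y =>
    σ.mat 2 n j x * σ.mat 3 n j y + σ.mat 2 n j y * σ.mat 3 n j x with hK
  set H := const (Fin n) (density (ofGraph G)) +
    ∑ j : Fin r, ((σ.arrs 1 j : ℝ) * (ε ^ 8 / 300)) • cutGraph (σ.row n 2 j) (σ.row n 3 j) with hH
  have hHval : ∀ x y : Fin n, H s(x, y) = density (ofGraph G) +
      ∑ j ∈ range r, (σ.arrs 1 j : ℝ) * (ε ^ 8 / 300) * (K j x y : ℝ) := by
    intro x y
    rw [← Fin.sum_univ_eq_sum_range (fun j => (σ.arrs 1 j : ℝ) * (ε ^ 8 / 300) * (K j x y : ℝ))]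
    simp only [hH, Pi.add_apply, const, Finset.sum_apply, Pi.smul_apply, smul_eq_mul]
    refine congrArg _ (sum_congr rfl fun j _ => ?_)
    rw [cutGraph_row (hσ.left j j.2) (hσ.right j j.2)]
  have hrest : ∀ x y : Fin n,
      |Q * (ofGraph G s(x, y) - H s(x, y)) - (σ.mat 0 n x y : ℝ)| ≤ 1 + ε * Q / 50 := by
    intro x y
    have e1 : Q * (ofGraph G s(x, y) - H s(x, y)) - (σ.mat 0 n x y : ℝ) =
        (Q * (ofGraph G s(x, y) - density (ofGraph G)) - centered G Q x y) +
        ∑ j ∈ range r, (σ.arrs 1 j * K j x y : ℝ) * (h - Q * (ε ^ 8 / 300)) := by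
      rw [hHval, hσ.eq x x.2 y y.2]
      push_cast
      have e2 : ∑ j ∈ range r, (σ.arrs 1 j * K j x y : ℝ) * (h - Q * (ε ^ 8 / 300)) =
          ∑ j ∈ range r, h * (σ.arrs 1 j : ℝ) * (K j x y : ℝ) -
          Q * ∑ j ∈ range r, (σ.arrs 1 j : ℝ) * (ε ^ 8 / 300) * (K j x y : ℝ) := by
        rw [mul_sum, ← sum_sub_distrib]
        exact sum_congr rfl fun j _ => by ring
      rw [e2]
      simp only [hK]
      push_cast
      ring
    have e3 : |∑ j ∈ range r, (σ.arrs 1 j * K j x y : ℝ) * (h - Q * (ε ^ 8 / 300))| ≤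
        (r : ℝ) * (2 * |(h : ℝ) - Q * (ε ^ 8 / 300)|) := by
      refine (abs_sum_le_sum_abs _ _).trans ((sum_le_card_nsmul _ _
        (2 * |(h : ℝ) - Q * (ε ^ 8 / 300)|) fun j hj => ?_).trans (by simp))
      have hj' : j < r := by simpa using hj
      have := abs_cut_le (h := 1) (hσ.sign j hj') (hσ.left j hj' x x.2) (hσ.right j hj' y y.2)
        (hσ.left j hj' y y.2) (hσ.right j hj' x x.2)
      have h5 : |(σ.arrs 1 j * K j x y : ℝ)| ≤ 2 := by
        have h6 : |σ.arrs 1 j * K j x y| ≤ 2 := by simpa [hK] using this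
        exact_mod_cast h6
      rw [abs_mul]
      exact mul_le_mul_of_nonneg_right h5 (abs_nonneg _)
    rw [e1]
    exact (abs_add_le _ _).trans (add_le_add (abs_centered_sub_le G hn Q x y)
      (e3.trans (P.coeff_error hr)))
  have hQε := P.le_mul_Q
  have h1 := P.abs_sum_le henergy hc X Y
  have h2 := abs_sum_sum_le (by positivity) hrest X Y
  refine le_of_mul_le_mul_left (a := (Q : ℝ)) ?_ hQ0
  have h3 : (Q : ℝ) * |∑ x ∈ X, ∑ y ∈ Y, (ofGraph G s(x, y) - H s(x, y))| =
      |∑ x ∈ X, ∑ y ∈ Y, (σ.mat 0 n x y : ℝ) + ∑ x ∈ X, ∑ y ∈ Y,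
        (Q * (ofGraph G s(x, y) - H s(x, y)) - (σ.mat 0 n x y : ℝ))| := by
    rw [← sum_add_distrib, ← abs_of_pos hQ0, ← abs_mul, abs_of_pos hQ0, mul_sum]
    refine congrArg _ (sum_congr rfl fun x _ => ?_)
    rw [← sum_add_distrib, mul_sum]
    exact sum_congr rfl fun y _ => by ring
  rw [h3]
  refine (abs_add_le _ _).trans ((add_le_add h1 h2).trans ?_)
  calc 7 / 8 * (ε * Q) * n ^ 2 + (1 + ε * Q / 50) * n ^ 2
      = (7 / 8 * (ε * Q) + (1 + ε * Q / 50)) * n ^ 2 := by ring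
    _ ≤ ε * Q * n ^ 2 := mul_le_mul_of_nonneg_right (by linarith) hn2.le
    _ = _ := by ring

theorem Params.exists {ε : ℝ} (hε : 0 < ε) (hε1 : ε < 1) :
    ∃ i m a p Q h L b₀, Params ε i m a p Q h L b₀ := by
  have hex : ∃ i : ℕ, 1 ≤ (2 : ℝ) ^ i * ε := by
    obtain ⟨i, hi⟩ := pow_unbounded_of_one_lt ε⁻¹ one_lt_two
    refine ⟨i, ?_⟩
    rw [← div_le_iff₀ hε, one_div]
    exact hi.le
  classical
  exact ⟨Nat.find hex, _, _, _, _, _, _, _, hε1, rfl, by exact_mod_cast Nat.find_spec hex,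
    fun i' hi' => not_le.1 (Nat.find_min hex hi'), rfl, rfl, rfl, rfl, rfl, rfl⟩

theorem Params.ends_approximate (P : Params ε i m a p Q h L b₀) (hn : 0 < n)
    (G : SimpleGraph (Fin n)) :
    Ends ((2 * m * n) ^ 700) ε approximate (input G) (2 ^ 64 * m ^ 32 * n ^ 2) fun τ =>
      τ.Solves ε G := by
  have hε := P.pos
  have hm1 := P.one_le_m
  set Y := 2 * m * n with hY
  have hmn : m ≤ m * n := Nat.le_mul_of_pos_right _ hn
  have hnm : n ≤ m * n := Nat.le_mul_of_pos_left _ hm1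
  have hY' : Y = 2 * (m * n) := by rw [hY]; ring
  have hY2 : 2 ≤ Y := by omega
  have hnY : 2 * n ≤ Y := by omega
  have hmY : 2 * m ≤ Y := by omega
  have haY : a ≤ Y ^ 17 := by
    rw [P.a_eq]
    calc 2 ^ 16 * m ^ 17 ≤ 2 ^ 17 * m ^ 17 := Nat.mul_le_mul_right _ (by norm_num)
      _ = (2 * m) ^ 17 := by ring
      _ ≤ Y ^ 17 := Nat.pow_le_pow_left hmY _
  have hhY : h ≤ Y ^ 136 := by
    rw [P.h_eq]
    exact (Nat.pow_le_pow_left (P.p_le_a.trans haY) 8).trans_eq (by ring)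
  have h300 : 300 ≤ Y ^ 9 := (by norm_num : 300 ≤ 2 ^ 9).trans (Nat.pow_le_pow_left hY2 9)
  have hQY : Q ≤ Y ^ 145 := by
    rw [P.Q_eq]
    exact (Nat.mul_le_mul h300 (Nat.pow_le_pow_left haY 8)).trans_eq (by ring)
  have hLY : L ≤ Y ^ 148 := by
    rw [P.L_eq]
    have h4 : 4 * m ≤ Y ^ 2 := by
      calc 4 * m = 2 * (2 * m) := by ring
        _ ≤ Y * Y := Nat.mul_le_mul hY2 hmY
        _ = Y ^ 2 := by ring
    refine (Nat.mul_le_mul h4 hQY).trans ?_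
    rw [← pow_add]
    exact Nat.pow_le_pow_right (by omega) (by norm_num)
  have hbY : b₀ ≤ Y ^ 40 := by
    rw [P.b_eq]
    calc 2 ^ 40 * m ^ 16 ≤ 2 ^ 40 * m ^ 40 :=
          Nat.mul_le_mul_left _ (Nat.pow_le_pow_right hm1 (by norm_num))
      _ = (2 * m) ^ 40 := by ring
      _ ≤ Y ^ 40 := Nat.pow_le_pow_left hmY _
  have hm16 : 1 ≤ m ^ 16 := Nat.one_le_pow _ _ hm1
  have hMY : 22500 * m ^ 16 + 1 ≤ Y ^ 31 := by
    calc 22500 * m ^ 16 + 1 ≤ 2 ^ 31 * m ^ 16 := by omega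
      _ ≤ 2 ^ 31 * m ^ 31 := Nat.mul_le_mul_left _ (Nat.pow_le_pow_right hm1 (by norm_num))
      _ = (2 * m) ^ 31 := by ring
      _ ≤ Y ^ 31 := Nat.pow_le_pow_left hmY _
  have hexj : ∃ j, n ≤ 4 ^ j := ⟨n, (Nat.lt_pow_self (by norm_num)).le⟩
  obtain ⟨j, hj, hj'⟩ : ∃ j, n ≤ 4 ^ j ∧ ∀ j' < j, 4 ^ j' < n :=
    ⟨Nat.find hexj, Nat.find_spec hexj, fun j' h => not_le.1 (Nat.find_min hexj h)⟩
  have hN4 : 4 ^ j ≤ 4 * n := by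
    rcases j with _ | j
    · simp; omega
    · have := hj' j (Nat.lt_succ_self j)
      rw [pow_succ]; omega
  have hjn : j ≤ n := by
    rcases j with _ | j
    · omega
    · exact (Nat.lt_pow_self (by norm_num : 1 < 4)).trans (hj' j (Nat.lt_succ_self j))
  have hNY : 4 ^ j ≤ Y ^ 2 := by
    calc 4 ^ j ≤ 2 * (2 * n) := by omega
      _ ≤ Y * Y := Nat.mul_le_mul hY2 hnY
      _ = Y ^ 2 := by ring
  have hB := roundBound_pow (n := n) hY2 (by omega) hLY hhY hQY hNY hbY hMY
  have key : ∀ {x : ℕ} (k : ℕ), x ≤ Y ^ k → k ≤ 700 → x ≤ Y ^ 700 := fun k hx hk =>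
    hx.trans (Nat.pow_le_pow_right (by omega) hk)
  have hn2Y : n ^ 2 ≤ Y ^ 2 := Nat.pow_le_pow_left (by omega) 2
  have him : i ≤ m := by rw [P.m_eq]; exact Nat.lt_two_pow_self.le
  have hcond : ¬ 1 ≤ ε := not_le.2 P.lt_one
  have hb2 : b₀ = 2 ^ (40 + 16 * i) := by rw [P.b_eq, P.m_eq]; ring
  -- The test -ε ≤ -1 singles out ε ≥ 1.
  refine Ends.ite (by simp [Ok]) (fun h1 => absurd h1 (by simp [val, P.lt_one])) fun _ => ?_
  refine Ends.cons (c₁ := i + p + j)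
    (c₂ := 2 * n ^ 2 + (22500 * m ^ 16 + 1) * (162 * n ^ 2 * b₀ + 1))
    (ends_setup (n := n) (by simp [input]) P.m_eq P.one_le P.lt P.a_eq P.p_eq P.Q_eq P.h_eq P.L_eq
      (j := j) rfl hj hj' P.b_eq (key 1 (by simp; omega) (by norm_num)) (key _ haY (by norm_num))
      (key _ (P.p_le_a.trans haY) (by norm_num)) (key _ hQY (by norm_num))
      (key _ hhY (by norm_num)) (key _ hLY (by norm_num)) (key _ hNY (by norm_num))
      (key _ hbY (by norm_num)) (key 139 ?_ (by norm_num))) ?_ ?_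
  · exact (Nat.mul_le_mul (Nat.mul_le_mul hY2 hhY) hn2Y).trans_eq (by ring)
  · rintro σ₁ - ⟨e0, e4, e5, e6, e7, e8, e9, e10, e11, ea⟩
    refine Ends.cons (c₁ := 2 * n ^ 2) (ends_center hn e0 e4 (by rw [ea]; exact input_arrs_zero G)
      (key 147 ?_ (by norm_num)) (key 2 hn2Y (by norm_num))) ?_ le_rfl
    · exact (Nat.mul_le_mul hQY hn2Y).trans_eq (by ring)
    rintro σ₂ hF hA
    have hmat : ∀ x < n, ∀ y < n, σ₂.mat 0 n x y = centered G Q x y := by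
      intro x hx y hy
      rw [State.mat, hA _ (by rw [sq]; exact index_lt hx hy), ea]
      rfl
    have harr : ∀ b, b ≠ 0 → ∀ k, σ₂.arrs b k = 0 := by
      intro b hb k
      rw [hF.arr b (by simpa [center, forLoop, block, stores] using hb), ea,
        input_arrs_of_ne G hb]
    have hmodel : σ₂.Model n h L Q (4 ^ j) b₀ 0 (2 * h * n ^ 2) (centered G Q) := by
      refine ⟨(hF.var 0 rfl).trans e0, (hF.var 5 rfl).trans e5, (hF.var 6 rfl).trans e6,
        (hF.var 7 rfl).trans e7, (hF.var 8 rfl).trans e8, by simpa using (hF.var 9 rfl).trans e9,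
        (hF.var 11 rfl).trans e11, by simp, by simp, by simp, by simpa using hmat, ?_,
        ⟨fun k _ => harr 4 (by norm_num) k, fun k => ?_, fun k => ?_, fun k => ?_⟩⟩
      · have := energy_le (n := n) (L := (L : ℤ)) (A := σ₂.mat 0 n) (Q := Q)
          (fun x hx y hy => by rw [hmat x hx y hy]; exact abs_centered_le G hn Q x y)
        simpa using this
      · simp [harr 4 (by norm_num) k]
      · simp [harr 6 (by norm_num) k]
      · simp [harr 9 (by norm_num) k]
    refine Ends.cons (c₂ := 0) (ends_rounds hmodel hn ((hF.var 10 rfl).trans e10) rfl hb2 hj hN4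
      (fun x hx y hy => ?_) (fun x _ y _ => abs_centered_le G hn Q x y) hB P.sq_lt
      (by positivity) (P.cut_small hn)) ?_ le_rfl
    · rw [centered, centered, input_symm G hx hy]
    rintro υ - ⟨r, hr, hυ, hc⟩
    have hv : (var 9).val ε υ = r := hυ.v9
    refine Ends.assign_cons trivial ?_ (Ends.nil ?_)
    · rw [hv]
      simp only [Nat.abs_cast]
      have := hB.count
      exact_mod_cast (by omega : r ≤ Y ^ 700)
    · rw [hv]
      exact P.solves hn hυ hc
  · have hm17 : m ^ 17 ≤ m ^ 32 := Nat.pow_le_pow_right hm1 (by norm_num)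
    have hm32 : m ≤ m ^ 32 := Nat.le_self_pow (by norm_num) m
    have hn1 : 1 ≤ n ^ 2 := Nat.one_le_pow _ _ hn
    have hnn : n ≤ n ^ 2 := Nat.le_self_pow (by norm_num) n
    have h32 : 1 ≤ m ^ 32 := Nat.one_le_pow _ _ hm1
    have hmn1 : m ^ 32 ≤ m ^ 32 * n ^ 2 := Nat.le_mul_of_pos_right _ (by omega)
    have hmn2 : n ^ 2 ≤ m ^ 32 * n ^ 2 := Nat.le_mul_of_pos_left _ (by omega)
    have hp : p ≤ 2 ^ 16 * m ^ 17 := by rw [← P.a_eq]; exact P.p_le_a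
    -- The number of rounds and the block size b₀ contribute a factor m^16 each; this term dominates
    -- the running time.
    have hbig : (22500 * m ^ 16 + 1) * (162 * n ^ 2 * b₀ + 1) ≤ 2 ^ 63 * (m ^ 32 * n ^ 2) := by
      have h1 : 22500 * m ^ 16 + 1 ≤ 22501 * m ^ 16 := by omega
      have h2 : 162 * n ^ 2 * b₀ + 1 ≤ (162 * 2 ^ 40 + 1) * (n ^ 2 * m ^ 16) := by
        have : 1 ≤ n ^ 2 * m ^ 16 := Nat.one_le_iff_ne_zero.2 (by positivity)
        rw [P.b_eq]; nlinarith
      calc (22500 * m ^ 16 + 1) * (162 * n ^ 2 * b₀ + 1)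
          ≤ 22501 * m ^ 16 * ((162 * 2 ^ 40 + 1) * (n ^ 2 * m ^ 16)) := Nat.mul_le_mul h1 h2
        _ = 22501 * (162 * 2 ^ 40 + 1) * (m ^ 32 * n ^ 2) := by ring
        _ ≤ 2 ^ 63 * (m ^ 32 * n ^ 2) := Nat.mul_le_mul_right _ (by norm_num)
    rw [mul_assoc (2 ^ 64)]
    omega

end Main

theorem input_bdd {n B : ℕ} (G : SimpleGraph (Fin n)) (hB : 1 ≤ B) (hn : n ≤ B) :
    (input G).Bdd B := by
  have h1 : (1 : ℤ) ≤ B := by exact_mod_cast hB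
  refine ⟨fun x => ?_, fun a k => ?_⟩
  · simp only [input]
    split_ifs
    · simpa using hn
    · simp
  · by_cases ha : a = 0
    · subst ha
      rcases input_arrs_zero G k with h | h <;> simp [h]
      exact_mod_cast hB
    · simp [input_arrs_of_ne G ha]

theorem exists_ends_approximate {n : ℕ} {ε : ℝ} (hn : 0 < n) (hε : 0 < ε)
    (G : SimpleGraph (Fin n)) : ∃ m : ℕ, 1 ≤ m ∧ (m : ℝ) ≤ 2 * max 1 ε⁻¹ ∧
      Ends ((2 * m * n) ^ 700) ε approximate (input G) (2 ^ 64 * m ^ 32 * n ^ 2) fun τ =>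
        τ.Solves ε G := by
  rcases lt_or_ge ε 1 with h | h
  · obtain ⟨i, m, a, p, Q, h', L, b₀, P⟩ := Params.exists hε h
    refine ⟨m, P.one_le_m, ?_, P.ends_approximate hn G⟩
    have h1 : (m : ℝ) ≤ 2 * ε⁻¹ := by
      rw [← div_eq_mul_inv, le_div_iff₀ hε]
      exact P.m_mul_lt.le
    exact h1.trans (mul_le_mul_of_nonneg_left (le_max_right _ _) (by norm_num))
  · refine ⟨1, le_rfl, by have := le_max_left 1 ε⁻¹; push_cast; linarith, ?_⟩
    refine Ends.ite (by simp [Ok]) (fun _ => ?_) (fun h1 => absurd h1 (by simp [val, h]))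
    exact Ends.assign trivial (by simp [val])
      (solves_of_one_le hn G h (by simp [val]))

end CutGraph

theorem theorem1p3 :
    ∃ (P : CutGraph.Prog) (C k : ℕ),
      ∀ (n : ℕ) (G : SimpleGraph (Fin n)) (ε : ℝ), 0 < n → 0 < ε →
        ∃ (W t : ℕ) (τ : CutGraph.State),
          CutGraph.Exec W ε P (CutGraph.input G) t τ ∧
          (t : ℝ) ≤ C * (max 1 ε⁻¹) ^ k * (n : ℝ) ^ 2 ∧
          (W : ℝ) ≤ C * (max 1 ε⁻¹ * n) ^ k ∧
          ∃ (r : ℕ) (c : Fin r → ℝ) (S T : Fin r → Finset (Fin n)),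
            CutGraph.IsOutput ε τ c S T ∧
            (r : ℝ) ≤ C * ε⁻¹ ^ 16 ∧
            (∀ i, c i = -(ε ^ 8 / 300) ∨ c i = ε ^ 8 / 300) ∧
            CutGraph.cutDist (CutGraph.ofGraph G)
              (CutGraph.const (Fin n) (CutGraph.density (CutGraph.ofGraph G)) +
                ∑ i, c i • CutGraph.cutGraph (S i) (T i)) ≤ ε := by
  obtain ⟨K, hK⟩ := CutGraph.approximate.polyBounded_bnd
  set U := CutGraph.approximate.unitCost
  -- With z = max 1 ε⁻¹ and m ≤ 2z, one plus the number of iterations is at most 2^65 m^32 n² ≤ 2^97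
  -- z^32 n². For the word bound, 2mn ≤ 4zn is raised to the power 700K, which explains the next
  -- constant.
  set C₁ := U * 2 ^ 97
  set C₂ := K * 4 ^ (700 * K)
  refine ⟨CutGraph.approximate, C₁ + C₂ + 22500, 700 * K + 32, fun n G ε hn hε => ?_⟩
  obtain ⟨m, hm, hmε, l, τ, hrun, hl, r, c, S, T, hout, hr, hc, hd⟩ :=
    CutGraph.exists_ends_approximate hn hε G
  set z := max 1 ε⁻¹
  have hz : 1 ≤ z := le_max_left _ _
  have hn1 : (1 : ℝ) ≤ n := by exact_mod_cast hn
  have hY : 1 ≤ 2 * m * n := Nat.one_le_iff_ne_zero.2 (by positivity)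
  have hB : 1 ≤ (2 * m * n) ^ 700 := Nat.one_le_pow _ _ hY
  have hnB : n ≤ (2 * m * n) ^ 700 :=
    (Nat.le_mul_of_pos_left n (by omega)).trans (Nat.le_self_pow (by norm_num) _)
  obtain ⟨t, ht, htU, -⟩ := hrun.exec (CutGraph.input_bdd G hB hnB) le_rfl
  refine ⟨_, t, τ, ht, ?_, ?_, r, c, S, T, hout, hr.trans ?_, hc, hd⟩
  · have h1 : t ≤ U * (2 ^ 65 * m ^ 32 * n ^ 2) := by
      refine htU.trans (Nat.mul_le_mul_left _ ?_)
      have : 1 ≤ m ^ 32 * n ^ 2 := Nat.one_le_iff_ne_zero.2 (by positivity)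
      rw [mul_assoc] at hl ⊢
      omega
    calc (t : ℝ) ≤ U * (2 ^ 65 * m ^ 32 * n ^ 2) := by exact_mod_cast h1
      _ ≤ U * (2 ^ 65 * (2 * z) ^ 32 * n ^ 2) := by gcongr
      _ = (C₁ : ℕ) * z ^ 32 * n ^ 2 := by simp only [C₁]; push_cast; ring
      _ ≤ (C₁ + C₂ + 22500 : ℕ) * z ^ (700 * K + 32) * n ^ 2 := by
        gcongr <;> omega
  · calc ((CutGraph.approximate.bnd ((2 * m * n) ^ 700) : ℕ) : ℝ)
        ≤ ((K * ((2 * m * n) ^ 700) ^ K : ℕ) : ℝ) := by exact_mod_cast hK _ hB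
      _ = K * (2 * m * n : ℝ) ^ (700 * K) := by rw [← pow_mul]; push_cast; rfl
      _ ≤ K * (2 * (2 * z) * n : ℝ) ^ (700 * K) := by gcongr
      _ = (C₂ : ℕ) * (z * n) ^ (700 * K) := by
        simp only [C₂]; push_cast
        rw [show 2 * (2 * z) * n = 4 * (z * n) by ring, mul_pow]; ring
      _ ≤ (C₁ + C₂ + 22500 : ℕ) * (z * n) ^ (700 * K + 32) := by
        have : 1 ≤ z * n := one_le_mul_of_one_le_of_one_le hz hn1
        gcongr <;> omega
  · refine mul_le_mul_of_nonneg_right ?_ (by positivity)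
    exact_mod_cast Nat.le_add_left _ _
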